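/- **Setting.** Let $H$ be a Hausdorff étale topological groupoid with locally compact Hausdorff unit space $H^0$ and range and source maps $r, s \colon H \to H^0$; write $H^y = r^{-1}(y)$. Let $C$ be an $H$-$C^*$-algebra: a $C_0(H^0)$-algebra (a $C^*$-algebra with a non-degenerate $*$-homomorphism $C_0(H^0) \to ZM(C)$), with fibres $C_y = C / \overline{C_0(H^0 \setminus \{y\})C}$ and associated upper semicontinuous $C^*$-bundle $\mathcal C = \bigsqcup_y C_y$, together with a continuous action of $H$ on $\mathcal C$ by $*$-isomorphisms $C_{s(h)} \to C_{r(h)}$, $c \mapsto h \cdot c$. Let $E$ be an $H$-Hilbert $C$-module: a right Hilbert $C$-module with fibres $E_y = E / \overline{C_0(H^0 \setminus \{y\})E}$ (Hilbert $C_y$-modules) and associated Banach bundle $\mathcal E = \bigsqcup_y E_y$, together with a continuous action of $H$ on $\mathcal E$ by isometric linear isomorphisms $E_{s(h)} \to E_{r(h)}$ such that $h \cdot (e \cdot c) = (h \cdot e) \cdot (h \cdot c)$ and $h \cdot \langle e, f \rangle = \langle h \cdot e, h \cdot f \rangle$. Let $\Omega$ be a Hausdorff right $H$-space with anchor map $\sigma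 \colon \Omega \to H^0$ that is * free: $\omega \cdot h = \omega$ implies $h \in H^0$, * proper: the map $(\omega, h) \mapsto (\omega \cdot h, \omega)$ from $\Omega \times_{\sigma, H^0, r} H$ to $\Omega \times \Omega$ is proper, * étale: $\sigma$ is a local homeomorphism. Let $\Gamma_c(H, s^*\mathcal C)$ be the space of compactly supported continuous sections $a$, with $a(h) \in C_{s(h)}$, and let $\Gamma_c(\Omega, \sigma^*\mathcal E)$ be the space of compactly supported continuous sections $\xi$, with $\xi(\omega) \in E_{\sigma(\omega)}$. The space $\Gamma_c(H, s^*\mathcal C)$ carries the operations $$(a * b)(g) = \sum_{h \in H^{s(g)}} (h \cdot a(gh))\, b(h^{-1}), \qquad a^*(g) = g^{-1} \cdot a(g^{-1})^*.$$ The full crossed product $H \ltimes C$ is the completion of this $*$-algebra in the maximal $C^*$-norm $\|a\| = \sup_\pi \|\pi(a)\|$, the supremum being over all $*$-representations $\pi$ on Hilbert spaces. Let $j \colon \Gamma_c(H, s^*\mathcal C) \to H \ltimes C$ be the canonical map. **Proposition (The crossed product Hilbert module).** The space $\Gamma_c(H, s^*\mathcal C)$ is closed under $*$ and ${}^*$,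 and the map $j$ is well defined (the supremum above is finite). For $\xi, \eta \in \Gamma_c(\Omega, \sigma^*\mathcal E)$ and $c \in \Gamma_c(H, s^*\mathcal C)$ the formulas $$\langle \xi, \eta \rangle(h) = \sum_{\omega \in \sigma^{-1}(r(h))} \langle h^{-1} \cdot \xi(\omega), \eta(\omega \cdot h) \rangle \in C_{s(h)} \qquad (h \in H),$$ $$(\xi \cdot c)(\omega) = \sum_{h \in H^{\sigma(\omega)}} (h \cdot \xi(\omega \cdot h)) \cdot c(h^{-1}) \in E_{\sigma(\omega)} \qquad (\omega \in \Omega)$$ define elements $\langle \xi, \eta \rangle \in \Gamma_c(H, s^*\mathcal C)$ and $\xi \cdot c \in \Gamma_c(\Omega, \sigma^*\mathcal E)$. There are a Hilbert $H \ltimes C$-module $\Omega \ltimes E$ and an injective linear map $\iota \colon \Gamma_c(\Omega, \sigma^*\mathcal E) \to \Omega \ltimes E$ with dense range such that $$\langle \iota(\xi), \iota(\eta) \rangle = j(\langle \xi, \eta \rangle), \qquad \iota(\xi) \cdot j(c) = \iota(\xi \cdot c)$$ for all $\xi, \eta \in \Gamma_c(\Omega, \sigma^*\mathcal E)$ and $c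 \in \Gamma_c(H, s^*\mathcal C)$. (In particular $j(\langle \xi, \xi \rangle) \ge 0$ in $H \ltimes C$.) -/

import Mathlib

open Topology
open scoped ZeroAtInfty MultiplierAlgebra ENNReal

universe uH uC uE uΩ

namespace GroupoidCrossedProduct

/-! ## Étale groupoids and their actions on spaces -/

/-- An étale topological groupoid structure on the space `H`: a subspace of units, range and
source maps, a multiplication of composable pairs (`mul g h _` is `gh`, defined for
`s g = r h`) and an inversion, all continuous, such that the range map is a local homeomorphism and
the unit space is open and locally compact. -/
structure EtaleGroupoid (H : Type uH) [TopologicalSpace H] where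
  units : Set H
  r : C(H, units)
  s : C(H, units)
  mul : (g h : H) → s g = r h → H
  inv : H → H
  continuous_mul : Continuous fun p : {p : H × H // s p.1 = r p.2} => mul p.1.1 p.1.2 p.2
  continuous_inv : Continuous inv
  r_unit : ∀ x : units, r x = x
  s_unit : ∀ x : units, s x = x
  r_mul : ∀ (g h : H) (e : s g = r h), r (mul g h e) = r g
  s_mul : ∀ (g h : H) (e : s g = r h), s (mul g h e) = s h
  mul_assoc : ∀ (g h k : H) (e : s g = r h) (e' : s h = r k),
    mul (mul g h e) k ((s_mul g h e).trans e') = mul g (mul h k e') (e.trans (r_mul h k e').symm)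
  unit_mul : ∀ g : H, mul (r g) g (s_unit (r g)) = g
  mul_unit : ∀ g : H, mul g (s g) (r_unit (s g)).symm = g
  r_inv : ∀ g : H, r (inv g) = s g
  s_inv : ∀ g : H, s (inv g) = r g
  inv_mul : ∀ g : H, mul (inv g) g (s_inv g) = (s g : H)
  mul_inv : ∀ g : H, mul g (inv g) (r_inv g).symm = (r g : H)
  isLocalHomeomorph_r : IsLocalHomeomorph r
  isOpen_units : IsOpen units
  locallyCompact_units : LocallyCompactSpace units

attribute [instance] EtaleGroupoid.locallyCompact_units

/-- A right action of the étale groupoid `G` on the space `Ω`, with anchor map `σ`;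
`act ω h _` is `ω · h`, defined for `σ ω = r h`. -/
structure RightSpaceAction {H : Type uH} [TopologicalSpace H] (G : EtaleGroupoid H)
    (Ω : Type uΩ) [TopologicalSpace Ω] where
  σ : C(Ω, G.units)
  act : (ω : Ω) → (h : H) → σ ω = G.r h → Ω
  continuous_act : Continuous fun p : {p : Ω × H // σ p.1 = G.r p.2} => act p.1.1 p.1.2 p.2
  σ_act : ∀ (ω : Ω) (h : H) (e : σ ω = G.r h), σ (act ω h e) = G.s h
  act_unit : ∀ ω : Ω, act ω (σ ω) (G.r_unit (σ ω)).symm = ω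
  act_mul : ∀ (ω : Ω) (h k : H) (e : σ ω = G.r h) (e' : G.s h = G.r k),
    act ω (G.mul h k e') (e.trans (G.r_mul h k e').symm)
      = act (act ω h e) k ((σ_act ω h e).trans e')

namespace RightSpaceAction

variable {H : Type uH} [TopologicalSpace H] {G : EtaleGroupoid H}
  {Ω : Type uΩ} [TopologicalSpace Ω]

/-- The action is free: `ω · h = ω` only if `h` is a unit. -/
def IsFree (ρ : RightSpaceAction G Ω) : Prop :=
  ∀ (ω : Ω) (h : H) (e : ρ.σ ω = G.r h), ρ.act ω h e = ω → h ∈ G.units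

/-- The action is proper: the map `(ω, h) ↦ (ω · h, ω)` on the fibre product is proper. -/
def IsProper (ρ : RightSpaceAction G Ω) : Prop :=
  IsProperMap fun p : {p : Ω × H // ρ.σ p.1 = G.r p.2} => (ρ.act p.1.1 p.1.2 p.2, p.1.1)

/-- The action is étale: the anchor map is a local homeomorphism. -/
def IsEtale (ρ : RightSpaceAction G Ω) : Prop :=
  IsLocalHomeomorph ρ.σ

end RightSpaceAction

/-! ## Fibres, the associated Banach bundle and its sections -/

section Bundle

variable {X : Type*} [TopologicalSpace X] {A ι : Type*} [NormedAddCommGroup A] [NormedSpace ℂ A]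

/-- Let `A` be a `C₀(X)`-Banach space whose action is described on a family `(aᵢ)` with dense span
by `m i f = f • aᵢ`. This is the closed subspace `closure (C₀(X ∖ {x}) A)` of `A`. -/
def fibreKer (m : ι → C₀(X, ℂ) →L[ℂ] A) (x : X) : Submodule ℂ A :=
  (Submodule.span ℂ {a | ∃ (i : ι) (f : C₀(X, ℂ)), f x = 0 ∧ m i f = a}).topologicalClosure

/-- The fibre `A_x = A / closure (C₀(X ∖ {x}) A)`, with the quotient norm. -/
def Fibre (m : ι → C₀(X, ℂ) →L[ℂ] A) (x : X) : Type _ := A ⧸ fibreKer m x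

instance isClosed_fibreKer (m : ι → C₀(X, ℂ) →L[ℂ] A) (x : X) :
    IsClosed (fibreKer m x : Set A) :=
  Submodule.isClosed_topologicalClosure _

noncomputable instance (m : ι → C₀(X, ℂ) →L[ℂ] A) (x : X) : NormedAddCommGroup (Fibre m x) :=
  Submodule.Quotient.normedAddCommGroup (fibreKer m x)

noncomputable instance (m : ι → C₀(X, ℂ) →L[ℂ] A) (x : X) : NormedSpace ℂ (Fibre m x) :=
  Submodule.Quotient.normedSpace (fibreKer m x) ℂ

/-- The quotient map `a ↦ a_x` from `A` to the fibre `A_x`. -/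
noncomputable def toFibre (m : ι → C₀(X, ℂ) →L[ℂ] A) (x : X) : A →ₗ[ℂ] Fibre m x :=
  (fibreKer m x).mkQ

theorem toFibre_surjective (m : ι → C₀(X, ℂ) →L[ℂ] A) (x : X) :
    Function.Surjective (toFibre m x) :=
  Submodule.mkQ_surjective _

theorem toFibre_eq_zero_iff (m : ι → C₀(X, ℂ) →L[ℂ] A) (x : X) (a : A) :
    toFibre m x a = 0 ↔ a ∈ fibreKer m x :=
  Submodule.Quotient.mk_eq_zero _

theorem norm_toFibre_le_norm (m : ι → C₀(X, ℂ) →L[ℂ] A) (x : X) (a : A) :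
    ‖toFibre m x a‖ ≤ ‖a‖ :=
  Submodule.Quotient.norm_mk_le (fibreKer m x) a

theorem exists_norm_lt (m : ι → C₀(X, ℂ) →L[ℂ] A) (x : X) (a : Fibre m x) {ε : ℝ} (hε : 0 < ε) :
    ∃ b : A, toFibre m x b = a ∧ ‖b‖ < ‖a‖ + ε :=
  Submodule.Quotient.norm_mk_lt (S := fibreKer m x) a hε

/-- The total space of the Banach bundle associated to `A`: the disjoint union of the fibres. -/
structure TotalSpace (m : ι → C₀(X, ℂ) →L[ℂ] A) where
  proj : X
  val : Fibre m proj

/-- The topology of the Banach bundle associated to `A`, with basic open sets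
`{b ∈ A_x | x ∈ U, ‖b - a_x‖ < ε}` for `a : A`, `U` open in `X` and `ε > 0`. -/
instance totalSpaceTopology (m : ι → C₀(X, ℂ) →L[ℂ] A) : TopologicalSpace (TotalSpace m) :=
  TopologicalSpace.generateFrom
    {W : Set (TotalSpace m) | ∃ (a : A) (U : Set X) (ε : ℝ), IsOpen U ∧ 0 < ε ∧
      W = {b : TotalSpace m | b.proj ∈ U ∧ ‖b.val - toFibre m b.proj a‖ < ε}}

/-- Transport of a section value along an equality of base points. -/
def Fibre.cast {m : ι → C₀(X, ℂ) →L[ℂ] A} {x y : X} (e : x = y) (a : Fibre m x) : Fibre m y :=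
  e ▸ a

/-- A (sesqui-)bilinear map that respects the kernels at `x` descends to the fibres at `x`. -/
noncomputable def fibreMap₂ {A₁ A₂ A₃ ι₁ ι₂ ι₃ : Type*}
    [NormedAddCommGroup A₁] [NormedSpace ℂ A₁] [NormedAddCommGroup A₂] [NormedSpace ℂ A₂]
    [NormedAddCommGroup A₃] [NormedSpace ℂ A₃] {τ : ℂ →+* ℂ}
    (m₁ : ι₁ → C₀(X, ℂ) →L[ℂ] A₁) (m₂ : ι₂ → C₀(X, ℂ) →L[ℂ] A₂) (m₃ : ι₃ → C₀(X, ℂ) →L[ℂ] A₃)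
    (x : X) (B : A₁ →ₛₗ[τ] A₂ →ₗ[ℂ] A₃)
    (h₁ : ∀ a ∈ fibreKer m₁ x, ∀ b, B a b ∈ fibreKer m₃ x)
    (h₂ : ∀ a, ∀ b ∈ fibreKer m₂ x, B a b ∈ fibreKer m₃ x) :
    Fibre m₁ x →ₛₗ[τ] Fibre m₂ x →ₗ[ℂ] Fibre m₃ x :=
  (fibreKer m₁ x).liftQ
    { toFun := fun a => (fibreKer m₂ x).liftQ ((toFibre m₃ x).comp (B a)) fun b hb =>
        (toFibre_eq_zero_iff _ _ _).2 (h₂ a b hb)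
      map_add' := fun a a' => Submodule.linearMap_qext _ <| LinearMap.ext fun b =>
        (congrArg (fun T : A₂ →ₗ[ℂ] A₃ => toFibre m₃ x (T b)) (map_add B a a')).trans
          (map_add (toFibre m₃ x) _ _)
      map_smul' := fun z a => Submodule.linearMap_qext _ <| LinearMap.ext fun b =>
        (congrArg (fun T : A₂ →ₗ[ℂ] A₃ => toFibre m₃ x (T b)) (map_smulₛₗ B z a)).trans
          (map_smul (toFibre m₃ x) _ _) }
    fun a ha => Submodule.linearMap_qext _ <| LinearMap.ext fun b =>
      (toFibre_eq_zero_iff m₃ x _).2 (h₁ a ha b)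

theorem exists_bump [T2Space X] [LocallyCompactSpace X] (x : X) :
    ∃ χ : C₀(X, ℂ), χ x = 1 ∧ ‖χ‖ ≤ 1 := by
  obtain ⟨f, hf1, -, hfc, hf⟩ := exists_continuous_one_zero_of_isCompact
    (isCompact_singleton (x := x)) (isClosed_empty (X := X)) (Set.disjoint_empty _)
  refine ⟨⟨⟨fun y => (f y : ℂ), by fun_prop⟩, ?_⟩, ?_, ?_⟩
  · have : HasCompactSupport fun y => (f y : ℂ) := by
      have := hfc.comp_left (g := fun t : ℝ => (t : ℂ)) (by simp)
      exact this
    exact this.is_zero_at_infty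
  · have := hf1 (Set.mem_singleton x)
    simp at this
    simp [this]
  · rw [← ZeroAtInftyContinuousMap.norm_toBCF_eq_norm]
    refine (BoundedContinuousFunction.norm_le zero_le_one).2 fun y => ?_
    have := hf y
    simp only [Set.mem_Icc] at this
    simpa [abs_le] using ⟨by linarith [this.1], this.2⟩

variable [T2Space X] [LocallyCompactSpace X]

theorem norm_toFibre_le (m : ι → C₀(X, ℂ) →L[ℂ] A) (i : ι) (f : C₀(X, ℂ)) (x : X) :
    ‖toFibre m x (m i f)‖ ≤ ‖f x‖ * ‖m i‖ := by
  obtain ⟨χ, hχ, hχ'⟩ := exists_bump x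
  have h : toFibre m x (m i f) = toFibre m x (m i (f x • χ)) := by
    rw [← sub_eq_zero, ← map_sub, toFibre_eq_zero_iff]
    refine Submodule.le_topologicalClosure _ (Submodule.subset_span ⟨i, f - f x • χ, ?_, ?_⟩)
    · simp [hχ]
    · simp
  rw [h]
  refine (norm_toFibre_le_norm _ _ _).trans (((m i).le_opNorm _).trans ?_)
  rw [norm_smul, mul_comm]
  gcongr
  nlinarith [norm_nonneg (f x)]

theorem tendsto_norm_toFibre (m : ι → C₀(X, ℂ) →L[ℂ] A) (x : X) {n : A}
    (hn : n ∈ Submodule.span ℂ {a | ∃ (i : ι) (f : C₀(X, ℂ)), f x = 0 ∧ m i f = a}) :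
    Filter.Tendsto (fun y => ‖toFibre m y n‖) (𝓝 x) (𝓝 0) := by
  induction hn using Submodule.span_induction with
  | mem a ha =>
    obtain ⟨i, f, hf, rfl⟩ := ha
    refine squeeze_zero (fun y => norm_nonneg _) (fun y => norm_toFibre_le m i f y) ?_
    have : Continuous fun y => ‖f y‖ * ‖m i‖ := by fun_prop
    simpa [hf] using this.tendsto x
  | zero => simp
  | add a b _ _ ha hb =>
    refine squeeze_zero (fun y => norm_nonneg _) (fun y => ?_) (by simpa using ha.add hb)
    rw [map_add]
    exact norm_add_le _ _
  | smul c a _ ha =>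
    have := ha.const_mul ‖c‖
    rw [mul_zero] at this
    refine this.congr fun y => ?_
    rw [map_smul, norm_smul]

/-- The norm of the section `x ↦ a_x` is upper semicontinuous. -/
theorem eventually_norm_toFibre_lt (m : ι → C₀(X, ℂ) →L[ℂ] A) (x : X) (a : A) {δ : ℝ}
    (h : ‖toFibre m x a‖ < δ) : ∀ᶠ y in 𝓝 x, ‖toFibre m y a‖ < δ := by
  obtain ⟨b, hb, hbδ⟩ := exists_norm_lt m x (toFibre m x a) (sub_pos.2 h)
  rw [add_sub_cancel] at hbδ
  have hab : a - b ∈ fibreKer m x := by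
    rw [← toFibre_eq_zero_iff, map_sub, hb, sub_self]
  obtain ⟨n, hn, hnd⟩ := Metric.mem_closure_iff.1 hab (δ - ‖b‖) (by linarith)
  have hlt : ‖a - n‖ < δ := by
    rw [dist_eq_norm] at hnd
    calc ‖a - n‖ = ‖b + (a - b - n)‖ := by congr 1; abel
      _ ≤ ‖b‖ + ‖a - b - n‖ := norm_add_le _ _
      _ < δ := by linarith
  filter_upwards [(tendsto_norm_toFibre m x hn).eventually (gt_mem_nhds (sub_pos.2 hlt))] with y hy
  calc ‖toFibre m y a‖ = ‖toFibre m y (a - n) + toFibre m y n‖ := by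
        rw [← map_add, sub_add_cancel]
    _ ≤ ‖toFibre m y (a - n)‖ + ‖toFibre m y n‖ := norm_add_le _ _
    _ ≤ ‖a - n‖ + ‖toFibre m y n‖ := by gcongr; exact norm_toFibre_le_norm _ _ _
    _ < δ := by linarith

/-- A section of a pullback bundle is continuous if and only if it is locally uniformly approximated
by the sections coming from elements of `A`. -/
theorem continuous_section_iff (m : ι → C₀(X, ℂ) →L[ℂ] A) {Y : Type*} [TopologicalSpace Y]
    (f : C(Y, X)) (ξ : ∀ y, Fibre m (f y)) :
    Continuous (fun y => (⟨f y, ξ y⟩ : TotalSpace m)) ↔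
      ∀ (y₀ : Y) (a : A), toFibre m (f y₀) a = ξ y₀ → ∀ ε > 0,
        ∀ᶠ y in 𝓝 y₀, ‖ξ y - toFibre m (f y) a‖ < ε := by
  constructor
  · intro h y₀ a ha ε hε
    have ho : IsOpen {b : TotalSpace m | b.proj ∈ Set.univ ∧ ‖b.val - toFibre m b.proj a‖ < ε} :=
      TopologicalSpace.isOpen_generateFrom_of_mem ⟨a, Set.univ, ε, isOpen_univ, hε, rfl⟩
    have := (ho.preimage h).mem_nhds (x := y₀) (by simp [ha, hε])
    filter_upwards [this] with y hy using hy.2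
  · intro h
    refine continuous_generateFrom_iff.2 ?_
    rintro W ⟨e, U, δ, hU, hδ, rfl⟩
    refine isOpen_iff_mem_nhds.2 ?_
    rintro y₀ ⟨hy₀, hlt⟩
    obtain ⟨a, ha⟩ := toFibre_surjective m _ (ξ y₀)
    have hlt' : ‖toFibre m (f y₀) (a - e)‖ < δ := by
      rw [map_sub, ha]; exact hlt
    obtain ⟨δ', h1, h2⟩ := exists_between hlt'
    have hev := (f.continuous.tendsto y₀).eventually (eventually_norm_toFibre_lt m _ _ h1)
    filter_upwards [hev, h y₀ a ha (δ - δ') (by linarith),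
      (hU.preimage f.continuous).mem_nhds hy₀] with y hy1 hy2 hy3
    refine ⟨hy3, ?_⟩
    calc ‖ξ y - toFibre m (f y) e‖
        = ‖(ξ y - toFibre m (f y) a) + toFibre m (f y) (a - e)‖ := by
          rw [map_sub]; congr 1; abel
      _ ≤ ‖ξ y - toFibre m (f y) a‖ + ‖toFibre m (f y) (a - e)‖ := norm_add_le _ _
      _ < δ := by linarith

/-- `Γ_c(Y, f^*𝒜)`: the compactly supported continuous sections of the pullback along `f : Y → X`
of the Banach bundle associated to `A`, as functions `ξ` with `ξ y ∈ A_{f y}`. -/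
def compactSections (m : ι → C₀(X, ℂ) →L[ℂ] A) {Y : Type*} [TopologicalSpace Y] (f : C(Y, X)) :
    Submodule ℂ (∀ y, Fibre m (f y)) where
  carrier := {ξ | Continuous (fun y => (⟨f y, ξ y⟩ : TotalSpace m)) ∧
    IsCompact (closure {y | ξ y ≠ 0})}
  zero_mem' := by
    refine ⟨(continuous_section_iff m f _).2 fun y₀ a ha ε hε => ?_, by simp⟩
    have h0 : ‖toFibre m (f y₀) a‖ < ε := by rw [ha]; simpa using hε
    filter_upwards [(f.continuous.tendsto y₀).eventually (eventually_norm_toFibre_lt m _ _ h0)]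
      with y hy
    simpa using hy
  add_mem' := by
    rintro ξ η ⟨hξ, hξ'⟩ ⟨hη, hη'⟩
    refine ⟨(continuous_section_iff m f _).2 fun y₀ c hc ε hε => ?_, ?_⟩
    · obtain ⟨a, ha⟩ := toFibre_surjective m _ (ξ y₀)
      have hb : toFibre m (f y₀) (c - a) = η y₀ := by
        rw [map_sub, ha, hc]; simp
      filter_upwards [(continuous_section_iff m f _).1 hξ y₀ a ha (ε / 2) (by positivity),
        (continuous_section_iff m f _).1 hη y₀ _ hb (ε / 2) (by positivity)] with y h1 h2
      calc ‖(ξ + η) y - toFibre m (f y) c‖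
          = ‖(ξ y - toFibre m (f y) a) + (η y - toFibre m (f y) (c - a))‖ := by
            rw [map_sub, Pi.add_apply]; congr 1; abel
        _ ≤ _ := norm_add_le _ _
        _ < ε := by linarith
    · refine (hξ'.union hη').of_isClosed_subset isClosed_closure ?_
      rw [← closure_union]
      refine closure_mono fun y hy => ?_
      by_contra hc
      simp only [Set.mem_union, Set.mem_ofPred_eq, not_or, not_not] at hc
      exact hy (by simp [hc.1, hc.2])
  smul_mem' := by
    rintro z ξ ⟨hξ, hξ'⟩
    refine ⟨(continuous_section_iff m f _).2 fun y₀ c hc ε hε => ?_, ?_⟩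
    · obtain ⟨a, ha⟩ := toFibre_surjective m _ (ξ y₀)
      have h0 : ‖toFibre m (f y₀) (z • a - c)‖ < ε / 2 := by
        rw [map_sub, map_smul, ha, hc]
        simpa using hε
      filter_upwards [(continuous_section_iff m f _).1 hξ y₀ a ha (ε / 2 / (‖z‖ + 1))
          (by positivity),
        (f.continuous.tendsto y₀).eventually (eventually_norm_toFibre_lt m _ _ h0)] with y h1 h2
      have h3 : ‖z‖ * ‖ξ y - toFibre m (f y) a‖ ≤ ε / 2 := by
        have hz : ‖z‖ / (‖z‖ + 1) ≤ 1 := (div_le_one (by positivity)).2 (by linarith)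
        calc ‖z‖ * ‖ξ y - toFibre m (f y) a‖ ≤ ‖z‖ * (ε / 2 / (‖z‖ + 1)) := by gcongr
          _ = (‖z‖ / (‖z‖ + 1)) * (ε / 2) := by ring
          _ ≤ 1 * (ε / 2) := by gcongr
          _ = ε / 2 := one_mul _
      calc ‖(z • ξ) y - toFibre m (f y) c‖
          = ‖z • (ξ y - toFibre m (f y) a) + toFibre m (f y) (z • a - c)‖ := by
            rw [map_sub, map_smul,
              Pi.smul_apply, smul_sub]
            congr 1; abel
        _ ≤ ‖z‖ * ‖ξ y - toFibre m (f y) a‖ + ‖toFibre m (f y) (z • a - c)‖ := by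
            rw [← norm_smul]; exact norm_add_le _ _
        _ < ε := by linarith
    · refine hξ'.of_isClosed_subset isClosed_closure (closure_mono fun y hy => ?_)
      exact fun h => hy (by simp [h])

/-- A (left) action of the étale groupoid `G` on the Banach bundle associated to `A`: for each
`g : x → y` (that is, `s g = x` and `r g = y`) an isometric linear isomorphism `A_x → A_y`,
compatible with units and multiplication, such that `(g, a) ↦ g · a` is continuous on
`{(g, a) | a ∈ A_{s g}}`. (The inverse of the bundle map is then `(g, b) ↦ g⁻¹ · b`, so it is
continuous as well.) -/
structure BundleAction {H : Type uH} [TopologicalSpace H] (G : EtaleGroupoid H)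
    {A ι : Type*} [NormedAddCommGroup A] [NormedSpace ℂ A]
    (m : ι → C₀(G.units, ℂ) →L[ℂ] A) where
  act : ∀ {x y : G.units} (g : H), G.s g = x → G.r g = y → (Fibre m x ≃ₗᵢ[ℂ] Fibre m y)
  act_unit : ∀ (x : G.units) (a : Fibre m x), act (x : H) (G.s_unit x) (G.r_unit x) a = a
  act_mul : ∀ {x y z : G.units} (g h : H) (hg : G.s g = y) (hg' : G.r g = z) (hh : G.s h = x)
    (hh' : G.r h = y) (a : Fibre m x),
    act (G.mul g h (hg.trans hh'.symm)) ((G.s_mul g h _).trans hh) ((G.r_mul g h _).trans hg') a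
      = act g hg hg' (act h hh hh' a)
  continuous_act : Continuous fun p : {p : H × TotalSpace m // G.s p.1 = p.2.proj} =>
    (⟨G.r p.1.1, act p.1.1 p.2 rfl p.1.2.val⟩ : TotalSpace m)

end Bundle

/-! ## `C₀(X)`-algebras -/

/-- A `C₀(X)`-algebra: a non-degenerate `*`-homomorphism from `C₀(X)` to the centre of the
multiplier algebra of `C`. -/
structure C0Algebra (X : Type*) [TopologicalSpace X] (C : Type*) [NonUnitalCStarAlgebra C] where
  toMultiplier : C₀(X, ℂ) →⋆ₙₐ[ℂ] 𝓜(ℂ, C)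
  central : ∀ (f : C₀(X, ℂ)) (k : 𝓜(ℂ, C)), toMultiplier f * k = k * toMultiplier f
  nondegenerate :
    Dense (Submodule.span ℂ {c : C | ∃ (f : C₀(X, ℂ)) (b : C), (toMultiplier f).fst b = c} : Set C)

namespace C0Algebra

variable {X : Type*} [TopologicalSpace X] {C : Type*} [NonUnitalCStarAlgebra C]
  (𝒞 : C0Algebra X C)

/-- The map `f ↦ f • b` from `C₀(X)` to `C`, for `b : C`. -/
noncomputable def orbit (b : C) : C₀(X, ℂ) →L[ℂ] C :=
  LinearMap.mkContinuous
    { toFun := fun f => (𝒞.toMultiplier f).fst b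
      map_add' := fun f g => by rw [map_add, DoubleCentralizer.add_fst]; rfl
      map_smul' := fun z f => by rw [map_smul, DoubleCentralizer.smul_fst]; rfl }
    ‖b‖ fun f => by
      have h1 := ((𝒞.toMultiplier f).fst).le_opNorm b
      rw [DoubleCentralizer.norm_fst] at h1
      have h2 : ‖𝒞.toMultiplier f‖ ≤ ‖f‖ := NonUnitalStarAlgHom.norm_apply_le _ f
      refine h1.trans ?_
      rw [mul_comm]
      gcongr

theorem orbit_apply (b : C) (f : C₀(X, ℂ)) : 𝒞.orbit b f = (𝒞.toMultiplier f).fst b := rfl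

theorem mul_fst (f : C₀(X, ℂ)) (b c : C) :
    b * (𝒞.toMultiplier f).fst c = (𝒞.toMultiplier f).fst (b * c) := by
  have h := congrArg (fun k : 𝓜(ℂ, C) => k.fst c) (𝒞.central f (DoubleCentralizer.coe ℂ b))
  simpa using h.symm

theorem fst_mul (f : C₀(X, ℂ)) (b c : C) :
    (𝒞.toMultiplier f).fst b * c = (𝒞.toMultiplier f).fst (b * c) := by
  have key : ∀ d : C,
      d * ((𝒞.toMultiplier f).fst b * c - (𝒞.toMultiplier f).fst (b * c)) = 0 := by
    intro d
    rw [mul_sub, ← mul_assoc, ← (𝒞.toMultiplier f).central, ← (𝒞.toMultiplier f).central,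
      mul_assoc, sub_self]
  have := key (star ((𝒞.toMultiplier f).fst b * c - (𝒞.toMultiplier f).fst (b * c)))
  rwa [CStarRing.star_mul_self_eq_zero_iff, sub_eq_zero] at this

theorem snd_eq_fst (f : C₀(X, ℂ)) (b : C) :
    (𝒞.toMultiplier f).snd b = (𝒞.toMultiplier f).fst b := by
  have key : ∀ c : C, ((𝒞.toMultiplier f).snd b - (𝒞.toMultiplier f).fst b) * c = 0 := by
    intro c
    have h := 𝒞.fst_mul f b c
    have h' := (𝒞.toMultiplier f).central b c
    have h'' := 𝒞.mul_fst f b c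
    rw [sub_mul, h', h'', h, sub_self]
  have := key (star ((𝒞.toMultiplier f).snd b - (𝒞.toMultiplier f).fst b))
  rwa [CStarRing.mul_star_self_eq_zero_iff, sub_eq_zero] at this

theorem star_fst (f : C₀(X, ℂ)) (b : C) :
    star ((𝒞.toMultiplier f).fst b) = (𝒞.toMultiplier (star f)).fst (star b) := by
  have h : 𝒞.toMultiplier (star f) = star (𝒞.toMultiplier f) := map_star 𝒞.toMultiplier f
  rw [h, DoubleCentralizer.star_fst, star_star, snd_eq_fst]

theorem mul_mem_right (x : X) (a : C) {b : C} (hb : b ∈ fibreKer 𝒞.orbit x) :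
    a * b ∈ fibreKer 𝒞.orbit x := by
  have : fibreKer 𝒞.orbit x ≤ (fibreKer 𝒞.orbit x).comap (LinearMap.mulLeft ℂ a) := by
    refine Submodule.topologicalClosure_minimal _ (Submodule.span_le.2 ?_) ?_
    · rintro _ ⟨i, f, hf, rfl⟩
      refine Submodule.le_topologicalClosure _ (Submodule.subset_span ⟨a * i, f, hf, ?_⟩)
      exact (𝒞.mul_fst f a i).symm
    · exact (isClosed_fibreKer 𝒞.orbit x).preimage (continuous_const_mul a)
  exact this hb

theorem mul_mem_left (x : X) {a : C} (b : C) (ha : a ∈ fibreKer 𝒞.orbit x) :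
    a * b ∈ fibreKer 𝒞.orbit x := by
  have : fibreKer 𝒞.orbit x ≤ (fibreKer 𝒞.orbit x).comap (LinearMap.mulRight ℂ b) := by
    refine Submodule.topologicalClosure_minimal _ (Submodule.span_le.2 ?_) ?_
    · rintro _ ⟨i, f, hf, rfl⟩
      refine Submodule.le_topologicalClosure _ (Submodule.subset_span ⟨i * b, f, hf, ?_⟩)
      exact (𝒞.fst_mul f i b).symm
    · exact (isClosed_fibreKer 𝒞.orbit x).preimage (continuous_mul_const b)
  exact this ha

theorem star_mem (x : X) {a : C} (ha : a ∈ fibreKer 𝒞.orbit x) :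
    star a ∈ fibreKer 𝒞.orbit x := by
  have : fibreKer 𝒞.orbit x ≤ (fibreKer 𝒞.orbit x).comap
      (starLinearEquiv ℂ : C ≃ₗ⋆[ℂ] C).toLinearMap := by
    refine Submodule.topologicalClosure_minimal _ (Submodule.span_le.2 ?_) ?_
    · rintro _ ⟨i, f, hf, rfl⟩
      refine Submodule.le_topologicalClosure _
        (Submodule.subset_span ⟨star i, star f, by simp [hf], ?_⟩)
      exact (𝒞.star_fst f i).symm
    · exact (isClosed_fibreKer 𝒞.orbit x).preimage continuous_star
  exact this ha

/-- The multiplication of the fibre `C_x`: `a_x * b_x = (a * b)_x`. -/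
noncomputable def fibreMul (x : X) :
    Fibre 𝒞.orbit x →ₗ[ℂ] Fibre 𝒞.orbit x →ₗ[ℂ] Fibre 𝒞.orbit x :=
  fibreMap₂ 𝒞.orbit 𝒞.orbit 𝒞.orbit x (LinearMap.mul ℂ C)
    (fun _ ha b => 𝒞.mul_mem_left x b ha) (fun a _ hb => 𝒞.mul_mem_right x a hb)

theorem fibreMul_toFibre (x : X) (a b : C) :
    𝒞.fibreMul x (toFibre _ x a) (toFibre _ x b) = toFibre _ x (a * b) := rfl

/-- The involution of the fibre `C_x`: `(a_x)^* = (a^*)_x`. -/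
noncomputable def fibreStar (x : X) : Fibre 𝒞.orbit x →ₗ⋆[ℂ] Fibre 𝒞.orbit x :=
  (fibreKer 𝒞.orbit x).mapQ (fibreKer 𝒞.orbit x) (starLinearEquiv ℂ : C ≃ₗ⋆[ℂ] C).toLinearMap
    fun _ ha => 𝒞.star_mem x ha

theorem fibreStar_toFibre (x : X) (a : C) :
    𝒞.fibreStar x (toFibre _ x a) = toFibre _ x (star a) := rfl

end C0Algebra

/-! ## Hilbert modules -/

/-- A (right) Hilbert `A`-module structure on the complex normed space `E`: a right `A`-module
structure together with an `A`-valued inner product, conjugate-linear in the first and linear in the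
second variable, whose norm is that of `E` and for which `E` is complete. Here positivity of
`⟨x, x⟩` in the C⋆-algebra `A` is expressed as `⟨x, x⟩ = b^* b`. Mathlib's `CStarModule`
has the convention `⟨x, a • y⟩ = a * ⟨x, y⟩`, whereas here `⟨x, y • a⟩ = ⟨x, y⟩ * a`. -/
structure HilbertModule (A : Type*) [NonUnitalCStarAlgebra A] (E : Type*) [NormedAddCommGroup E]
    [NormedSpace ℂ E] where
  inner : E → E → A
  rsmul : E → A → E
  inner_add_right : ∀ x y z, inner x (y + z) = inner x y + inner x z
  inner_smul_right : ∀ (x y) (z : ℂ), inner x (z • y) = z • inner x y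
  star_inner : ∀ x y, star (inner x y) = inner y x
  inner_rsmul_right : ∀ x y a, inner x (rsmul y a) = inner x y * a
  inner_self_nonneg : ∀ x, ∃ b : A, inner x x = star b * b
  norm_sq_eq : ∀ x, ‖x‖ ^ 2 = ‖inner x x‖
  add_rsmul : ∀ x y a, rsmul (x + y) a = rsmul x a + rsmul y a
  rsmul_add : ∀ x a b, rsmul x (a + b) = rsmul x a + rsmul x b
  rsmul_mul : ∀ x a b, rsmul x (a * b) = rsmul (rsmul x a) b
  smul_rsmul : ∀ (z : ℂ) (x a), rsmul (z • x) a = z • rsmul x a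
  rsmul_smul : ∀ (z : ℂ) (x a), rsmul x (z • a) = z • rsmul x a
  complete : CompleteSpace E

namespace HilbertModule

section General

variable {A : Type*} [NonUnitalCStarAlgebra A] {E : Type*} [NormedAddCommGroup E]
  [NormedSpace ℂ E] (𝓔 : HilbertModule A E)

theorem norm_inner_le (x y : E) : ‖𝓔.inner x y‖ ≤ ‖x‖ * ‖y‖ := by
  let : PartialOrder A := CStarAlgebra.spectralOrder A
  have : StarOrderedRing A := CStarAlgebra.spectralOrderedRing A
  let : SMul Aᵐᵒᵖ E := ⟨fun a x => 𝓔.rsmul x a.unop⟩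
  let : CStarModule Aᵐᵒᵖ E :=
    { inner := fun x y => MulOpposite.op (𝓔.inner x y)
      inner_add_right := by intros; simp [𝓔.inner_add_right]
      inner_self_nonneg := by
        intro x
        obtain ⟨b, hb⟩ := 𝓔.inner_self_nonneg x
        rw [← MulOpposite.unop_nonneg, MulOpposite.unop_op, hb]
        exact star_mul_self_nonneg b
      inner_self := by
        intro x
        rw [MulOpposite.op_eq_zero_iff, ← norm_eq_zero, ← 𝓔.norm_sq_eq]
        simp
      inner_op_smul_right := by
        intro a x y
        exact congrArg MulOpposite.op (𝓔.inner_rsmul_right x y a.unop)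
      inner_smul_right_complex := by intros; simp [𝓔.inner_smul_right]
      star_inner := fun x y => congrArg MulOpposite.op (𝓔.star_inner x y)
      norm_eq_sqrt_norm_inner_self := by
        intro x
        rw [MulOpposite.norm_op, ← 𝓔.norm_sq_eq, Real.sqrt_sq (norm_nonneg x)] }
  exact CStarModule.norm_inner_le (A := Aᵐᵒᵖ) E (x := x) (y := y)

theorem inner_add_left (x y z : E) : 𝓔.inner (x + y) z = 𝓔.inner x z + 𝓔.inner y z := by
  rw [← 𝓔.star_inner, 𝓔.inner_add_right, star_add, 𝓔.star_inner, 𝓔.star_inner]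

theorem inner_smul_left (x y : E) (z : ℂ) : 𝓔.inner (z • x) y = star z • 𝓔.inner x y := by
  rw [← 𝓔.star_inner, 𝓔.inner_smul_right, star_smul, 𝓔.star_inner]

theorem norm_rsmul_le (x : E) (a : A) : ‖𝓔.rsmul x a‖ ≤ ‖x‖ * ‖a‖ := by
  have h : 𝓔.inner (𝓔.rsmul x a) (𝓔.rsmul x a) = star a * 𝓔.inner x x * a := by
    rw [𝓔.inner_rsmul_right, ← 𝓔.star_inner, 𝓔.inner_rsmul_right, star_mul, 𝓔.star_inner]
  refine abs_le_of_sq_le_sq' ?_ (by positivity) |>.2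
  rw [𝓔.norm_sq_eq, h, mul_pow, 𝓔.norm_sq_eq]
  refine (norm_mul_le _ _).trans ?_
  calc ‖star a * 𝓔.inner x x‖ * ‖a‖ ≤ ‖star a‖ * ‖𝓔.inner x x‖ * ‖a‖ := by
        gcongr; exact norm_mul_le _ _
    _ = ‖𝓔.inner x x‖ * ‖a‖ ^ 2 := by rw [norm_star]; ring

/-- The inner product as a sesquilinear map. -/
def innerₛₗ : E →ₗ⋆[ℂ] E →ₗ[ℂ] A where
  toFun x :=
    { toFun := 𝓔.inner x
      map_add' := 𝓔.inner_add_right x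
      map_smul' := fun z y => 𝓔.inner_smul_right x y z }
  map_add' x y := by ext z; exact 𝓔.inner_add_left x y z
  map_smul' z x := by ext y; exact 𝓔.inner_smul_left x y z

/-- The right action as a bilinear map. -/
def rsmulₗ : E →ₗ[ℂ] A →ₗ[ℂ] E where
  toFun x :=
    { toFun := 𝓔.rsmul x
      map_add' := 𝓔.rsmul_add x
      map_smul' := fun z a => 𝓔.rsmul_smul z x a }
  map_add' x y := by ext a; exact 𝓔.add_rsmul x y a
  map_smul' z x := by ext a; exact 𝓔.smul_rsmul z x a

theorem continuous_inner_right (x : E) : Continuous (𝓔.inner x) :=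
  ((𝓔.innerₛₗ x).mkContinuous ‖x‖ (𝓔.norm_inner_le x)).continuous

theorem continuous_rsmul_right (x : E) : Continuous (𝓔.rsmul x) :=
  ((𝓔.rsmulₗ x).mkContinuous ‖x‖ (𝓔.norm_rsmul_le x)).continuous

theorem continuous_rsmul_left (a : A) : Continuous fun x => 𝓔.rsmul x a :=
  ((𝓔.rsmulₗ.flip a).mkContinuous ‖a‖
    fun x => (𝓔.norm_rsmul_le x a).trans_eq (mul_comm _ _)).continuous

end General

section Fibres

variable {X : Type*} [TopologicalSpace X] {C : Type*} [NonUnitalCStarAlgebra C]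
  (𝒞 : C0Algebra X C) {E : Type*} [NormedAddCommGroup E] [NormedSpace ℂ E]
  (𝓔 : HilbertModule C E)

/-- A Hilbert module `E` over a `C₀(X)`-algebra `C` is a `C₀(X)`-Banach space by
`f • (e • b) = e • (f • b)` for `e : E`, `b : C`, where the `e • b` have dense span in `E`. For
`p = (e, b)` this is the map `f ↦ f • (e • b)` from `C₀(X)` to `E`. Thus
`Fibre (𝓔.orbit 𝒞) x` is the fibre `E_x = E / closure (C₀(X ∖ {x}) E)`. -/
noncomputable def orbit (p : E × C) : C₀(X, ℂ) →L[ℂ] E :=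
  ((𝓔.rsmulₗ p.1).mkContinuous ‖p.1‖ (𝓔.norm_rsmul_le p.1)).comp (𝒞.orbit p.2)

theorem orbit_apply (p : E × C) (f : C₀(X, ℂ)) :
    𝓔.orbit 𝒞 p f = 𝓔.rsmul p.1 ((𝒞.toMultiplier f).fst p.2) := rfl

theorem inner_mem (x : X) (d : E) {e : E} (he : e ∈ fibreKer (𝓔.orbit 𝒞) x) :
    𝓔.inner d e ∈ fibreKer 𝒞.orbit x := by
  have : fibreKer (𝓔.orbit 𝒞) x ≤ (fibreKer 𝒞.orbit x).comap (𝓔.innerₛₗ d) := by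
    refine Submodule.topologicalClosure_minimal _ (Submodule.span_le.2 ?_) ?_
    · rintro _ ⟨p, f, hf, rfl⟩
      refine Submodule.le_topologicalClosure _
        (Submodule.subset_span ⟨𝓔.inner d p.1 * p.2, f, hf, ?_⟩)
      change _ = 𝓔.inner d (𝓔.rsmul p.1 ((𝒞.toMultiplier f).fst p.2))
      rw [𝓔.inner_rsmul_right, 𝒞.mul_fst]
      rfl
    · exact (isClosed_fibreKer 𝒞.orbit x).preimage (𝓔.continuous_inner_right d)
  exact this he

theorem inner_mem' (x : X) {d : E} (e : E) (hd : d ∈ fibreKer (𝓔.orbit 𝒞) x) :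
    𝓔.inner d e ∈ fibreKer 𝒞.orbit x := by
  rw [← 𝓔.star_inner]
  exact 𝒞.star_mem x (𝓔.inner_mem 𝒞 x e hd)

theorem rsmul_mem_left (x : X) {e : E} (b : C) (he : e ∈ fibreKer (𝓔.orbit 𝒞) x) :
    𝓔.rsmul e b ∈ fibreKer (𝓔.orbit 𝒞) x := by
  have : fibreKer (𝓔.orbit 𝒞) x ≤ (fibreKer (𝓔.orbit 𝒞) x).comap (𝓔.rsmulₗ.flip b) := by
    refine Submodule.topologicalClosure_minimal _ (Submodule.span_le.2 ?_) ?_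
    · rintro _ ⟨p, f, hf, rfl⟩
      refine Submodule.le_topologicalClosure _
        (Submodule.subset_span ⟨(p.1, p.2 * b), f, hf, ?_⟩)
      change _ = 𝓔.rsmul (𝓔.rsmul p.1 ((𝒞.toMultiplier f).fst p.2)) b
      rw [orbit_apply, ← 𝒞.fst_mul, 𝓔.rsmul_mul]
    · exact (isClosed_fibreKer (𝓔.orbit 𝒞) x).preimage (𝓔.continuous_rsmul_left b)
  exact this he

theorem rsmul_mem_right (x : X) (e : E) {b : C} (hb : b ∈ fibreKer 𝒞.orbit x) :
    𝓔.rsmul e b ∈ fibreKer (𝓔.orbit 𝒞) x := by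
  have : fibreKer 𝒞.orbit x ≤ (fibreKer (𝓔.orbit 𝒞) x).comap (𝓔.rsmulₗ e) := by
    refine Submodule.topologicalClosure_minimal _ (Submodule.span_le.2 ?_) ?_
    · rintro _ ⟨c, f, hf, rfl⟩
      exact Submodule.le_topologicalClosure _ (Submodule.subset_span ⟨(e, c), f, hf, rfl⟩)
    · exact (isClosed_fibreKer (𝓔.orbit 𝒞) x).preimage (𝓔.continuous_rsmul_right e)
  exact this hb

/-- The `C_x`-valued inner product of the fibre `E_x`: `⟨d_x, e_x⟩ = ⟨d, e⟩_x`. -/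
noncomputable def fibreInner (x : X) :
    Fibre (𝓔.orbit 𝒞) x →ₗ⋆[ℂ] Fibre (𝓔.orbit 𝒞) x →ₗ[ℂ] Fibre 𝒞.orbit x :=
  fibreMap₂ (𝓔.orbit 𝒞) (𝓔.orbit 𝒞) 𝒞.orbit x 𝓔.innerₛₗ
    (fun _ hd e => 𝓔.inner_mem' 𝒞 x e hd) (fun d _ he => 𝓔.inner_mem 𝒞 x d he)

theorem fibreInner_toFibre (x : X) (d e : E) :
    𝓔.fibreInner 𝒞 x (toFibre _ x d) (toFibre _ x e) = toFibre _ x (𝓔.inner d e) := rfl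

/-- The right action of `C_x` on the fibre `E_x`: `e_x • b_x = (e • b)_x`. -/
noncomputable def fibreRsmul (x : X) :
    Fibre (𝓔.orbit 𝒞) x →ₗ[ℂ] Fibre 𝒞.orbit x →ₗ[ℂ] Fibre (𝓔.orbit 𝒞) x :=
  fibreMap₂ (𝓔.orbit 𝒞) 𝒞.orbit (𝓔.orbit 𝒞) x 𝓔.rsmulₗ
    (fun _ he b => 𝓔.rsmul_mem_left 𝒞 x b he) (fun e _ hb => 𝓔.rsmul_mem_right 𝒞 x e hb)

theorem fibreRsmul_toFibre (x : X) (e : E) (b : C) :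
    𝓔.fibreRsmul 𝒞 x (toFibre _ x e) (toFibre _ x b) = toFibre _ x (𝓔.rsmul e b) := rfl

end Fibres

end HilbertModule

/-! ## Equivariance -/

noncomputable section Equivariant

variable {H : Type uH} [TopologicalSpace H] [T2Space H] {G : EtaleGroupoid H}

/-- The structure of a `G`-C⋆-algebra on the `C₀(G⁰)`-algebra `C`: an action of `G` on the
associated Banach bundle such that every `C_{s g} → C_{r g}` is a `*`-isomorphism. -/
structure CStarAction (G : EtaleGroupoid H) {C : Type uC} [NonUnitalCStarAlgebra C]
    (𝒞 : C0Algebra G.units C) extends BundleAction G 𝒞.orbit where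
  act_fibreMul : ∀ {x y : G.units} (g : H) (hs : G.s g = x) (hr : G.r g = y)
    (a b : Fibre 𝒞.orbit x),
    act g hs hr (𝒞.fibreMul x a b) = 𝒞.fibreMul y (act g hs hr a) (act g hs hr b)
  act_fibreStar : ∀ {x y : G.units} (g : H) (hs : G.s g = x) (hr : G.r g = y)
    (a : Fibre 𝒞.orbit x),
    act g hs hr (𝒞.fibreStar x a) = 𝒞.fibreStar y (act g hs hr a)

/-- The structure of a `G`-Hilbert `C`-module on the Hilbert `C`-module `E`: an action of `G` on the
associated Banach bundle which is compatible with the right action of `C` and the inner product. -/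
structure HilbertAction {C : Type uC} [NonUnitalCStarAlgebra C] {𝒞 : C0Algebra G.units C}
    (α : CStarAction G 𝒞) {E : Type uE} [NormedAddCommGroup E] [NormedSpace ℂ E]
    (𝓔 : HilbertModule C E) extends BundleAction G (𝓔.orbit 𝒞) where
  act_fibreRsmul : ∀ {x y : G.units} (g : H) (hs : G.s g = x) (hr : G.r g = y)
    (e : Fibre (𝓔.orbit 𝒞) x) (b : Fibre 𝒞.orbit x),
    act g hs hr (𝓔.fibreRsmul 𝒞 x e b) = 𝓔.fibreRsmul 𝒞 y (act g hs hr e) (α.act g hs hr b)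
  act_fibreInner : ∀ {x y : G.units} (g : H) (hs : G.s g = x) (hr : G.r g = y)
    (d e : Fibre (𝓔.orbit 𝒞) x),
    α.act g hs hr (𝓔.fibreInner 𝒞 x d e) = 𝓔.fibreInner 𝒞 y (act g hs hr d) (act g hs hr e)

namespace CStarAction

variable {C : Type uC} [NonUnitalCStarAlgebra C] {𝒞 : C0Algebra G.units C} (α : CStarAction G 𝒞)

/-- The space `Γ_c(G, s^*𝒞)`. -/
abbrev Sections (_ : CStarAction G 𝒞) : Submodule ℂ (∀ g, Fibre 𝒞.orbit (G.s g)) :=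
  compactSections 𝒞.orbit G.s

/-- The convolution `(a * b)(g) = ∑_{h ∈ G^{s g}} (h · a(gh)) b(h⁻¹)`. -/
def conv (a b : ∀ g, Fibre 𝒞.orbit (G.s g)) (g : H) : Fibre 𝒞.orbit (G.s g) :=
  ∑ᶠ h : {h : H // G.r h = G.s g},
    𝒞.fibreMul (G.s g)
      (α.act h.1 (G.s_mul g h.1 h.2.symm).symm h.2 (a (G.mul g h.1 h.2.symm)))
      (Fibre.cast ((G.s_inv h.1).trans h.2) (b (G.inv h.1)))

/-- The involution `a^*(g) = g⁻¹ · a(g⁻¹)^*`. -/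
def invol (a : ∀ g, Fibre 𝒞.orbit (G.s g)) (g : H) : Fibre 𝒞.orbit (G.s g) :=
  α.act (G.inv g) rfl (G.r_inv g) (𝒞.fibreStar (G.s (G.inv g)) (a (G.inv g)))

/-- A `*`-representation of the `*`-algebra `Γ_c(G, s^*𝒞)` on a Hilbert space. -/
structure Representation where
  K : Type (max uH uC)
  [normedAddCommGroup : NormedAddCommGroup K]
  [innerProductSpace : InnerProductSpace ℂ K]
  [completeSpace : CompleteSpace K]
  π : α.Sections →ₗ[ℂ] (K →L[ℂ] K)
  map_conv : ∀ a b c : α.Sections, (∀ g, c.1 g = α.conv a.1 b.1 g) → π c = π a * π b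
  map_invol : ∀ a b : α.Sections, (∀ g, b.1 g = α.invol a.1 g) → π b = star (π a)

attribute [instance] Representation.normedAddCommGroup Representation.innerProductSpace
  Representation.completeSpace

/-- The C⋆-algebra of bounded families of operators, one on each of the representation spaces. -/
abbrev UniversalOperators := lp (fun R : α.Representation => R.K →L[ℂ] R.K) ∞

/-- The full crossed product `G ⋉ C`, as a closed `*`-subalgebra: the closure of the image of
`Γ_c(G, s^*𝒞)` under the direct sum of all its `*`-representations on Hilbert spaces. -/
def crossedProduct : NonUnitalStarSubalgebra ℂ α.UniversalOperators :=
  (NonUnitalStarAlgebra.adjoin ℂ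
    {T : α.UniversalOperators | ∃ a : α.Sections, ∀ R, T R = R.π a}).topologicalClosure

instance isClosed_crossedProduct : IsClosed (α.crossedProduct : Set α.UniversalOperators) :=
  NonUnitalStarSubalgebra.isClosed_topologicalClosure _

/-- The full crossed product `G ⋉ C`, that is, the completion of `Γ_c(G, s^*𝒞)` in the maximal
C⋆-norm `‖a‖ = sup ‖π a‖` over all `*`-representations `π`. -/
abbrev CrossedProduct : Type _ := α.crossedProduct

/-- `j` is the canonical map `Γ_c(G, s^*𝒞) → G ⋉ C`, that is `j a = (π a)_π`. -/
def IsCanonicalMap (j : α.Sections →ₗ[ℂ] α.CrossedProduct) : Prop :=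
  ∀ (a : α.Sections) (R : α.Representation), (j a).1 R = R.π a

end CStarAction

namespace HilbertAction

variable {C : Type uC} [NonUnitalCStarAlgebra C] {𝒞 : C0Algebra G.units C} {α : CStarAction G 𝒞}
  {E : Type uE} [NormedAddCommGroup E] [NormedSpace ℂ E] {𝓔 : HilbertModule C E}
  {Ω : Type uΩ} [TopologicalSpace Ω]

/-- The space `Γ_c(Ω, σ^*𝓔)`. -/
abbrev Sections (_ : HilbertAction α 𝓔) (ρ : RightSpaceAction G Ω) :
    Submodule ℂ (∀ ω, Fibre (𝓔.orbit 𝒞) (ρ.σ ω)) :=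
  compactSections (𝓔.orbit 𝒞) ρ.σ

variable (β : HilbertAction α 𝓔) (ρ : RightSpaceAction G Ω)

/-- The inner product `⟨ξ, η⟩(h) = ∑_{ω ∈ Ω_{r h}} ⟨h⁻¹ · ξ(ω), η(ω · h)⟩ ∈ C_{s h}`. -/
def sectionInner (ξ η : ∀ ω, Fibre (𝓔.orbit 𝒞) (ρ.σ ω)) (h : H) :
    Fibre 𝒞.orbit (G.s h) :=
  ∑ᶠ ω : {ω : Ω // ρ.σ ω = G.r h},
    𝓔.fibreInner 𝒞 (G.s h)
      (β.act (G.inv h) ((G.s_inv h).trans ω.2.symm) (G.r_inv h) (ξ ω.1))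
      (Fibre.cast (ρ.σ_act ω.1 h ω.2) (η (ρ.act ω.1 h ω.2)))

/-- The right action `(ξ · c)(ω) = ∑_{h ∈ G^{σ ω}} (h · ξ(ω · h)) · c(h⁻¹) ∈ E_{σ ω}`. -/
def sectionRsmul (ξ : ∀ ω, Fibre (𝓔.orbit 𝒞) (ρ.σ ω))
    (c : ∀ h, Fibre 𝒞.orbit (G.s h)) (ω : Ω) : Fibre (𝓔.orbit 𝒞) (ρ.σ ω) :=
  ∑ᶠ h : {h : H // G.r h = ρ.σ ω},
    𝓔.fibreRsmul 𝒞 (ρ.σ ω)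
      (β.act h.1 (ρ.σ_act ω h.1 h.2.symm).symm h.2 (ξ (ρ.act ω h.1 h.2.symm)))
      (Fibre.cast ((G.s_inv h.1).trans h.2) (c (G.inv h.1)))

end HilbertAction

end Equivariant

end GroupoidCrossedProduct

open GroupoidCrossedProduct

/-! The module `Ω ⋉ E` is the completion of `Γ_c(Ω, σ^*𝓔)`, viewed as a pre-Hilbert module over the
dense image of `j`. The algebraic identities `⟨ξ, η⟩^* = ⟨η, ξ⟩` and `⟨ξ, η · c⟩ = ⟨ξ, η⟩ * c` are
changes of variables in finite sums. That the formulas define compactly supported continuous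
sections follows from one statement on sums over the fibres of a local homeomorphism
(`finsum_fibre_mem_compactSections`). Four points carry the rest.

Existence of `j`. If `a` vanishes off a set on which `r` and `s` are injective, then `a^* * a` lives
on the units. There a representation restricts to a `*`-homomorphism of a C⋆-algebra of sections,
which is contractive, so `‖π(a)‖ ≤ sup ‖a(g)‖`. A partition of unity extends this to a bound,
uniform in `π`, for every section (`exists_norm_π_le`).

Positivity. The full crossed product has too many representations to test positivity fibrewise, so
`⟨ξ, ξ⟩` is written explicitly as a finite sum of elements `b^* * b`. (a) Reduction to `Ω = H`: let
`φ_i` sum to one on the support of `ξ`, with `σ` injective on the support of each `φ_i`. Their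
summed orbit sum `Ψ(ω) = ∑_i ∑_k φ_i(ω · k)` is invariant, is continuous by properness, and is at
least `1` where `ξ ≠ 0`. With `ζ = Ψ^{-1/2} ξ` and `a_i(h) = ∑_w √φ_i(w) ζ(w · h)` one finds `⟨ξ, ξ⟩
= ∑_i ⟨a_i, a_i⟩` (`exists_sectionInner_eq_sum_self`). (b) The case of `H`: a section has the form
`a(h) = h⁻¹ · ∑_l θ_l(h) x_l(r h)`. The Gram matrix of the `x_l` is positive over the C⋆-algebra of
bounded continuous sections, hence equals `B^* B`. Replacing the `x_l` by the entries `B_{pl}` turns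
`a` into sections `b_p` with `⟨a, a⟩ = ∑_p b_p^* * b_p` (`exists_sectionInner_self_eq`).

Definiteness. At a unit `y` the value of `⟨ξ, ξ⟩` is `∑ ⟨ξ(ω), ξ(ω)⟩`, a sum of positive elements of
the C⋆-algebra `C_y`, and the inner product of `E_y` is definite. Regular representations on
`ℓ²(H_y, K)` show that `j` is injective (`canonicalMap_injective`), so nothing is divided out and
`ι` is injective.

Completion. Cauchy–Schwarz needs multiplication only by values of the inner product, which lie in
the range of `j`. The product `y · a` in the completion is then found as the vector representing the
functional `x ↦ ⟨x, y⟩ a` (`exists_hilbertModule`). -/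

namespace GroupoidCrossedProduct

/-! ## Continuity of sections at a point -/

section BundleContinuity

open Filter

variable {X : Type*} [TopologicalSpace X] {A ι : Type*} [NormedAddCommGroup A] [NormedSpace ℂ A]

theorem Fibre.mk_cast {m : ι → C₀(X, ℂ) →L[ℂ] A} {x y : X} (e : x = y) (a : Fibre m x) :
    (⟨y, Fibre.cast e a⟩ : TotalSpace m) = ⟨x, a⟩ := by
  subst e; rfl

@[simp] theorem Fibre.cast_rfl {m : ι → C₀(X, ℂ) →L[ℂ] A} {x : X} (e : x = x) (a : Fibre m x) :
    Fibre.cast e a = a := rfl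

theorem Fibre.norm_cast {m : ι → C₀(X, ℂ) →L[ℂ] A} {x y : X} (e : x = y) (a : Fibre m x) :
    ‖Fibre.cast e a‖ = ‖a‖ := by
  subst e; rfl

@[simp] theorem Fibre.cast_zero {m : ι → C₀(X, ℂ) →L[ℂ] A} {x y : X} (e : x = y) :
    Fibre.cast e (0 : Fibre m x) = 0 := by
  subst e; rfl

@[simp] theorem Fibre.cast_eq_zero {m : ι → C₀(X, ℂ) →L[ℂ] A} {x y : X} (e : x = y)
    (a : Fibre m x) : Fibre.cast e a = 0 ↔ a = 0 := by
  subst e; rfl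

theorem Fibre.cast_smul {m : ι → C₀(X, ℂ) →L[ℂ] A} {x y : X} (e : x = y) (z : ℂ)
    (a : Fibre m x) : Fibre.cast e (z • a) = z • Fibre.cast e a := by
  subst e; rfl

theorem Fibre.cast_cast {m : ι → C₀(X, ℂ) →L[ℂ] A} {x y z : X} (e : x = y) (e' : y = z)
    (a : Fibre m x) : Fibre.cast e' (Fibre.cast e a) = Fibre.cast (e.trans e') a := by
  subst e; rfl

theorem Fibre.cast_section {m : ι → C₀(X, ℂ) →L[ℂ] A} {Y : Type*} {f : Y → X}
    (ξ : ∀ y, Fibre m (f y)) {y y' : Y} (h : y = y') {x : X} (e : f y = x) (e' : f y' = x) :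
    Fibre.cast e (ξ y) = Fibre.cast e' (ξ y') := by
  subst h; rfl

/-- Transport of fibres as an additive map. -/
def Fibre.castHom {m : ι → C₀(X, ℂ) →L[ℂ] A} {x y : X} (e : x = y) : Fibre m x →+ Fibre m y where
  toFun := Fibre.cast e
  map_zero' := Fibre.cast_zero e
  map_add' a b := by subst e; rfl

variable (m : ι → C₀(X, ℂ) →L[ℂ] A) {Y : Type*} [TopologicalSpace Y]

/-- With `continuousAt_of_tendsto_norm_sub` this gives the pointwise form of
`continuous_section_iff`: near `y₀` a continuous section is compared with the constant lift of its
value at `y₀`. The base map is not assumed continuous elsewhere. -/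
theorem tendsto_norm_sub_of_continuousAt {f : Y → X} {ξ : ∀ y, Fibre m (f y)} {y₀ : Y}
    (h : ContinuousAt (fun y => (⟨f y, ξ y⟩ : TotalSpace m)) y₀) (a : A)
    (ha : toFibre m (f y₀) a = ξ y₀) :
    Tendsto (fun y => ‖ξ y - toFibre m (f y) a‖) (𝓝 y₀) (𝓝 0) := by
  rw [Metric.tendsto_nhds]
  intro ε hε
  have ho : IsOpen {b : TotalSpace m | b.proj ∈ Set.univ ∧ ‖b.val - toFibre m b.proj a‖ < ε} :=
    TopologicalSpace.isOpen_generateFrom_of_mem ⟨a, Set.univ, ε, isOpen_univ, hε, rfl⟩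
  filter_upwards [h (ho.mem_nhds (by simp [ha, hε]))] with y hy
  simpa using hy.2

theorem continuousAt_proj {f : Y → X} {ξ : ∀ y, Fibre m (f y)} {y₀ : Y}
    (h : ContinuousAt (fun y => (⟨f y, ξ y⟩ : TotalSpace m)) y₀) : ContinuousAt f y₀ := by
  obtain ⟨a, ha⟩ := toFibre_surjective m _ (ξ y₀)
  intro U hU
  obtain ⟨V, hVU, hV, hy⟩ := mem_nhds_iff.1 hU
  have ho : IsOpen {b : TotalSpace m | b.proj ∈ V ∧ ‖b.val - toFibre m b.proj a‖ < 1} :=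
    TopologicalSpace.isOpen_generateFrom_of_mem ⟨a, V, 1, hV, one_pos, rfl⟩
  have := h (ho.mem_nhds ⟨hy, by simp [ha]⟩)
  rw [mem_map] at this
  rw [mem_map]
  filter_upwards [this] with y hy
  exact hVU hy.1

theorem eventually_norm_section_lt {f : Y → X} {ξ : ∀ y, Fibre m (f y)} {y₀ : Y}
    (h : ContinuousAt (fun y => (⟨f y, ξ y⟩ : TotalSpace m)) y₀) {δ : ℝ} (hδ : ‖ξ y₀‖ < δ) :
    ∀ᶠ y in 𝓝 y₀, ‖ξ y‖ < δ := by
  have ho : IsOpen {b : TotalSpace m | b.proj ∈ Set.univ ∧ ‖b.val - toFibre m b.proj 0‖ < δ} :=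
    TopologicalSpace.isOpen_generateFrom_of_mem
      ⟨0, Set.univ, δ, isOpen_univ, (norm_nonneg _).trans_lt hδ, rfl⟩
  filter_upwards [h (ho.mem_nhds (by simpa using hδ))] with y hy
  simpa using hy.2

variable [T2Space X] [LocallyCompactSpace X]

theorem mem_compactSections_of_support_subset [T2Space Y] {f : C(Y, X)} {ξ : ∀ y, Fibre m (f y)}
    (h : Continuous fun y => (⟨f y, ξ y⟩ : TotalSpace m)) {K : Set Y} (hK : IsCompact K)
    (hξ : ∀ y, ξ y ≠ 0 → y ∈ K) : ξ ∈ compactSections m f :=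
  ⟨h, hK.of_isClosed_subset isClosed_closure (closure_minimal hξ hK.isClosed)⟩

/-- The norm of a section is only upper semicontinuous, so the bound comes from a finite subcover of
the closed support. Summing the local bounds, instead of taking a maximum, also covers the empty
support. -/
theorem exists_norm_le_of_mem_compactSections {f : C(Y, X)} {ξ : ∀ y, Fibre m (f y)}
    (h : ξ ∈ compactSections m f) : ∃ M : ℝ, 0 ≤ M ∧ ∀ y, ‖ξ y‖ ≤ M := by
  obtain ⟨t, -, ht⟩ := h.2.elim_nhds_subcover (fun y => {y' | ‖ξ y'‖ < ‖ξ y‖ + 1})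
    fun y _ => eventually_norm_section_lt m h.1.continuousAt (lt_add_one _)
  have hM : 0 ≤ ∑ i ∈ t, (‖ξ i‖ + 1) := Finset.sum_nonneg fun i _ => by positivity
  refine ⟨_, hM, fun y => ?_⟩
  by_cases hy : ξ y = 0
  · rwa [hy, norm_zero]
  · obtain ⟨i, hi, hy'⟩ := Set.mem_iUnion₂.1 (ht (subset_closure hy))
    exact (le_of_lt hy').trans
      (Finset.single_le_sum (f := fun i => ‖ξ i‖ + 1) (fun i _ => by positivity) hi)

theorem continuousAt_of_tendsto_norm_sub {f : Y → X} {ξ : ∀ y, Fibre m (f y)} {y₀ : Y}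
    (hf : ContinuousAt f y₀) (a : A) (ha : toFibre m (f y₀) a = ξ y₀)
    (h : Tendsto (fun y => ‖ξ y - toFibre m (f y) a‖) (𝓝 y₀) (𝓝 0)) :
    ContinuousAt (fun y => (⟨f y, ξ y⟩ : TotalSpace m)) y₀ := by
  refine TopologicalSpace.tendsto_nhds_generateFrom_iff.2 ?_
  rintro W ⟨e, U, δ, hU, hδ, rfl⟩ ⟨hy₀, hlt⟩
  have hlt' : ‖toFibre m (f y₀) (a - e)‖ < δ := by
    rw [map_sub, ha]; exact hlt
  obtain ⟨δ', h1, h2⟩ := exists_between hlt'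
  filter_upwards [hf.eventually (eventually_norm_toFibre_lt m _ _ h1),
    h.eventually (gt_mem_nhds (sub_pos.2 h2)), hf (hU.mem_nhds hy₀)] with y hy1 hy2 hy3
  refine ⟨hy3, ?_⟩
  calc ‖ξ y - toFibre m (f y) e‖
      = ‖(ξ y - toFibre m (f y) a) + toFibre m (f y) (a - e)‖ := by
        rw [map_sub]; congr 1; abel
    _ ≤ ‖ξ y - toFibre m (f y) a‖ + ‖toFibre m (f y) (a - e)‖ := norm_add_le _ _
    _ < δ := by linarith

theorem continuousAt_toFibre {f : Y → X} {y₀ : Y} (hf : ContinuousAt f y₀) (a : A) :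
    ContinuousAt (fun y => (⟨f y, toFibre m (f y) a⟩ : TotalSpace m)) y₀ :=
  continuousAt_of_tendsto_norm_sub m hf a rfl (by simp)

theorem continuousAt_section_zero {f : Y → X} {y₀ : Y} (hf : ContinuousAt f y₀) :
    ContinuousAt (fun y => (⟨f y, 0⟩ : TotalSpace m)) y₀ := by
  simpa using continuousAt_toFibre m hf 0

theorem continuousAt_section_add {f : Y → X} {ξ η : ∀ y, Fibre m (f y)} {y₀ : Y}
    (hξ : ContinuousAt (fun y => (⟨f y, ξ y⟩ : TotalSpace m)) y₀)
    (hη : ContinuousAt (fun y => (⟨f y, η y⟩ : TotalSpace m)) y₀) :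
    ContinuousAt (fun y => (⟨f y, ξ y + η y⟩ : TotalSpace m)) y₀ := by
  obtain ⟨a, ha⟩ := toFibre_surjective m _ (ξ y₀)
  obtain ⟨b, hb⟩ := toFibre_surjective m _ (η y₀)
  refine continuousAt_of_tendsto_norm_sub m (continuousAt_proj m hξ) (a + b) (by simp [ha, hb]) ?_
  have h := (tendsto_norm_sub_of_continuousAt m hξ a ha).add
    (tendsto_norm_sub_of_continuousAt m hη b hb)
  rw [add_zero] at h
  refine squeeze_zero (fun _ => norm_nonneg _) (fun y => ?_) h
  rw [map_add, add_sub_add_comm]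
  exact norm_add_le _ _

theorem continuousAt_section_sum {κ : Type*} (s : Finset κ) {f : Y → X}
    {ξ : κ → ∀ y, Fibre m (f y)} {y₀ : Y} (hf : ContinuousAt f y₀)
    (hξ : ∀ i ∈ s, ContinuousAt (fun y => (⟨f y, ξ i y⟩ : TotalSpace m)) y₀) :
    ContinuousAt (fun y => (⟨f y, ∑ i ∈ s, ξ i y⟩ : TotalSpace m)) y₀ := by
  classical
  induction s using Finset.induction_on with
  | empty => simpa using continuousAt_section_zero m hf
  | insert i s hi ih =>
    simp only [Finset.sum_insert hi]
    exact continuousAt_section_add m (hξ i (Finset.mem_insert_self i s))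
      (ih fun j hj => hξ j (Finset.mem_insert_of_mem hj))

theorem continuousAt_section_smul {f : Y → X} {φ : Y → ℂ} {ξ : ∀ y, Fibre m (f y)} {y₀ : Y}
    (hφ : ContinuousAt φ y₀) (hξ : ContinuousAt (fun y => (⟨f y, ξ y⟩ : TotalSpace m)) y₀) :
    ContinuousAt (fun y => (⟨f y, φ y • ξ y⟩ : TotalSpace m)) y₀ := by
  obtain ⟨a, ha⟩ := toFibre_surjective m _ (ξ y₀)
  refine continuousAt_of_tendsto_norm_sub m (continuousAt_proj m hξ) (φ y₀ • a) (by simp [ha]) ?_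
  have h1 : Tendsto (fun y => ‖φ y‖ * ‖ξ y - toFibre m (f y) a‖ + ‖φ y - φ y₀‖ * ‖a‖)
      (𝓝 y₀) (𝓝 (‖φ y₀‖ * 0 + ‖φ y₀ - φ y₀‖ * ‖a‖)) :=
    ((Tendsto.norm hφ).mul (tendsto_norm_sub_of_continuousAt m hξ a ha)).add
      ((hφ.sub tendsto_const_nhds).norm.mul_const _)
  refine squeeze_zero (fun _ => norm_nonneg _) (fun y => ?_) (by simpa using h1)
  calc ‖φ y • ξ y - toFibre m (f y) (φ y₀ • a)‖
      = ‖φ y • (ξ y - toFibre m (f y) a) + (φ y - φ y₀) • toFibre m (f y) a‖ := by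
        rw [map_smul, smul_sub, sub_smul]; congr 1; abel
    _ ≤ ‖φ y • (ξ y - toFibre m (f y) a)‖ + ‖(φ y - φ y₀) • toFibre m (f y) a‖ := norm_add_le _ _
    _ ≤ _ := by
      rw [norm_smul, norm_smul]
      gcongr
      exact norm_toFibre_le_norm _ _ _

/-- The usual splitting `T(ξ, η) - T(a, b) = T(ξ - a, η) + T(a, η - b)`, with lifts `a`, `b` of the
values at `y₀`; it covers products, inner products and module actions at once. -/
theorem continuousAt_section_map₂ {A₁ A₂ A₃ ι₁ ι₂ ι₃ : Type*}
    [NormedAddCommGroup A₁] [NormedSpace ℂ A₁] [NormedAddCommGroup A₂] [NormedSpace ℂ A₂]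
    [NormedAddCommGroup A₃] [NormedSpace ℂ A₃] {τ : ℂ →+* ℂ}
    {m₁ : ι₁ → C₀(X, ℂ) →L[ℂ] A₁} {m₂ : ι₂ → C₀(X, ℂ) →L[ℂ] A₂} {m₃ : ι₃ → C₀(X, ℂ) →L[ℂ] A₃}
    (B : A₁ → A₂ → A₃) (T : ∀ x, Fibre m₁ x →ₛₗ[τ] Fibre m₂ x →ₗ[ℂ] Fibre m₃ x)
    (hT : ∀ x a b, T x (toFibre m₁ x a) (toFibre m₂ x b) = toFibre m₃ x (B a b))
    (hn : ∀ x a b, ‖T x a b‖ ≤ ‖a‖ * ‖b‖)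
    {f : Y → X} {ξ : ∀ y, Fibre m₁ (f y)} {η : ∀ y, Fibre m₂ (f y)} {y₀ : Y}
    (hξ : ContinuousAt (fun y => (⟨f y, ξ y⟩ : TotalSpace m₁)) y₀)
    (hη : ContinuousAt (fun y => (⟨f y, η y⟩ : TotalSpace m₂)) y₀) :
    ContinuousAt (fun y => (⟨f y, T (f y) (ξ y) (η y)⟩ : TotalSpace m₃)) y₀ := by
  obtain ⟨a, ha⟩ := toFibre_surjective m₁ _ (ξ y₀)
  obtain ⟨b, hb⟩ := toFibre_surjective m₂ _ (η y₀)
  refine continuousAt_of_tendsto_norm_sub m₃ (continuousAt_proj m₁ hξ) (B a b)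
    (by rw [← hT, ha, hb]) ?_
  have h1 := tendsto_norm_sub_of_continuousAt m₁ hξ a ha
  have h2 := tendsto_norm_sub_of_continuousAt m₂ hη b hb
  have h3 := (h1.mul (h2.add_const ‖b‖)).add (h2.const_mul ‖a‖)
  refine squeeze_zero (fun _ => norm_nonneg _) (fun y => ?_) (by simpa using h3)
  rw [← hT]
  have hη' : ‖η y‖ ≤ ‖η y - toFibre m₂ (f y) b‖ + ‖b‖ := by
    calc ‖η y‖ = ‖(η y - toFibre m₂ (f y) b) + toFibre m₂ (f y) b‖ := by rw [sub_add_cancel]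
      _ ≤ _ := (norm_add_le _ _).trans (by gcongr; exact norm_toFibre_le_norm _ _ _)
  calc ‖T (f y) (ξ y) (η y) - T (f y) (toFibre m₁ (f y) a) (toFibre m₂ (f y) b)‖
      = ‖T (f y) (ξ y - toFibre m₁ (f y) a) (η y)
          + T (f y) (toFibre m₁ (f y) a) (η y - toFibre m₂ (f y) b)‖ := by
        rw [map_sub, LinearMap.sub_apply, map_sub]; congr 1; abel
    _ ≤ _ := norm_add_le _ _
    _ ≤ ‖ξ y - toFibre m₁ (f y) a‖ * ‖η y‖
        + ‖toFibre m₁ (f y) a‖ * ‖η y - toFibre m₂ (f y) b‖ := add_le_add (hn _ _ _) (hn _ _ _)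
    _ ≤ _ := by
        gcongr
        exact norm_toFibre_le_norm _ _ _

theorem continuousAt_section_map {A₁ A₂ ι₁ ι₂ : Type*}
    [NormedAddCommGroup A₁] [NormedSpace ℂ A₁] [NormedAddCommGroup A₂] [NormedSpace ℂ A₂]
    {τ : ℂ →+* ℂ} {m₁ : ι₁ → C₀(X, ℂ) →L[ℂ] A₁} {m₂ : ι₂ → C₀(X, ℂ) →L[ℂ] A₂}
    (B : A₁ → A₂) (T : ∀ x, Fibre m₁ x →ₛₗ[τ] Fibre m₂ x)
    (hT : ∀ x a, T x (toFibre m₁ x a) = toFibre m₂ x (B a)) (hn : ∀ x a, ‖T x a‖ ≤ ‖a‖)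
    {f : Y → X} {ξ : ∀ y, Fibre m₁ (f y)} {y₀ : Y}
    (hξ : ContinuousAt (fun y => (⟨f y, ξ y⟩ : TotalSpace m₁)) y₀) :
    ContinuousAt (fun y => (⟨f y, T (f y) (ξ y)⟩ : TotalSpace m₂)) y₀ := by
  obtain ⟨a, ha⟩ := toFibre_surjective m₁ _ (ξ y₀)
  refine continuousAt_of_tendsto_norm_sub m₂ (continuousAt_proj m₁ hξ) (B a)
    (by rw [← hT, ha]) ?_
  refine squeeze_zero (fun _ => norm_nonneg _) (fun y => ?_)
    (tendsto_norm_sub_of_continuousAt m₁ hξ a ha)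
  rw [← hT, ← map_sub]
  exact hn _ _

/-- Uniform limits of continuous sections are continuous: an `ε/3` argument in which upper
semicontinuity controls the difference of the two lifts. It makes algebras of continuous sections
complete. -/
theorem continuousAt_section_of_approx {f : Y → X} {ξ : ∀ y, Fibre m (f y)} {y₀ : Y}
    (h : ∀ ε > 0, ∃ η : ∀ y, Fibre m (f y),
      ContinuousAt (fun y => (⟨f y, η y⟩ : TotalSpace m)) y₀ ∧ ∀ y, ‖ξ y - η y‖ ≤ ε) :
    ContinuousAt (fun y => (⟨f y, ξ y⟩ : TotalSpace m)) y₀ := by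
  obtain ⟨a, ha⟩ := toFibre_surjective m _ (ξ y₀)
  have hf : ContinuousAt f y₀ := by
    obtain ⟨η, hη, -⟩ := h 1 one_pos
    exact continuousAt_proj m hη
  refine continuousAt_of_tendsto_norm_sub m hf a ha ?_
  rw [Metric.tendsto_nhds]
  intro ε hε
  obtain ⟨η, hη, hd⟩ := h (ε / 3) (by positivity)
  obtain ⟨b, hb⟩ := toFibre_surjective m _ (η y₀)
  have h1 : ‖toFibre m (f y₀) (b - a)‖ < ε / 2 := by
    rw [map_sub, ha, hb, norm_sub_rev]
    exact (hd y₀).trans_lt (by linarith)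
  filter_upwards [hf.eventually (eventually_norm_toFibre_lt m _ _ h1),
    (tendsto_norm_sub_of_continuousAt m hη b hb).eventually
      (gt_mem_nhds (show (0 : ℝ) < ε / 6 by positivity))] with y h2 h3
  rw [dist_zero_right, norm_norm]
  calc ‖ξ y - toFibre m (f y) a‖
      = ‖(ξ y - η y) + (η y - toFibre m (f y) b) + toFibre m (f y) (b - a)‖ := by
        rw [map_sub]; congr 1; abel
    _ ≤ ‖ξ y - η y‖ + ‖η y - toFibre m (f y) b‖ + ‖toFibre m (f y) (b - a)‖ := norm_add₃_le
    _ < ε := by linarith [hd y]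

/-- Joint continuity of the action, stated with free endpoints `f` and `f'`, so that it applies when
source and range are only propositionally the required units. -/
theorem BundleAction.continuousAt_section {H : Type*} [TopologicalSpace H] {G : EtaleGroupoid H}
    {m : ι → C₀(G.units, ℂ) →L[ℂ] A} (β : BundleAction G m) {g : Y → H} {f f' : Y → G.units}
    {ξ : ∀ y, Fibre m (f y)} {y₀ : Y} (hs : ∀ y, G.s (g y) = f y) (hr : ∀ y, G.r (g y) = f' y)
    (hg : ContinuousAt g y₀) (hξ : ContinuousAt (fun y => (⟨f y, ξ y⟩ : TotalSpace m)) y₀) :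
    ContinuousAt (fun y => (⟨f' y, β.act (g y) (hs y) (hr y) (ξ y)⟩ : TotalSpace m)) y₀ := by
  have key : (fun y => (⟨f' y, β.act (g y) (hs y) (hr y) (ξ y)⟩ : TotalSpace m)) =
      (fun p : {p : H × TotalSpace m // G.s p.1 = p.2.proj} =>
        (⟨G.r p.1.1, β.act p.1.1 p.2 rfl p.1.2.val⟩ : TotalSpace m)) ∘
      fun y => ⟨(g y, ⟨f y, ξ y⟩), hs y⟩ := by
    obtain rfl : (fun y => G.r (g y)) = f' := funext hr
    rfl
  rw [key]
  refine β.continuous_act.continuousAt.comp ?_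
  exact tendsto_subtype_rng.2 (hg.prodMk hξ)

end BundleContinuity

end GroupoidCrossedProduct

namespace GroupoidCrossedProduct

/-! ## Sums over the fibres of local homeomorphisms -/

section LocalHomeomorph

open Filter

variable {Y W B : Type*} [TopologicalSpace Y] [TopologicalSpace W] [TopologicalSpace B]
  {k : W → B}

theorem exists_injOn_cover (hk : IsLocalHomeomorph k) {K : Set W} (hK : IsCompact K) :
    ∃ (n : ℕ) (U : Fin n → Set W), (∀ i, IsOpen (U i)) ∧ (∀ i, Set.InjOn k (U i)) ∧
      K ⊆ ⋃ i, U i := by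
  choose U hU hwU hinj using fun w => hk.isLocallyInjective w
  obtain ⟨t, ht⟩ := hK.elim_finite_subcover U hU fun w _ => Set.mem_iUnion.2 ⟨w, hwU w⟩
  refine ⟨t.card, fun i => U (t.equivFin.symm i), fun i => hU _, fun i => hinj _, fun w hw => ?_⟩
  obtain ⟨w', hw', h⟩ := Set.mem_iUnion₂.1 (ht hw)
  exact Set.mem_iUnion.2 ⟨t.equivFin ⟨w', hw'⟩, by simpa using h⟩

/-- Pigeonhole: two points of one fibre cannot share a set on which `k` is injective, so the number
of such sets covering `K` bounds every fibre. -/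
theorem exists_forall_card_le (hk : IsLocalHomeomorph k) {K : Set W} (hK : IsCompact K) :
    ∃ N : ℕ, ∀ (b : B) (s : Finset W), (∀ w ∈ s, w ∈ K ∧ k w = b) → s.card ≤ N := by
  obtain ⟨n, U, -, hinj, hKU⟩ := exists_injOn_cover hk hK
  refine ⟨n, fun b s hs => ?_⟩
  have : ∀ w : s, ∃ i, w.1 ∈ U i := fun w => Set.mem_iUnion.1 (hKU (hs w w.2).1)
  choose i hi using this
  have hinj' : Function.Injective i := fun w w' h => Subtype.ext <|
    hinj (i w) (hi w) (h ▸ hi w') ((hs w w.2).2.trans (hs w' w'.2).2.symm)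
  simpa using Fintype.card_le_of_injective i hinj'

theorem finite_fibre (hk : IsLocalHomeomorph k) {K : Set W} (hK : IsCompact K) (b : B) :
    {w | w ∈ K ∧ k w = b}.Finite := by
  obtain ⟨N, hN⟩ := exists_forall_card_le hk hK
  by_contra h
  obtain ⟨s, hs, hc⟩ := Set.Infinite.exists_subset_card_eq h (N + 1)
  have := hN b s fun w hw => hs hw
  omega

theorem finite_fibre_subtype (hk : IsLocalHomeomorph k) {K : Set W} (hK : IsCompact K) (b : B) :
    {w : {w // k w = b} | w.1 ∈ K}.Finite :=
  (finite_fibre hk hK b).preimage (f := Subtype.val) Subtype.val_injective.injOn |>.subset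
    fun w hw => ⟨hw, w.2⟩

/-- Over base points near `y₀` the part of the fibre lying in `K` is exhausted by finitely many
local sections through the points of `K` above `y₀`. Disjoint neighbourhoods of these points keep
the sections distinct, and compactness of `K` excludes further points. -/
theorem exists_local_sections [T2Space Y] [T2Space W] [T2Space B] (hk : IsLocalHomeomorph k)
    {u : Y → B} (hu : Continuous u) {K : Set (Y × W)} (hK : IsCompact K) (y₀ : Y) :
    ∃ (t : Finset W) (s : W → Y → W), (∀ w ∈ t, ContinuousAt (s w) y₀) ∧
      ∀ᶠ y in 𝓝 y₀, (∀ w ∈ t, k (s w y) = u y) ∧ Set.InjOn (fun w => s w y) t ∧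
        ∀ w, k w = u y → (y, w) ∈ K → ∃ w' ∈ t, s w' y = w := by
  have hfin : {w | (y₀, w) ∈ K ∧ k w = u y₀}.Finite :=
    (finite_fibre hk (hK.image continuous_snd) (u y₀)).subset
      fun w hw => ⟨⟨_, hw.1, rfl⟩, hw.2⟩
  obtain ⟨V, hV, hdisj⟩ := hfin.t2_separation
  choose e hwe hke using fun w => hk w
  let t := hfin.toFinset
  have ht : ∀ w ∈ t, (y₀, w) ∈ K ∧ k w = u y₀ := fun w hw => hfin.mem_toFinset.1 hw
  have hmem : ∀ w ∈ t, u y₀ ∈ (e w).target := fun w hw => by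
    have := (e w).map_source (hwe w)
    rwa [← hke, (ht w hw).2] at this
  have hs0 : ∀ w ∈ t, (e w).symm (u y₀) = w := fun w hw => by
    rw [← (ht w hw).2, hke w]
    exact (e w).left_inv (hwe w)
  have hcont : ∀ w ∈ t, ContinuousAt (fun y => (e w).symm (u y)) y₀ := fun w hw =>
    ((e w).continuousAt_symm (hmem w hw)).comp (f := u) hu.continuousAt
  refine ⟨t, fun w y => (e w).symm (u y), hcont, ?_⟩
  have h1 : ∀ᶠ y in 𝓝 y₀, ∀ w ∈ t, u y ∈ (e w).target ∧ (e w).symm (u y) ∈ V w := by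
    refine (t.eventually_all).2 fun w hw => ?_
    refine (hu.continuousAt.eventually ((e w).open_target.mem_nhds (hmem w hw))).and ?_
    refine (hcont w hw).eventually ((hV w).2.mem_nhds ?_)
    change (e w).symm (u y₀) ∈ V w
    rw [hs0 w hw]
    exact (hV w).1
  -- The base points over which `K` has a point outside the chosen neighbourhoods form the
  -- projection of a compact set, hence a closed set, and `y₀` is not among them.
  have h2 : ∀ᶠ y in 𝓝 y₀, y ∉ Prod.fst '' ((K ∩ {p | k p.2 = u p.1}) \
      ⋃ w ∈ t, {p : Y × W | p.2 ∈ V w ∩ (e w).source}) := by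
    refine IsClosed.compl_mem_nhds ?_ ?_
    · refine (IsCompact.image ?_ continuous_fst).isClosed
      refine (hK.inter_right (isClosed_eq (hk.continuous.comp continuous_snd)
        (hu.comp continuous_fst))).diff ?_
      exact isOpen_biUnion fun w _ =>
        ((hV w).2.inter (e w).open_source).preimage continuous_snd
    · rintro ⟨⟨y, w⟩, ⟨⟨hwK, hw⟩, hw'⟩, rfl⟩
      exact hw' (Set.mem_iUnion₂.2 ⟨w, hfin.mem_toFinset.2 ⟨hwK, hw⟩, (hV w).1, hwe w⟩)
  filter_upwards [h1, h2] with y hy1 hy2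
  refine ⟨fun w hw => ?_, fun w hw w' hw' h => ?_, fun w hw hwK => ?_⟩
  · rw [hke w]
    exact (e w).right_inv (hy1 w hw).1
  · by_contra hne
    refine (hdisj (ht w hw) (ht w' hw') hne).le_bot ⟨(hy1 w hw).2, ?_⟩
    have h' : (e w).symm (u y) = (e w').symm (u y) := h
    rw [h']
    exact (hy1 w' hw').2
  · by_contra hne
    refine hy2 ⟨(y, w), ⟨⟨hwK, hw⟩, fun h => hne ?_⟩, rfl⟩
    obtain ⟨w', hw't, hw'⟩ := Set.mem_iUnion₂.1 h
    refine ⟨w', hw't, ?_⟩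
    rw [← hw, hke w']
    exact (e w').left_inv hw'.2

theorem finsum_subtype_eq_sum_of_injOn {W M : Type*} [AddCommMonoid M] {p : W → Prop} (G : W → M)
    (hG : ∀ w, G w ≠ 0 → p w) (t : Finset W) (s : W → W) (hs : Set.InjOn s t)
    (hts : ∀ w, G w ≠ 0 → ∃ w' ∈ t, s w' = w) :
    ∑ᶠ w : {w // p w}, G w.1 = ∑ w ∈ t, G (s w) := by
  classical
  rw [finsum_subtype_eq_finsum_cond (f := G) p, ← Finset.sum_image (g := s) (f := G) hs,
    ← finsum_eq_sum_of_support_subset (s := t.image s)]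
  · refine finsum_congr fun w => ?_
    by_cases hw : p w
    · rw [finsum_eq_if, if_pos hw]
    · rw [finsum_eq_if, if_neg hw]
      by_contra h
      exact hw (hG w (Ne.symm h))
  · intro w hw
    obtain ⟨w', hw', h⟩ := hts w hw
    simpa using ⟨w', hw', h⟩

/-- The scalar version, used for orbit sums. The compactness condition is imposed only for `y` near
`y₀`, since an orbit sum need not have compact support. -/
theorem continuousAt_finsum_fibre [T2Space Y] [T2Space W] [T2Space B] (hk : IsLocalHomeomorph k)
    {u : Y → B} (hu : Continuous u) {M : Type*} [AddCommMonoid M] [TopologicalSpace M]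
    [ContinuousAdd M] (F : Y → W → M) (y₀ : Y)
    (hF : ContinuousOn (fun p : Y × W => F p.1 p.2) {p | k p.2 = u p.1})
    (K : Set (Y × W)) (hK : IsCompact K)
    (hFK : ∀ᶠ y in 𝓝 y₀, ∀ w, k w = u y → F y w ≠ 0 → (y, w) ∈ K) :
    ContinuousAt (fun y => ∑ᶠ w : {w // k w = u y}, F y w.1) y₀ := by
  classical
  obtain ⟨t, s, hs, hev⟩ := exists_local_sections hk hu hK y₀
  have h1 : (fun y => ∑ w ∈ t, F y (s w y)) =ᶠ[𝓝 y₀]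
      fun y => ∑ᶠ w : {w // k w = u y}, F y w.1 := by
    filter_upwards [hev, hFK] with y hy hy'
    let G : W → M := fun w => if k w = u y then F y w else 0
    have h2 : ∑ᶠ w : {w // k w = u y}, F y w.1 = ∑ᶠ w : {w // k w = u y}, G w.1 :=
      finsum_congr fun w => (if_pos w.2).symm
    rw [h2, finsum_subtype_eq_sum_of_injOn G (fun w hw => by_contra fun h => hw (if_neg h)) t
      (fun w => s w y) hy.2.1 fun w hw => ?_]
    · exact Finset.sum_congr rfl fun w hw => (if_pos (hy.1 w hw)).symm
    · have hw1 : k w = u y := by_contra fun h => hw (if_neg h)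
      exact hy.2.2 w hw1 (hy' w hw1 (by simpa [G, hw1] using hw))
  refine ContinuousAt.congr ?_ h1
  refine tendsto_finsetSum t fun w hw => ?_
  have hev' := hev.self_of_nhds.1 w hw
  refine Tendsto.comp (x := 𝓝 y₀) (f := fun y => (y, s w y)) (hF (y₀, s w y₀) hev') ?_
  exact tendsto_nhdsWithin_iff.2 ⟨continuousAt_id.prodMk (hs w hw),
    hev.mono fun y hy => hy.1 w hw⟩

variable {X : Type*} [TopologicalSpace X] {A ι : Type*} [NormedAddCommGroup A] [NormedSpace ℂ A]
  [T2Space X] [LocallyCompactSpace X]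

/-- The sums of a compactly supported continuous section over the fibres of a local homeomorphism
form a compactly supported continuous section. -/
theorem finsum_fibre_mem_compactSections [T2Space Y] [T2Space W] [T2Space B]
    (m : ι → C₀(X, ℂ) →L[ℂ] A) (f : C(Y, X)) (hk : IsLocalHomeomorph k) {u : Y → B}
    (hu : Continuous u) (F : ∀ y w, k w = u y → Fibre m (f y))
    (hF : Continuous fun p : {p : Y × W // k p.2 = u p.1} =>
      (⟨f p.1.1, F p.1.1 p.1.2 p.2⟩ : TotalSpace m))
    (K : Set (Y × W)) (hK : IsCompact K) (hFK : ∀ y w h, F y w h ≠ 0 → (y, w) ∈ K) :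
    (fun y => ∑ᶠ w : {w // k w = u y}, F y w.1 w.2) ∈ compactSections m f := by
  classical
  -- Extension by `0` off the fibre product: a local section `s w y` lies over `u y` only for `y`
  -- near `y₀`, so the family must be defined for all pairs.
  let G : ∀ y, W → Fibre m (f y) := fun y w => if h : k w = u y then F y w h else 0
  have hG : ∀ y w, G y w ≠ 0 → ∃ h : k w = u y, F y w h ≠ 0 := fun y w hw => by
    have h : k w = u y := by_contra fun h => hw (dif_neg h)
    exact ⟨h, by simpa [G, h] using hw⟩
  have hsum : ∀ y, ∑ᶠ w : {w // k w = u y}, F y w.1 w.2 = ∑ᶠ w : {w // k w = u y}, G y w.1 :=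
    fun y => finsum_congr fun w => (dif_pos w.2).symm
  have hcont : ContinuousOn (fun p : Y × W => (⟨f p.1, G p.1 p.2⟩ : TotalSpace m))
      {p | k p.2 = u p.1} := by
    rw [continuousOn_iff_continuous_domRestrict]
    refine hF.congr fun p => ?_
    have hp : k p.1.2 = u p.1.1 := p.2
    change _ = (⟨f p.1.1, G p.1.1 p.1.2⟩ : TotalSpace m)
    simp only [G]
    rw [dif_pos hp]
  refine mem_compactSections_of_support_subset m ?_ (hK.image continuous_fst) fun y hy => ?_
  · simp only [hsum]
    refine continuous_iff_continuousAt.2 fun y₀ => ?_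
    obtain ⟨t, s, hs, hev⟩ := exists_local_sections hk hu hK y₀
    have h1 : (fun y => (⟨f y, ∑ w ∈ t, G y (s w y)⟩ : TotalSpace m)) =ᶠ[𝓝 y₀]
        fun y => ⟨f y, ∑ᶠ w : {w // k w = u y}, G y w.1⟩ := by
      filter_upwards [hev] with y hy
      rw [finsum_subtype_eq_sum_of_injOn (G y) (fun w hw => (hG y w hw).1) t
        (fun w => s w y) hy.2.1 fun w hw => ?_]
      obtain ⟨h, hw'⟩ := hG y w hw
      exact hy.2.2 w h (hFK y w h hw')
    refine ContinuousAt.congr ?_ h1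
    refine continuousAt_section_sum m t f.continuous.continuousAt fun w hw => ?_
    have hev' := hev.self_of_nhds.1 w hw
    refine Tendsto.comp (x := 𝓝 y₀) (f := fun y => (y, s w y)) (hcont (y₀, s w y₀) hev') ?_
    exact tendsto_nhdsWithin_iff.2 ⟨continuousAt_id.prodMk (hs w hw),
      hev.mono fun y hy => hy.1 w hw⟩
  · obtain ⟨w, hw⟩ : ∃ w : {w // k w = u y}, F y w.1 w.2 ≠ 0 := by
      by_contra! h
      exact hy (by simp only [h, finsum_zero])
    exact ⟨_, hFK y w.1 w.2 hw, rfl⟩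

end LocalHomeomorph

end GroupoidCrossedProduct

namespace GroupoidCrossedProduct

/-! ## The fibres of a `C₀(X)`-algebra are C⋆-algebras -/

section NormBound

variable {X : Type*} [TopologicalSpace X] {A₁ A₂ A₃ ι₁ ι₂ ι₃ : Type*}
  [NormedAddCommGroup A₁] [NormedSpace ℂ A₁] [NormedAddCommGroup A₂] [NormedSpace ℂ A₂]
  [NormedAddCommGroup A₃] [NormedSpace ℂ A₃]
  {m₁ : ι₁ → C₀(X, ℂ) →L[ℂ] A₁} {m₂ : ι₂ → C₀(X, ℂ) →L[ℂ] A₂} {m₃ : ι₃ → C₀(X, ℂ) →L[ℂ] A₃}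

/-- Lifts of norm below `‖a‖ + δ` and `‖b‖ + δ` exist by definition of the quotient norm; then `δ`
tends to `0`. -/
theorem norm_map₂_le_of_toFibre {x : X} {B : A₁ → A₂ → A₃}
    {T : Fibre m₁ x → Fibre m₂ x → Fibre m₃ x}
    (hT : ∀ a b, T (toFibre m₁ x a) (toFibre m₂ x b) = toFibre m₃ x (B a b))
    (hB : ∀ a b, ‖B a b‖ ≤ ‖a‖ * ‖b‖) (a : Fibre m₁ x) (b : Fibre m₂ x) :
    ‖T a b‖ ≤ ‖a‖ * ‖b‖ := by
  refine le_of_forall_pos_le_add fun ε hε => ?_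
  have hc : Filter.Tendsto (fun δ : ℝ => (‖a‖ + δ) * (‖b‖ + δ)) (𝓝[>] 0)
      (𝓝 ((‖a‖ + 0) * (‖b‖ + 0))) := by
    refine Filter.Tendsto.mono_left ?_ nhdsWithin_le_nhds
    exact Continuous.tendsto (by fun_prop) 0
  rw [add_zero, add_zero] at hc
  obtain ⟨δ, h1, hδ⟩ := ((hc.eventually (gt_mem_nhds (lt_add_of_pos_right _ hε))).and
    self_mem_nhdsWithin).exists
  obtain ⟨a', rfl, ha⟩ := exists_norm_lt _ x a hδ
  obtain ⟨b', rfl, hb⟩ := exists_norm_lt _ x b hδ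
  rw [hT]
  refine (norm_toFibre_le_norm _ _ _).trans ((hB _ _).trans ?_)
  refine le_trans ?_ h1.le
  gcongr

end NormBound

section Bump

variable {X : Type*} [TopologicalSpace X] [T2Space X] [LocallyCompactSpace X]

theorem exists_bump_of_mem_nhds (x : X) {U : Set X} (hU : U ∈ 𝓝 x) :
    ∃ χ : C₀(X, ℂ), χ x = 1 ∧ ‖χ‖ ≤ 1 ∧ star χ = χ ∧ ∀ y ∉ U, χ y = 0 := by
  obtain ⟨V, hVU, hV, hxV⟩ := mem_nhds_iff.1 hU
  obtain ⟨f, hf1, hf0, hfc, hf⟩ := exists_continuous_one_zero_of_isCompact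
    (isCompact_singleton (x := x)) hV.isClosed_compl
    (Set.disjoint_singleton_left.2 fun h => h hxV)
  refine ⟨⟨⟨fun y => (f y : ℂ), by fun_prop⟩, ?_⟩, ?_, ?_, ?_, ?_⟩
  · have : HasCompactSupport fun y => (f y : ℂ) :=
      hfc.comp_left (g := fun t : ℝ => (t : ℂ)) (by simp)
    exact this.is_zero_at_infty
  · simpa using hf1 (Set.mem_singleton x)
  · rw [← ZeroAtInftyContinuousMap.norm_toBCF_eq_norm]
    refine (BoundedContinuousFunction.norm_le zero_le_one).2 fun y => ?_
    have := hf y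
    simp only [Set.mem_Icc] at this
    simpa [abs_le] using ⟨by linarith [this.1], this.2⟩
  · ext y
    exact Complex.conj_ofReal _
  · intro y hy
    simpa using hf0 (fun h => hy (hVU h))

end Bump

namespace C0Algebra

variable {X : Type*} [TopologicalSpace X] {C : Type*} [NonUnitalCStarAlgebra C]
  (𝒞 : C0Algebra X C)

theorem norm_fst_le (f : C₀(X, ℂ)) (b : C) : ‖(𝒞.toMultiplier f).fst b‖ ≤ ‖f‖ * ‖b‖ := by
  refine ((𝒞.toMultiplier f).fst.le_opNorm b).trans ?_
  rw [DoubleCentralizer.norm_fst]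
  gcongr
  exact NonUnitalStarAlgHom.norm_apply_le 𝒞.toMultiplier f

theorem fst_fst (f g : C₀(X, ℂ)) (b : C) :
    (𝒞.toMultiplier f).fst ((𝒞.toMultiplier g).fst b) = (𝒞.toMultiplier (f * g)).fst b := by
  rw [map_mul, DoubleCentralizer.mul_fst]; rfl

/-- On `g • b` the operator `f - f(x)` gives `(f g - f(x) g) • b`, whose coefficient vanishes at
`x`. Nondegeneracy makes such elements span a dense subspace, and the kernel is closed. -/
theorem toFibre_fst (x : X) (f : C₀(X, ℂ)) (a : C) :
    toFibre 𝒞.orbit x ((𝒞.toMultiplier f).fst a) = f x • toFibre 𝒞.orbit x a := by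
  let L : C →L[ℂ] C := (𝒞.toMultiplier f).fst - f x • ContinuousLinearMap.id ℂ C
  have hcl : IsClosed {a | L a ∈ fibreKer 𝒞.orbit x} :=
    (isClosed_fibreKer 𝒞.orbit x).preimage L.continuous
  have hspan : (Submodule.span ℂ {c : C | ∃ (f : C₀(X, ℂ)) (b : C),
      (𝒞.toMultiplier f).fst b = c} : Set C) ⊆ {a | L a ∈ fibreKer 𝒞.orbit x} := by
    have : Submodule.span ℂ {c : C | ∃ (f : C₀(X, ℂ)) (b : C), (𝒞.toMultiplier f).fst b = c} ≤
        (fibreKer 𝒞.orbit x).comap L.toLinearMap := by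
      refine Submodule.span_le.2 ?_
      rintro _ ⟨g, b, rfl⟩
      refine Submodule.le_topologicalClosure _
        (Submodule.subset_span ⟨b, f * g - f x • g, by simp, ?_⟩)
      rw [orbit_apply, map_sub, map_smul]
      change _ = (𝒞.toMultiplier f).fst ((𝒞.toMultiplier g).fst b) -
        f x • (𝒞.toMultiplier g).fst b
      rw [fst_fst]
      rfl
    exact this
  have h := (hcl.closure_subset_iff.2 hspan) (𝒞.nondegenerate a)
  rw [← map_smul, ← sub_eq_zero, ← map_sub, toFibre_eq_zero_iff]
  exact h

/-- Elements of the ideal at `x` become small under cutoffs near `x`: for a generator `g • b` with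
`g(x) = 0` the cutoff is supported where `g` is small. Norm estimates in the fibre thereby reduce to
estimates in `C`. -/
theorem exists_norm_fst_le_of_mem_fibreKer (x : X) {n : C} (hn : n ∈ fibreKer 𝒞.orbit x) {ε : ℝ}
    (hε : 0 < ε) : ∃ U ∈ 𝓝 x, ∀ f : C₀(X, ℂ), ‖f‖ ≤ 1 → (∀ y ∉ U, f y = 0) →
      ‖(𝒞.toMultiplier f).fst n‖ ≤ ε := by
  have hspan : ∀ n ∈ Submodule.span ℂ {a | ∃ (b : C) (f : C₀(X, ℂ)), f x = 0 ∧ 𝒞.orbit b f = a},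
      ∀ ε > 0, ∃ U ∈ 𝓝 x, ∀ f : C₀(X, ℂ), ‖f‖ ≤ 1 → (∀ y ∉ U, f y = 0) →
        ‖(𝒞.toMultiplier f).fst n‖ ≤ ε := by
    intro n hn
    induction hn using Submodule.span_induction with
    | mem a ha =>
      obtain ⟨b, g, hg, rfl⟩ := ha
      intro ε hε
      have hpos : 0 < ε / (‖b‖ + 1) := by positivity
      refine ⟨{y | ‖g y‖ < ε / (‖b‖ + 1)}, (g.continuous.norm.continuousAt).eventually
        (gt_mem_nhds (by simpa [hg] using hpos)), fun f hf hfU => ?_⟩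
      rw [orbit_apply, fst_fst]
      refine (𝒞.norm_fst_le _ _).trans ?_
      have h1 : ‖f * g‖ ≤ ε / (‖b‖ + 1) := by
        rw [← ZeroAtInftyContinuousMap.norm_toBCF_eq_norm]
        refine (BoundedContinuousFunction.norm_le hpos.le).2 fun y => ?_
        change ‖f y * g y‖ ≤ _
        by_cases hy : ‖g y‖ < ε / (‖b‖ + 1)
        · have h2 : ‖f y‖ ≤ 1 := by
            rw [← ZeroAtInftyContinuousMap.norm_toBCF_eq_norm] at hf
            exact (f.toBCF.norm_coe_le_norm y).trans hf
          rw [norm_mul]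
          calc ‖f y‖ * ‖g y‖ ≤ 1 * ‖g y‖ := by gcongr
            _ ≤ _ := by rw [one_mul]; exact hy.le
        · rw [hfU y hy, zero_mul, norm_zero]; exact hpos.le
      calc ‖f * g‖ * ‖b‖ ≤ ε / (‖b‖ + 1) * (‖b‖ + 1) := by gcongr; linarith
        _ = ε := div_mul_cancel₀ _ (by positivity)
    | zero => exact fun ε hε => ⟨Set.univ, Filter.univ_mem, fun f _ _ => by simpa using hε.le⟩
    | add a b _ _ ha hb =>
      intro ε hε
      obtain ⟨U, hU, hU'⟩ := ha (ε / 2) (by positivity)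
      obtain ⟨V, hV, hV'⟩ := hb (ε / 2) (by positivity)
      refine ⟨U ∩ V, Filter.inter_mem hU hV, fun f hf hfU => ?_⟩
      rw [map_add]
      refine (norm_add_le _ _).trans ?_
      have h1 := hU' f hf fun y hy => hfU y fun h => hy h.1
      have h2 := hV' f hf fun y hy => hfU y fun h => hy h.2
      linarith
    | smul c a _ ha =>
      intro ε hε
      obtain ⟨U, hU, hU'⟩ := ha (ε / (‖c‖ + 1)) (by positivity)
      refine ⟨U, hU, fun f hf hfU => ?_⟩
      rw [map_smul, norm_smul]
      calc ‖c‖ * ‖(𝒞.toMultiplier f).fst a‖ ≤ (‖c‖ + 1) * (ε / (‖c‖ + 1)) := by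
            gcongr
            · linarith
            · exact hU' f hf hfU
        _ = ε := mul_div_cancel₀ _ (by positivity)
  obtain ⟨n', hn', hd⟩ := Metric.mem_closure_iff.1 hn (ε / 2) (by positivity)
  obtain ⟨U, hU, hU'⟩ := hspan n' hn' (ε / 2) (by positivity)
  refine ⟨U, hU, fun f hf hfU => ?_⟩
  have h1 := hU' f hf hfU
  have h2 : ‖(𝒞.toMultiplier f).fst (n - n')‖ ≤ ε / 2 := by
    refine (𝒞.norm_fst_le _ _).trans ?_
    rw [dist_eq_norm] at hd
    nlinarith [norm_nonneg (n - n'), norm_nonneg f]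
  calc ‖(𝒞.toMultiplier f).fst n‖ = ‖(𝒞.toMultiplier f).fst (n - n') +
        (𝒞.toMultiplier f).fst n'‖ := by rw [← map_add, sub_add_cancel]
    _ ≤ _ := norm_add_le _ _
    _ ≤ ε := by linarith

theorem norm_fibreMul_le (x : X) (a b : Fibre 𝒞.orbit x) : ‖𝒞.fibreMul x a b‖ ≤ ‖a‖ * ‖b‖ :=
  norm_map₂_le_of_toFibre (B := fun a b => a * b) (T := fun a b => 𝒞.fibreMul x a b)
    (𝒞.fibreMul_toFibre x) norm_mul_le a b

theorem norm_fibreStar_le (x : X) (a : Fibre 𝒞.orbit x) : ‖𝒞.fibreStar x a‖ ≤ ‖a‖ := by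
  refine le_of_forall_pos_le_add fun ε hε => ?_
  obtain ⟨a', rfl, ha⟩ := exists_norm_lt _ x a hε
  rw [fibreStar_toFibre]
  refine (norm_toFibre_le_norm _ _ _).trans ?_
  rw [norm_star]
  exact ha.le

/-- The C⋆-identity in `C` is applied to `f • a` with a self-adjoint cutoff `f`, `f(x) = 1`. Writing
`a^* a = b + n` with `b` a nearly minimal lift of its class and `n` in the ideal at `x`, the term `f
• n` is negligible. -/
theorem norm_mul_self_le_norm_fibreMul_fibreStar [T2Space X] [LocallyCompactSpace X] (x : X)
    (a : Fibre 𝒞.orbit x) : ‖a‖ * ‖a‖ ≤ ‖𝒞.fibreMul x (𝒞.fibreStar x a) a‖ := by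
  refine le_of_forall_pos_le_add fun ε hε => ?_
  obtain ⟨a, rfl⟩ := toFibre_surjective _ x a
  rw [fibreStar_toFibre, fibreMul_toFibre]
  obtain ⟨b, hb, hbε⟩ := exists_norm_lt _ x (toFibre 𝒞.orbit x (star a * a)) (half_pos hε)
  have hn : star a * a - b ∈ fibreKer 𝒞.orbit x := by
    rw [← toFibre_eq_zero_iff, map_sub, hb, sub_self]
  obtain ⟨U, hU, hU'⟩ := 𝒞.exists_norm_fst_le_of_mem_fibreKer x hn (half_pos hε)
  obtain ⟨f, hfx, hf1, hfs, hfU⟩ := exists_bump_of_mem_nhds x hU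
  have h1 : ‖toFibre 𝒞.orbit x a‖ ≤ ‖(𝒞.toMultiplier f).fst a‖ := by
    have := norm_toFibre_le_norm 𝒞.orbit x ((𝒞.toMultiplier f).fst a)
    rwa [toFibre_fst, hfx, one_smul] at this
  have h2 : ‖(𝒞.toMultiplier f).fst a‖ * ‖(𝒞.toMultiplier f).fst a‖ ≤
      ‖(𝒞.toMultiplier f).fst (star a * a)‖ := by
    rw [← CStarRing.norm_star_mul_self, star_fst, hfs, fst_mul, mul_fst]
    refine (𝒞.norm_fst_le _ _).trans ?_
    exact mul_le_of_le_one_left (norm_nonneg _) hf1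
  have h3 : ‖(𝒞.toMultiplier f).fst b‖ ≤ ‖b‖ :=
    (𝒞.norm_fst_le _ _).trans (mul_le_of_le_one_left (norm_nonneg _) hf1)
  have h4 : ‖(𝒞.toMultiplier f).fst (star a * a)‖ ≤ ε / 2 + ‖b‖ := by
    calc ‖(𝒞.toMultiplier f).fst (star a * a)‖ = ‖(𝒞.toMultiplier f).fst (star a * a - b) +
          (𝒞.toMultiplier f).fst b‖ := by rw [← map_add, sub_add_cancel]
      _ ≤ _ := (norm_add_le _ _).trans (add_le_add (hU' f hf1 hfU) h3)
  have h5 := mul_le_mul h1 h1 (norm_nonneg _) (norm_nonneg _)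
  linarith

variable [T2Space X] [LocallyCompactSpace X]

/-- The fibre `C_x`, as a C⋆-algebra. -/
def FibreAlgebra (x : X) : Type _ := Fibre 𝒞.orbit x

/-- The fibres of a `C₀(X)`-algebra are C⋆-algebras. -/
@[reducible]
noncomputable def fibreCStarAlgebra (x : X) : NonUnitalCStarAlgebra (Fibre 𝒞.orbit x) where
  __ := (inferInstance : NormedAddCommGroup (Fibre 𝒞.orbit x))
  __ := (inferInstance : NormedSpace ℂ (Fibre 𝒞.orbit x))
  mul a b := 𝒞.fibreMul x a b
  left_distrib a b c := map_add (𝒞.fibreMul x a) b c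
  right_distrib a b c := by
    change 𝒞.fibreMul x (a + b) c = 𝒞.fibreMul x a c + 𝒞.fibreMul x b c
    rw [map_add]; rfl
  zero_mul a := by change 𝒞.fibreMul x 0 a = 0; rw [map_zero]; rfl
  mul_zero a := map_zero (𝒞.fibreMul x a)
  mul_assoc a b c := by
    obtain ⟨a, rfl⟩ := toFibre_surjective _ x a
    obtain ⟨b, rfl⟩ := toFibre_surjective _ x b
    obtain ⟨c, rfl⟩ := toFibre_surjective _ x c
    change 𝒞.fibreMul x (𝒞.fibreMul x _ _) _ = 𝒞.fibreMul x _ (𝒞.fibreMul x _ _)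
    simp only [fibreMul_toFibre, mul_assoc]
  norm_mul_le a b := 𝒞.norm_fibreMul_le x a b
  star a := 𝒞.fibreStar x a
  star_involutive a := by
    obtain ⟨a, rfl⟩ := toFibre_surjective _ x a
    change 𝒞.fibreStar x (𝒞.fibreStar x _) = _
    simp only [fibreStar_toFibre, star_star]
  star_mul a b := by
    obtain ⟨a, rfl⟩ := toFibre_surjective _ x a
    obtain ⟨b, rfl⟩ := toFibre_surjective _ x b
    change 𝒞.fibreStar x (𝒞.fibreMul x _ _) = 𝒞.fibreMul x (𝒞.fibreStar x _) (𝒞.fibreStar x _)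
    simp only [fibreStar_toFibre, fibreMul_toFibre, star_mul]
  star_add a b := map_add (𝒞.fibreStar x) a b
  toCompleteSpace := (inferInstance : CompleteSpace (C ⧸ fibreKer 𝒞.orbit x))
  norm_mul_self_le a := 𝒞.norm_mul_self_le_norm_fibreMul_fibreStar x a
  smul_assoc z a b := by
    change 𝒞.fibreMul x (z • a) b = z • 𝒞.fibreMul x a b
    rw [map_smul]; rfl
  smul_comm z a b := (map_smul (𝒞.fibreMul x a) z b).symm
  star_smul z a := map_smulₛₗ (𝒞.fibreStar x) z a

noncomputable instance (x : X) : NonUnitalCStarAlgebra (𝒞.FibreAlgebra x) :=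
  𝒞.fibreCStarAlgebra x

/-- The identity map from the fibre `C_x` to the C⋆-algebra `C_x`. -/
noncomputable def toFibreAlgebra (x : X) : Fibre 𝒞.orbit x ≃ₗ[ℂ] 𝒞.FibreAlgebra x where
  toFun a := a
  invFun a := a
  map_add' _ _ := rfl
  map_smul' _ _ := rfl
  left_inv _ := rfl
  right_inv _ := rfl

theorem toFibreAlgebra_fibreMul (x : X) (a b : Fibre 𝒞.orbit x) :
    𝒞.toFibreAlgebra x (𝒞.fibreMul x a b) = 𝒞.toFibreAlgebra x a * 𝒞.toFibreAlgebra x b := rfl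

theorem toFibreAlgebra_fibreStar (x : X) (a : Fibre 𝒞.orbit x) :
    𝒞.toFibreAlgebra x (𝒞.fibreStar x a) = star (𝒞.toFibreAlgebra x a) := rfl

theorem norm_toFibreAlgebra (x : X) (a : Fibre 𝒞.orbit x) : ‖𝒞.toFibreAlgebra x a‖ = ‖a‖ := rfl

theorem norm_fibreStar (x : X) (a : Fibre 𝒞.orbit x) : ‖𝒞.fibreStar x a‖ = ‖a‖ := by
  rw [← norm_toFibreAlgebra, toFibreAlgebra_fibreStar, norm_star, norm_toFibreAlgebra]

theorem fibreStar_fibreMul (x : X) (a b : Fibre 𝒞.orbit x) :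
    𝒞.fibreStar x (𝒞.fibreMul x a b) = 𝒞.fibreMul x (𝒞.fibreStar x b) (𝒞.fibreStar x a) :=
  star_mul (𝒞.toFibreAlgebra x a) (𝒞.toFibreAlgebra x b)

end C0Algebra

/-! ## The fibres of a Hilbert module -/

namespace HilbertModule

section

variable {X : Type*} [TopologicalSpace X] {C : Type*} [NonUnitalCStarAlgebra C]
  (𝒞 : C0Algebra X C) {E : Type*} [NormedAddCommGroup E] [NormedSpace ℂ E]
  (𝓔 : HilbertModule C E)

theorem norm_fibreInner_le (x : X) (a b : Fibre (𝓔.orbit 𝒞) x) :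
    ‖𝓔.fibreInner 𝒞 x a b‖ ≤ ‖a‖ * ‖b‖ :=
  norm_map₂_le_of_toFibre (B := 𝓔.inner) (T := fun a b => 𝓔.fibreInner 𝒞 x a b)
    (𝓔.fibreInner_toFibre 𝒞 x) 𝓔.norm_inner_le a b

theorem norm_fibreRsmul_le (x : X) (a : Fibre (𝓔.orbit 𝒞) x) (b : Fibre 𝒞.orbit x) :
    ‖𝓔.fibreRsmul 𝒞 x a b‖ ≤ ‖a‖ * ‖b‖ :=
  norm_map₂_le_of_toFibre (B := 𝓔.rsmul) (T := fun a b => 𝓔.fibreRsmul 𝒞 x a b)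
    (𝓔.fibreRsmul_toFibre 𝒞 x) 𝓔.norm_rsmul_le a b

theorem fibreStar_fibreInner (x : X) (a b : Fibre (𝓔.orbit 𝒞) x) :
    𝒞.fibreStar x (𝓔.fibreInner 𝒞 x a b) = 𝓔.fibreInner 𝒞 x b a := by
  obtain ⟨a, rfl⟩ := toFibre_surjective _ x a
  obtain ⟨b, rfl⟩ := toFibre_surjective _ x b
  simp only [fibreInner_toFibre, C0Algebra.fibreStar_toFibre, star_inner]

theorem fibreInner_fibreRsmul (x : X) (a b : Fibre (𝓔.orbit 𝒞) x) (c : Fibre 𝒞.orbit x) :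
    𝓔.fibreInner 𝒞 x a (𝓔.fibreRsmul 𝒞 x b c) = 𝒞.fibreMul x (𝓔.fibreInner 𝒞 x a b) c := by
  obtain ⟨a, rfl⟩ := toFibre_surjective _ x a
  obtain ⟨b, rfl⟩ := toFibre_surjective _ x b
  obtain ⟨c, rfl⟩ := toFibre_surjective _ x c
  simp only [fibreInner_toFibre, C0Algebra.fibreMul_toFibre, fibreRsmul_toFibre,
    inner_rsmul_right]

theorem exists_fibreInner_self_eq (x : X) (a : Fibre (𝓔.orbit 𝒞) x) :
    ∃ b, 𝓔.fibreInner 𝒞 x a a = 𝒞.fibreMul x (𝒞.fibreStar x b) b := by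
  obtain ⟨a, rfl⟩ := toFibre_surjective _ x a
  obtain ⟨b, hb⟩ := 𝓔.inner_self_nonneg a
  exact ⟨toFibre _ x b, by rw [fibreInner_toFibre, hb]; rfl⟩

theorem exists_norm_sub_rsmul_lt (e : E) {ε : ℝ} (hε : 0 < ε) :
    ∃ b : C, ‖b‖ ≤ 1 ∧ star b = b ∧ ‖e - 𝓔.rsmul e b‖ < ε := by
  let : PartialOrder C := CStarAlgebra.spectralOrder C
  have : StarOrderedRing C := CStarAlgebra.spectralOrderedRing C
  have hu := CStarAlgebra.increasingApproximateUnit C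
  -- The bound `ε² / 2` leaves room for the two terms of `‖e - e b‖² = ‖d - b d‖ ≤ 2 ‖d‖`, where `d
  -- = ⟨e, e⟩ - ⟨e, e⟩ b`.
  obtain ⟨b, hb, hb1, hbs⟩ := (((hu.tendsto_mul_left (𝓔.inner e e)).eventually
    (Metric.ball_mem_nhds _ (show 0 < ε ^ 2 / 2 by positivity))).and
    (hu.eventually_norm.and hu.eventually_star_eq)).exists
  refine ⟨b, hb1, hbs, ?_⟩
  have hd : ‖𝓔.inner e e - 𝓔.inner e e * b‖ < ε ^ 2 / 2 := by
    rwa [dist_comm, dist_eq_norm] at hb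
  have hexp : 𝓔.inner (e - 𝓔.rsmul e b) (e - 𝓔.rsmul e b) =
      (𝓔.inner e e - 𝓔.inner e e * b) - b * (𝓔.inner e e - 𝓔.inner e e * b) := by
    change 𝓔.innerₛₗ (e - 𝓔.rsmul e b) (e - 𝓔.rsmul e b) = _
    rw [map_sub (𝓔.innerₛₗ (e - 𝓔.rsmul e b)), map_sub 𝓔.innerₛₗ, LinearMap.sub_apply,
      LinearMap.sub_apply]
    rw [sub_sub_sub_comm]
    change (𝓔.inner e e - 𝓔.inner e (𝓔.rsmul e b)) -
      (𝓔.inner (𝓔.rsmul e b) e - 𝓔.inner (𝓔.rsmul e b) (𝓔.rsmul e b)) = _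
    have h1 : 𝓔.inner (𝓔.rsmul e b) e = b * 𝓔.inner e e := by
      rw [← 𝓔.star_inner, 𝓔.inner_rsmul_right, star_mul, 𝓔.star_inner, hbs]
    rw [𝓔.inner_rsmul_right, 𝓔.inner_rsmul_right, h1, mul_sub, mul_assoc]
  have h2 : ‖e - 𝓔.rsmul e b‖ ^ 2 < ε ^ 2 := by
    rw [𝓔.norm_sq_eq, hexp]
    refine (norm_sub_le _ _).trans_lt ?_
    have h3 := norm_mul_le b (𝓔.inner e e - 𝓔.inner e e * b)
    nlinarith [norm_nonneg (𝓔.inner e e - 𝓔.inner e e * b)]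
  exact lt_of_pow_lt_pow_left₀ 2 hε.le h2

/-- The inner product of the fibre `E_x` is definite. -/
theorem eq_zero_of_fibreInner_self [T2Space X] [LocallyCompactSpace X] (x : X)
    (e : Fibre (𝓔.orbit 𝒞) x) (he : 𝓔.fibreInner 𝒞 x e e = 0) : e = 0 := by
  obtain ⟨a, rfl⟩ := toFibre_surjective _ x e
  rw [fibreInner_toFibre, toFibre_eq_zero_iff] at he
  rw [← norm_eq_zero]
  refine le_antisymm (le_of_forall_pos_le_add fun ε hε => ?_) (norm_nonneg _)
  -- `C₀(X)` acts on `E` only through products `a · b`, so `a` is first replaced by `a · b`. A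
  -- cutoff `f` at `x` does not change the class of `a · b` at `x`, while `‖a · (f • b)‖² ≤ ‖f • ⟨a,
  -- a⟩‖` is small because `⟨a, a⟩` lies in the ideal at `x`.
  obtain ⟨b, hb1, -, hb⟩ := 𝓔.exists_norm_sub_rsmul_lt a (half_pos hε)
  obtain ⟨U, hU, hU'⟩ := 𝒞.exists_norm_fst_le_of_mem_fibreKer x he
    (show 0 < (ε / 2) ^ 2 by positivity)
  obtain ⟨f, hfx, hf1, hfs, hfU⟩ := exists_bump_of_mem_nhds x hU
  have hfb : ‖(𝒞.toMultiplier f).fst b‖ ≤ 1 := (𝒞.norm_fst_le f b).trans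
    (mul_le_one₀ hf1 (norm_nonneg _) hb1)
  have h1 : toFibre (𝓔.orbit 𝒞) x (𝓔.rsmul a b) =
      toFibre (𝓔.orbit 𝒞) x (𝓔.rsmul a ((𝒞.toMultiplier f).fst b)) := by
    rw [← fibreRsmul_toFibre, ← fibreRsmul_toFibre, 𝒞.toFibre_fst, hfx, one_smul]
  have h2 : ‖𝓔.rsmul a ((𝒞.toMultiplier f).fst b)‖ ≤ ε / 2 := by
    refine le_of_sq_le_sq ?_ (half_pos hε).le
    have h3 : 𝓔.inner (𝓔.rsmul a ((𝒞.toMultiplier f).fst b))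
        (𝓔.rsmul a ((𝒞.toMultiplier f).fst b)) =
        star ((𝒞.toMultiplier f).fst b) * ((𝒞.toMultiplier f).fst (𝓔.inner a a) * b) := by
      rw [𝓔.inner_rsmul_right, ← 𝓔.star_inner, 𝓔.inner_rsmul_right, star_mul, 𝓔.star_inner,
        mul_assoc, 𝒞.mul_fst, 𝒞.fst_mul]
    rw [𝓔.norm_sq_eq, h3]
    refine (norm_mul_le _ _).trans ?_
    rw [norm_star]
    have h4 := hU' f hf1 hfU
    have h5 := norm_mul_le ((𝒞.toMultiplier f).fst (𝓔.inner a a)) b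
    have h6 : ‖(𝒞.toMultiplier f).fst (𝓔.inner a a) * b‖ ≤ (ε / 2) ^ 2 := by
      refine h5.trans ((mul_le_of_le_one_right (norm_nonneg _) hb1).trans h4)
    exact (mul_le_of_le_one_left (norm_nonneg _) hfb).trans h6
  calc ‖toFibre (𝓔.orbit 𝒞) x a‖
      = ‖toFibre (𝓔.orbit 𝒞) x (a - 𝓔.rsmul a b) +
          toFibre (𝓔.orbit 𝒞) x (𝓔.rsmul a ((𝒞.toMultiplier f).fst b))‖ := by
        rw [← h1, ← map_add, sub_add_cancel]
    _ ≤ ‖a - 𝓔.rsmul a b‖ + ‖𝓔.rsmul a ((𝒞.toMultiplier f).fst b)‖ :=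
        (norm_add_le _ _).trans (add_le_add (norm_toFibre_le_norm _ _ _)
          (norm_toFibre_le_norm _ _ _))
    _ ≤ 0 + ε := by linarith

end

end HilbertModule

end GroupoidCrossedProduct

namespace GroupoidCrossedProduct

/-! ## Computations in étale groupoids -/

namespace EtaleGroupoid

section Algebra

variable {H : Type uH} [TopologicalSpace H] (G : EtaleGroupoid H)

theorem mul_congr {g g' h h' : H} (hg : g = g') (hh : h = h') (e : G.s g = G.r h) :
    G.mul g h e = G.mul g' h' (hg ▸ hh ▸ e) := by
  subst hg hh; rfl

theorem mul_unit' (g : H) (x : G.units) (e : G.s g = G.r x) : G.mul g x e = g := by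
  have hx : x = G.s g := by rw [e, G.r_unit]
  subst hx
  exact G.mul_unit g

theorem unit_mul' (g : H) (x : G.units) (e : G.s x = G.r g) : G.mul x g e = g := by
  have hx : x = G.r g := by rw [← e, G.s_unit]
  subst hx
  exact G.unit_mul g

theorem mul_mul_inv (g h : H) (e : G.s g = G.r h) :
    G.mul (G.mul g h e) (G.inv h) ((G.s_mul g h e).trans (G.r_inv h).symm) = g := by
  rw [G.mul_assoc g h (G.inv h) e (G.r_inv h).symm, G.mul_congr rfl (G.mul_inv h), G.mul_unit']

theorem mul_inv_mul (g h : H) (e : G.s g = G.r (G.inv h)) :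
    G.mul (G.mul g (G.inv h) e) h ((G.s_mul _ _ e).trans (G.s_inv h)) = g := by
  rw [G.mul_assoc g (G.inv h) h e (G.s_inv h), G.mul_congr rfl (G.inv_mul h), G.mul_unit']

theorem inv_mul_mul (g h : H) (e : G.s g = G.r h) :
    G.mul (G.inv g) (G.mul g h e) ((G.s_inv g).trans (G.r_mul g h e).symm) = h := by
  rw [← G.mul_assoc (G.inv g) g h (G.s_inv g) e, G.mul_congr (G.inv_mul g) rfl, G.unit_mul']

theorem mul_inv_mul_cancel (g h : H) (e : G.s (G.inv g) = G.r h) :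
    G.mul g (G.mul (G.inv g) h e) ((G.r_inv g).symm.trans (G.r_mul _ h e).symm) = h := by
  rw [← G.mul_assoc g (G.inv g) h (G.r_inv g).symm e, G.mul_congr (G.mul_inv g) rfl, G.unit_mul']

theorem inv_inv (g : H) : G.inv (G.inv g) = g := by
  have h1 : G.mul (G.inv (G.inv g)) (G.mul (G.inv g) g (G.s_inv g))
      ((G.s_inv (G.inv g)).trans (G.r_mul _ _ _).symm) = g :=
    G.inv_mul_mul (G.inv g) g (G.s_inv g)
  rw [G.mul_congr rfl (G.inv_mul g), G.mul_unit'] at h1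
  exact h1

theorem inv_injective : Function.Injective G.inv := fun g h e => by
  rw [← G.inv_inv g, e, G.inv_inv]

theorem inv_mul_rev (g h : H) (e : G.s g = G.r h) :
    G.inv (G.mul g h e) =
      G.mul (G.inv h) (G.inv g) ((G.s_inv h).trans (e.symm.trans (G.r_inv g).symm)) := by
  have h1 := G.mul_inv_mul (G.inv h) g
    ((G.s_inv h).trans (e.symm.trans (G.r_inv g).symm))
  have h2 := G.mul_mul_inv (G.mul (G.inv h) (G.inv g)
    ((G.s_inv h).trans (e.symm.trans (G.r_inv g).symm))) (G.mul g h e)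
    ((G.s_mul _ _ _).trans ((G.s_inv g).trans (G.r_mul g h e).symm))
  rw [← h2]
  have h3 : G.mul (G.mul (G.inv h) (G.inv g)
      ((G.s_inv h).trans (e.symm.trans (G.r_inv g).symm))) (G.mul g h e)
      ((G.s_mul _ _ _).trans ((G.s_inv g).trans (G.r_mul g h e).symm)) = G.s h := by
    rw [← G.mul_assoc _ g h ((G.s_mul _ _ _).trans (G.s_inv g)) e, G.mul_congr h1 rfl, G.inv_mul]
  rw [G.mul_congr h3 rfl, G.unit_mul']

theorem inv_unit (x : G.units) : G.inv (x : H) = x := by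
  have h := G.mul_inv x
  rw [G.unit_mul', G.r_unit] at h
  exact h

theorem coe_s_of_mem {g : H} (hg : g ∈ G.units) : (G.s g : H) = g :=
  congrArg Subtype.val (G.s_unit ⟨g, hg⟩)

theorem coe_r_of_mem {g : H} (hg : g ∈ G.units) : (G.r g : H) = g :=
  congrArg Subtype.val (G.r_unit ⟨g, hg⟩)

theorem inv_of_mem {g : H} (hg : g ∈ G.units) : G.inv g = g := G.inv_unit ⟨g, hg⟩

theorem r_eq_s_of_mem {g : H} (hg : g ∈ G.units) : G.r g = G.s g :=
  Subtype.ext ((G.coe_r_of_mem hg).trans (G.coe_s_of_mem hg).symm)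

theorem inv_mem_units_iff {g : H} : G.inv g ∈ G.units ↔ g ∈ G.units :=
  ⟨fun h => by
    have := G.inv_of_mem h
    rw [G.inv_inv] at this
    rwa [this], fun h => by rwa [G.inv_of_mem h]⟩

/-- If `gh = g` then `h` is a unit. -/
theorem mem_units_of_mul_eq_left {g h : H} {e : G.s g = G.r h} (hgh : G.mul g h e = g) :
    h ∈ G.units := by
  have h1 := G.inv_mul_mul g h e
  rw [G.mul_congr rfl hgh, G.inv_mul] at h1
  rw [← h1]
  exact (G.s g).2

theorem mul_left_injective {g g' h : H} {e : G.s g = G.r h} {e' : G.s g' = G.r h}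
    (hgg : G.mul g h e = G.mul g' h e') : g = g' := by
  rw [← G.mul_mul_inv g h e, G.mul_congr hgg rfl, G.mul_mul_inv]

end Algebra

section Topology

variable {H : Type uH} [TopologicalSpace H] (G : EtaleGroupoid H)

/-- Inversion as a homeomorphism. -/
def invHomeomorph : H ≃ₜ H where
  toFun := G.inv
  invFun := G.inv
  left_inv := G.inv_inv
  right_inv := G.inv_inv
  continuous_toFun := G.continuous_inv
  continuous_invFun := G.continuous_inv

theorem isLocalHomeomorph_s : IsLocalHomeomorph G.s := by
  have : (G.s : H → G.units) = G.r ∘ G.invHomeomorph := funext fun g => (G.r_inv g).symm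
  rw [this]
  exact G.isLocalHomeomorph_r.comp G.invHomeomorph.isLocalHomeomorph

theorem isClosed_units [T2Space H] : IsClosed G.units := by
  have : G.units = {g | (G.r g : H) = g} :=
    Set.ext fun g => ⟨G.coe_r_of_mem, fun h => h ▸ (G.r g).2⟩
  rw [this]
  exact isClosed_eq (continuous_subtype_val.comp G.r.continuous) continuous_id

theorem isClosed_composable [T2Space H] : IsClosed {p : H × H | G.s p.1 = G.r p.2} :=
  isClosed_eq (G.s.continuous.comp continuous_fst) (G.r.continuous.comp continuous_snd)

end Topology

end EtaleGroupoid

/-- Local compactness passes from the unit space to `H` and `Ω`, where partitions of unity and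
compact neighbourhoods are needed. -/
theorem locallyCompactSpace_of_isLocalHomeomorph {W B : Type*} [TopologicalSpace W]
    [TopologicalSpace B] [LocallyCompactSpace B] {k : W → B} (hk : IsLocalHomeomorph k) :
    LocallyCompactSpace W := by
  refine ⟨fun w U hU => ?_⟩
  obtain ⟨e, hwe, rfl⟩ := hk w
  have hV : e.symm ⁻¹' U ∩ e.target ∈ 𝓝 (e w) :=
    Filter.inter_mem (e.symm.continuousAt (e.map_source hwe) (by rwa [e.left_inv hwe]))
      (e.open_target.mem_nhds (e.map_source hwe))
  obtain ⟨K, hK, hKV, hKc⟩ := local_compact_nhds hV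
  refine ⟨e.symm '' K, ?_, ?_, hKc.image_of_continuousOn
    (e.continuousOn_symm.mono fun y hy => (hKV hy).2)⟩
  · filter_upwards [e.continuousAt hwe hK, e.open_source.mem_nhds hwe] with w' h1 h2
    exact ⟨e w', h1, e.left_inv h2⟩
  · rintro _ ⟨y, hy, rfl⟩
    exact (hKV hy).1

theorem isCompact_image_subtype {Z W : Type*} [TopologicalSpace Z] [TopologicalSpace W]
    {p : Z → Prop} (hp : IsClosed {z | p z}) {φ : {z // p z} → W} (hφ : Continuous φ) {K : Set Z}
    (hK : IsCompact K) : IsCompact (φ '' {z | z.1 ∈ K}) :=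
  (hp.isClosedEmbedding_subtypeVal.isCompact_preimage hK).image hφ

namespace RightSpaceAction

variable {H : Type uH} [TopologicalSpace H] {G : EtaleGroupoid H}
  {Ω : Type uΩ} [TopologicalSpace Ω] (ρ : RightSpaceAction G Ω)

theorem act_congr {ω ω' : Ω} {h h' : H} (hω : ω = ω') (hh : h = h') (e : ρ.σ ω = G.r h) :
    ρ.act ω h e = ρ.act ω' h' (hω ▸ hh ▸ e) := by
  subst hω hh; rfl

theorem act_unit' (ω : Ω) (x : G.units) (e : ρ.σ ω = G.r x) : ρ.act ω x e = ω := by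
  have hx : x = ρ.σ ω := by rw [e, G.r_unit]
  subst hx
  exact ρ.act_unit ω

theorem act_act_inv (ω : Ω) (h : H) (e : ρ.σ ω = G.r h) :
    ρ.act (ρ.act ω h e) (G.inv h) ((ρ.σ_act ω h e).trans (G.r_inv h).symm) = ω := by
  rw [← ρ.act_mul ω h (G.inv h) e (G.r_inv h).symm, ρ.act_congr rfl (G.mul_inv h), ρ.act_unit']

theorem act_inv_act (ω : Ω) (h : H) (e : ρ.σ ω = G.r (G.inv h)) :
    ρ.act (ρ.act ω (G.inv h) e) h ((ρ.σ_act ω _ e).trans (G.s_inv h)) = ω := by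
  rw [← ρ.act_mul ω (G.inv h) h e (G.s_inv h), ρ.act_congr rfl (G.inv_mul h), ρ.act_unit']

theorem isClosed_composable [T2Space H] :
    IsClosed {p : Ω × H | ρ.σ p.1 = G.r p.2} :=
  isClosed_eq (ρ.σ.continuous.comp continuous_fst) (G.r.continuous.comp continuous_snd)

/-- Compactness of the set of all `(ω, h)` with `ω ∈ K` and `ω · h ∈ L`, for a proper action. -/
theorem IsProper.isCompact [T2Space H] {ρ : RightSpaceAction G Ω} (hρ : ρ.IsProper) {K L : Set Ω}
    (hK : IsCompact K) (hL : IsCompact L) :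
    IsCompact {p : Ω × H | ∃ e : ρ.σ p.1 = G.r p.2, p.1 ∈ K ∧ ρ.act p.1 p.2 e ∈ L} := by
  convert (IsProperMap.isCompact_preimage hρ (hL.prod hK)).image continuous_subtype_val using 1
  ext p
  constructor
  · rintro ⟨e, h1, h2⟩
    exact ⟨⟨p, e⟩, ⟨h2, h1⟩, rfl⟩
  · rintro ⟨⟨p, e⟩, ⟨h2, h1⟩, rfl⟩
    exact ⟨e, h1, h2⟩

/-- The action of a groupoid on itself by right multiplication. -/
def self (G : EtaleGroupoid H) : RightSpaceAction G H where
  σ := G.s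
  act := G.mul
  continuous_act := G.continuous_mul
  σ_act := G.s_mul
  act_unit := G.mul_unit
  act_mul ω h k e e' := (G.mul_assoc ω h k e e').symm

end RightSpaceAction

namespace BundleAction

variable {H : Type uH} [TopologicalSpace H] {G : EtaleGroupoid H}
  {A ι : Type*} [NormedAddCommGroup A] [NormedSpace ℂ A] {m : ι → C₀(G.units, ℂ) →L[ℂ] A}
  (β : BundleAction G m)

theorem act_congr {x y : G.units} {g g' : H} (h : g = g') (hs : G.s g = x) (hr : G.r g = y)
    (a : Fibre m x) : β.act g hs hr a = β.act g' (h ▸ hs) (h ▸ hr) a := by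
  subst h; rfl

theorem act_cast {x x' y : G.units} (g : H) (hs : G.s g = x) (hr : G.r g = y) (e : x' = x)
    (a : Fibre m x') : β.act g hs hr (Fibre.cast e a) = β.act g (hs.trans e.symm) hr a := by
  subst e; rfl

theorem cast_act {x y y' : G.units} (g : H) (hs : G.s g = x) (hr : G.r g = y) (e : y = y')
    (a : Fibre m x) : Fibre.cast e (β.act g hs hr a) = β.act g hs (hr.trans e) a := by
  subst e; rfl

theorem act_unit' {x y : G.units} {g : H} (hg : g ∈ G.units) (hs : G.s g = x) (hr : G.r g = y)
    (a : Fibre m x) :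
    β.act g hs hr a = Fibre.cast (hs.symm.trans ((G.r_eq_s_of_mem hg).symm.trans hr)) a := by
  obtain rfl : x = ⟨g, hg⟩ := hs.symm.trans (G.s_unit ⟨g, hg⟩)
  obtain rfl : y = ⟨g, hg⟩ := hr.symm.trans (G.r_unit ⟨g, hg⟩)
  exact β.act_unit ⟨g, hg⟩ a

/-- The product is a separate variable `k`, so that any expression for it can be substituted. -/
theorem act_act {x y z : G.units} {g h k : H} (hg : G.s g = y) (hg' : G.r g = z) (hh : G.s h = x)
    (hh' : G.r h = y) (hk : G.mul g h (hg.trans hh'.symm) = k) (a : Fibre m x) :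
    β.act g hg hg' (β.act h hh hh' a) =
      β.act k (hk ▸ (G.s_mul g h _).trans hh) (hk ▸ (G.r_mul g h _).trans hg') a := by
  subst hk
  exact (β.act_mul g h hg hg' hh hh' a).symm

theorem act_inv_act {x y : G.units} {g : H} (hs : G.s g = x) (hr : G.r g = y)
    (hs' : G.s (G.inv g) = y) (hr' : G.r (G.inv g) = x) (a : Fibre m x) :
    β.act (G.inv g) hs' hr' (β.act g hs hr a) = a := by
  rw [β.act_act hs' hr' hs hr (G.inv_mul g), β.act_unit' (G.s g).2]
  rfl

@[simp] theorem act_eq_zero {x y : G.units} (g : H) (hs : G.s g = x) (hr : G.r g = y)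
    (a : Fibre m x) : β.act g hs hr a = 0 ↔ a = 0 :=
  (β.act g hs hr).map_eq_zero_iff

theorem norm_act {x y : G.units} (g : H) (hs : G.s g = x) (hr : G.r g = y)
    (a : Fibre m x) : ‖β.act g hs hr a‖ = ‖a‖ := (β.act g hs hr).norm_map a

end BundleAction

end GroupoidCrossedProduct

namespace GroupoidCrossedProduct

/-! ### Exchange of finite sums and transport of section values -/

theorem finsum_comm_of_finite {κ₁ κ₂ M : Type*} [AddCommMonoid M] (T : κ₁ → κ₂ → M) {s : Set κ₁}
    {t : Set κ₂} (hs : s.Finite) (ht : t.Finite) (h₁ : ∀ a b, T a b ≠ 0 → a ∈ s)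
    (h₂ : ∀ a b, T a b ≠ 0 → b ∈ t) : ∑ᶠ a, ∑ᶠ b, T a b = ∑ᶠ b, ∑ᶠ a, T a b := by
  have e1 : ∀ a, ∑ᶠ b, T a b = ∑ b ∈ ht.toFinset, T a b := fun a =>
    finsum_eq_sum_of_support_subset _ fun b hb => by simpa using h₂ a b hb
  have e2 : ∀ b, ∑ᶠ a, T a b = ∑ a ∈ hs.toFinset, T a b := fun b =>
    finsum_eq_sum_of_support_subset _ fun a ha => by simpa using h₁ a b ha
  simp only [e1, e2]
  rw [finsum_eq_sum_of_support_subset (s := hs.toFinset),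
    finsum_eq_sum_of_support_subset (s := ht.toFinset), Finset.sum_comm]
  · intro b hb
    obtain ⟨a, -, ha⟩ := Finset.exists_ne_zero_of_sum_ne_zero hb
    simpa using h₂ a b ha
  · intro a ha
    obtain ⟨b, -, hb⟩ := Finset.exists_ne_zero_of_sum_ne_zero ha
    simpa using h₁ a b hb

theorem continuousAt_section_cast {X : Type*} [TopologicalSpace X] {A ι : Type*}
    [NormedAddCommGroup A] [NormedSpace ℂ A] (m : ι → C₀(X, ℂ) →L[ℂ] A) {Y : Type*}
    [TopologicalSpace Y] {f f' : Y → X} (e : ∀ y, f y = f' y) {ξ : ∀ y, Fibre m (f y)} {y₀ : Y}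
    (hξ : ContinuousAt (fun y => (⟨f y, ξ y⟩ : TotalSpace m)) y₀) :
    ContinuousAt (fun y => (⟨f' y, Fibre.cast (e y) (ξ y)⟩ : TotalSpace m)) y₀ := by
  simpa only [Fibre.mk_cast] using hξ

theorem continuousAt_section_comp {X : Type*} [TopologicalSpace X] [T2Space X]
    [LocallyCompactSpace X] {A ι : Type*} [NormedAddCommGroup A] [NormedSpace ℂ A]
    {m : ι → C₀(X, ℂ) →L[ℂ] A} {Y Z : Type*} [TopologicalSpace Y] [TopologicalSpace Z] {f : C(Y, X)}
    {ξ : ∀ y, Fibre m (f y)} (hξ : ξ ∈ compactSections m f) {g : Z → Y} {z₀ : Z}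
    (hg : ContinuousAt g z₀) :
    ContinuousAt (fun z => (⟨f (g z), ξ (g z)⟩ : TotalSpace m)) z₀ := by
  have h : Continuous (fun y => (⟨f y, ξ y⟩ : TotalSpace m)) := hξ.1
  exact ContinuousAt.comp (f := g) (g := fun y => (⟨f y, ξ y⟩ : TotalSpace m)) h.continuousAt hg

section

variable {H : Type uH} [TopologicalSpace H] {G : EtaleGroupoid H}

theorem BundleAction.act_section_congr {A ι : Type*} [NormedAddCommGroup A] [NormedSpace ℂ A]
    {m : ι → C₀(G.units, ℂ) →L[ℂ] A} (β : BundleAction G m) {Y : Type*} {f : Y → G.units}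
    (F : ∀ y, Fibre m (f y)) {y y' : Y} (h : y = y') {g : H} {x : G.units} (hs : G.s g = f y)
    (hr : G.r g = x) : β.act g hs hr (F y) = β.act g (h ▸ hs) hr (F y') := by
  subst h; rfl

theorem BundleAction.act_inv_inv {A ι : Type*} [NormedAddCommGroup A] [NormedSpace ℂ A]
    {m : ι → C₀(G.units, ℂ) →L[ℂ] A} (β : BundleAction G m) {x y : G.units} {g : H}
    (hs : G.s (G.inv g) = y) (hr : G.r (G.inv g) = x) (hs' : G.s (G.inv (G.inv g)) = x)
    (hr' : G.r (G.inv (G.inv g)) = y) (a : Fibre m x) :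
    β.act (G.inv g) hs hr (β.act (G.inv (G.inv g)) hs' hr' a) = a := by
  rw [β.act_congr (G.inv_inv g), β.act_inv_act]

variable [T2Space H]

/-! ## The operations on compactly supported sections -/

namespace CStarAction

variable {C : Type uC} [NonUnitalCStarAlgebra C] {𝒞 : C0Algebra G.units C} (α : CStarAction G 𝒞)

theorem conv_mem {a b : ∀ g, Fibre 𝒞.orbit (G.s g)} (ha : a ∈ α.Sections) (hb : b ∈ α.Sections) :
    α.conv a b ∈ α.Sections := by
  -- A nonzero summand has `u = gh` in the support of `a` and `v = h⁻¹` in the support of `b`, and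
  -- `(g, h) = (uv, v⁻¹)` is recovered continuously.
  let φ : {p : H × H // G.s p.1 = G.r p.2} → H × H := fun p => (G.mul p.1.1 p.1.2 p.2, G.inv p.1.2)
  have hφ : Continuous φ :=
    G.continuous_mul.prodMk (G.continuous_inv.comp (continuous_snd.comp continuous_subtype_val))
  refine finsum_fibre_mem_compactSections 𝒞.orbit G.s G.isLocalHomeomorph_r G.s.continuous
    (fun g h e => 𝒞.fibreMul (G.s g)
      (α.act h (G.s_mul g h e.symm).symm e (a (G.mul g h e.symm)))
      (Fibre.cast ((G.s_inv h).trans e) (b (G.inv h)))) ?_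
    (φ '' {p | p.1 ∈ (closure {g | a g ≠ 0}) ×ˢ closure {g | b g ≠ 0}})
    (isCompact_image_subtype G.isClosed_composable hφ (ha.2.prod hb.2)) ?_
  · refine continuous_iff_continuousAt.2 fun p₀ => ?_
    have h1 : Continuous fun p : {p : H × H // G.r p.2 = G.s p.1} => p.1.2 :=
      continuous_snd.comp continuous_subtype_val
    have h2 : Continuous fun p : {p : H × H // G.r p.2 = G.s p.1} =>
        G.mul p.1.1 p.1.2 p.2.symm :=
      G.continuous_mul.comp (Continuous.subtype_mk continuous_subtype_val fun p => p.2.symm)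
    have ha1 := continuousAt_section_comp (z₀ := p₀) ha h2.continuousAt
    have hb1 := continuousAt_section_comp (z₀ := p₀) hb (G.continuous_inv.comp h1).continuousAt
    have h3 := α.continuousAt_section (y₀ := p₀)
      (fun p : {p : H × H // G.r p.2 = G.s p.1} => (G.s_mul p.1.1 p.1.2 p.2.symm).symm)
      (fun p => p.2) h1.continuousAt
      ha1
    have h4 := continuousAt_section_cast 𝒞.orbit (y₀ := p₀)
      (fun p : {p : H × H // G.r p.2 = G.s p.1} => (G.s_inv p.1.2).trans p.2)
      hb1
    exact continuousAt_section_map₂ (fun x y => x * y) 𝒞.fibreMul 𝒞.fibreMul_toFibre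
      𝒞.norm_fibreMul_le h3 h4
  · intro g h e hne
    have ha' : a (G.mul g h e.symm) ≠ 0 := fun h0 => hne (by simp [h0])
    have hb' : b (G.inv h) ≠ 0 := fun h0 => hne (by simp [h0])
    refine ⟨⟨(G.mul g h e.symm, G.inv h), (G.s_mul _ _ _).trans (G.r_inv h).symm⟩,
      ⟨subset_closure ha', subset_closure hb'⟩, ?_⟩
    exact Prod.ext (G.mul_mul_inv g h e.symm) (G.inv_inv h)

theorem invol_mem {a : ∀ g, Fibre 𝒞.orbit (G.s g)} (ha : a ∈ α.Sections) :
    α.invol a ∈ α.Sections := by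
  refine mem_compactSections_of_support_subset _ ?_ (ha.2.image G.continuous_inv) fun g hg => ?_
  · refine continuous_iff_continuousAt.2 fun g₀ => ?_
    have h1 := continuousAt_section_map star 𝒞.fibreStar 𝒞.fibreStar_toFibre
      𝒞.norm_fibreStar_le (f := fun g => G.s (G.inv g)) (ξ := fun g => a (G.inv g)) (y₀ := g₀)
      (continuousAt_section_comp ha G.continuous_inv.continuousAt)
    exact α.continuousAt_section (fun _ => rfl) G.r_inv G.continuous_inv.continuousAt h1
  · have : a (G.inv g) ≠ 0 := fun h0 => hg (by simp [invol, h0])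
    exact ⟨G.inv g, subset_closure this, G.inv_inv g⟩

/-- `(a^* * b)(g) = ∑_{s k = r g} (g⁻¹ · a(k)^*) b(kg)`. -/
theorem conv_invol_apply (a b : ∀ g, Fibre 𝒞.orbit (G.s g)) (g : H) :
    α.conv (α.invol a) b g = ∑ᶠ k : {k : H // G.s k = G.r g},
      𝒞.fibreMul (G.s g)
        (α.act (G.inv g) ((G.s_inv g).trans k.2.symm) (G.r_inv g) (𝒞.fibreStar (G.s k.1) (a k.1)))
        (Fibre.cast (G.s_mul k.1 g k.2) (b (G.mul k.1 g k.2))) := by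
  -- The substitution `h = (kg)⁻¹`, for which `gh = k⁻¹` and `h⁻¹ = kg`.
  let φ : {k : H // G.s k = G.r g} → {h : H // G.r h = G.s g} := fun k =>
    ⟨G.inv (G.mul k.1 g k.2), (G.r_inv _).trans (G.s_mul _ _ _)⟩
  have hφ : Function.Bijective φ := by
    constructor
    · intro k k' h
      exact Subtype.ext (G.mul_left_injective (G.inv_injective (congrArg Subtype.val h)))
    · intro h
      refine ⟨⟨G.inv (G.mul g h.1 h.2.symm), (G.s_inv _).trans (G.r_mul _ _ _)⟩, ?_⟩
      apply Subtype.ext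
      change G.inv (G.mul (G.inv (G.mul g h.1 _)) g _) = h.1
      rw [G.inv_mul_rev, G.mul_congr rfl (G.inv_inv _), G.inv_mul_mul]
  refine (finsum_eq_of_bijective φ hφ fun k => ?_).symm
  have hk : G.inv (G.mul g (φ k).1 (φ k).2.symm) = k.1 := by
    change G.inv (G.mul g (G.inv (G.mul k.1 g _)) _) = k.1
    rw [G.inv_mul_rev, G.mul_congr (G.inv_inv _) rfl, G.mul_mul_inv]
  congr 1
  · congr 1
    unfold invol
    rw [α.act_act (hk := rfl)]
    have h1 : G.mul (φ k).1 (G.inv (G.mul g (φ k).1 (φ k).2.symm))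
        ((G.s_mul g _ (φ k).2.symm).symm.trans (G.r_inv _).symm) = G.inv g := by
      rw [G.mul_congr rfl hk]
      change G.mul (G.inv (G.mul k.1 g _)) k.1 _ = _
      rw [G.mul_congr (G.inv_mul_rev _ _ _) rfl, G.mul_inv_mul]
    rw [α.act_congr h1]
    exact (α.act_section_congr (fun k => 𝒞.fibreStar (G.s k) (a k)) hk _ _).symm
  · exact Fibre.cast_section b (G.inv_inv _).symm _ _

theorem finite_support_fibre {a : ∀ g, Fibre 𝒞.orbit (G.s g)} (ha : a ∈ α.Sections)
    (x : G.units) : {h : {h : H // G.r h = x} | a (G.inv h.1) ≠ 0}.Finite := by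
  refine (finite_fibre_subtype G.isLocalHomeomorph_r (ha.2.image G.continuous_inv) x).subset ?_
  exact fun h hh => ⟨_, subset_closure hh, G.inv_inv _⟩

end CStarAction

namespace HilbertAction

variable {C : Type uC} [NonUnitalCStarAlgebra C] {𝒞 : C0Algebra G.units C} {α : CStarAction G 𝒞}
  {E : Type uE} [NormedAddCommGroup E] [NormedSpace ℂ E] {𝓔 : HilbertModule C E}
  {Ω : Type uΩ} [TopologicalSpace Ω] (β : HilbertAction α 𝓔) (ρ : RightSpaceAction G Ω)

theorem sectionRsmul_mem [T2Space Ω] {ξ : ∀ ω, Fibre (𝓔.orbit 𝒞) (ρ.σ ω)}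
    {c : ∀ h, Fibre 𝒞.orbit (G.s h)} (hξ : ξ ∈ β.Sections ρ) (hc : c ∈ α.Sections) :
    β.sectionRsmul ρ ξ c ∈ β.Sections ρ := by
  -- As for convolution: `(ω, h)` is recovered from `(ω · h, h⁻¹)`.
  let φ : {p : Ω × H // ρ.σ p.1 = G.r p.2} → Ω × H := fun p =>
    (ρ.act p.1.1 p.1.2 p.2, G.inv p.1.2)
  have hφ : Continuous φ :=
    ρ.continuous_act.prodMk (G.continuous_inv.comp (continuous_snd.comp continuous_subtype_val))
  refine finsum_fibre_mem_compactSections (𝓔.orbit 𝒞) ρ.σ G.isLocalHomeomorph_r ρ.σ.continuous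
    (fun ω h e => 𝓔.fibreRsmul 𝒞 (ρ.σ ω)
      (β.act h (ρ.σ_act ω h e.symm).symm e (ξ (ρ.act ω h e.symm)))
      (Fibre.cast ((G.s_inv h).trans e) (c (G.inv h)))) ?_
    (φ '' {p | p.1 ∈ (closure {g | ξ g ≠ 0}) ×ˢ closure {g | c g ≠ 0}})
    (isCompact_image_subtype ρ.isClosed_composable hφ (hξ.2.prod hc.2)) ?_
  · refine continuous_iff_continuousAt.2 fun p₀ => ?_
    have h1 : Continuous fun p : {p : Ω × H // G.r p.2 = ρ.σ p.1} => p.1.2 :=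
      continuous_snd.comp continuous_subtype_val
    have h2 : Continuous fun p : {p : Ω × H // G.r p.2 = ρ.σ p.1} =>
        ρ.act p.1.1 p.1.2 p.2.symm :=
      ρ.continuous_act.comp (Continuous.subtype_mk continuous_subtype_val fun p => p.2.symm)
    have ha1 := continuousAt_section_comp (z₀ := p₀) hξ h2.continuousAt
    have hb1 := continuousAt_section_comp (z₀ := p₀) hc (G.continuous_inv.comp h1).continuousAt
    have h3 := β.continuousAt_section (y₀ := p₀)
      (fun p : {p : Ω × H // G.r p.2 = ρ.σ p.1} => (ρ.σ_act p.1.1 p.1.2 p.2.symm).symm)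
      (fun p => p.2) h1.continuousAt
      ha1
    have h4 := continuousAt_section_cast 𝒞.orbit (y₀ := p₀)
      (fun p : {p : Ω × H // G.r p.2 = ρ.σ p.1} => (G.s_inv p.1.2).trans p.2)
      hb1
    exact continuousAt_section_map₂ 𝓔.rsmul (𝓔.fibreRsmul 𝒞) (𝓔.fibreRsmul_toFibre 𝒞)
      (𝓔.norm_fibreRsmul_le 𝒞) h3 h4
  · intro ω h e hne
    have ha' : ξ (ρ.act ω h e.symm) ≠ 0 := fun h0 => hne (by simp [h0])
    have hb' : c (G.inv h) ≠ 0 := fun h0 => hne (by simp [h0])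
    refine ⟨⟨(ρ.act ω h e.symm, G.inv h), (ρ.σ_act _ _ _).trans (G.r_inv h).symm⟩,
      ⟨subset_closure ha', subset_closure hb'⟩, ?_⟩
    exact Prod.ext (ρ.act_act_inv ω h e.symm) (G.inv_inv h)

/-- Properness makes the set of `(ω, h)` with `ω` in the support of `ξ` and `ω · h` in that of `η`
compact; étaleness makes the sum over a `σ`-fibre a sum along local sections. -/
theorem sectionInner_mem [T2Space Ω] (hproper : ρ.IsProper) (hetale : ρ.IsEtale)
    {ξ η : ∀ ω, Fibre (𝓔.orbit 𝒞) (ρ.σ ω)} (hξ : ξ ∈ β.Sections ρ) (hη : η ∈ β.Sections ρ) :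
    β.sectionInner ρ ξ η ∈ α.Sections := by
  refine finsum_fibre_mem_compactSections 𝒞.orbit G.s hetale G.r.continuous
    (fun h ω e => 𝓔.fibreInner 𝒞 (G.s h)
      (β.act (G.inv h) ((G.s_inv h).trans e.symm) (G.r_inv h) (ξ ω))
      (Fibre.cast (ρ.σ_act ω h e) (η (ρ.act ω h e)))) ?_ _
    ((hproper.isCompact hξ.2 hη.2).image continuous_swap) ?_
  · refine continuous_iff_continuousAt.2 fun p₀ => ?_
    have h1 : Continuous fun p : {p : H × Ω // ρ.σ p.2 = G.r p.1} => p.1.1 :=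
      continuous_fst.comp continuous_subtype_val
    have h2 : Continuous fun p : {p : H × Ω // ρ.σ p.2 = G.r p.1} => p.1.2 :=
      continuous_snd.comp continuous_subtype_val
    have h3 : Continuous fun p : {p : H × Ω // ρ.σ p.2 = G.r p.1} =>
        ρ.act p.1.2 p.1.1 p.2 :=
      ρ.continuous_act.comp (Continuous.subtype_mk
        (continuous_swap.comp continuous_subtype_val) fun p => p.2)
    have ha1 := continuousAt_section_comp (z₀ := p₀) hξ h2.continuousAt
    have hb1 := continuousAt_section_comp (z₀ := p₀) hη h3.continuousAt
    have h4 := β.continuousAt_section (y₀ := p₀)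
      (fun p : {p : H × Ω // ρ.σ p.2 = G.r p.1} => (G.s_inv p.1.1).trans p.2.symm)
      (fun p => G.r_inv p.1.1) (G.continuous_inv.comp h1).continuousAt
      ha1
    have h5 := continuousAt_section_cast (𝓔.orbit 𝒞) (y₀ := p₀)
      (fun p : {p : H × Ω // ρ.σ p.2 = G.r p.1} => ρ.σ_act p.1.2 p.1.1 p.2)
      hb1
    exact continuousAt_section_map₂ 𝓔.inner (𝓔.fibreInner 𝒞) (𝓔.fibreInner_toFibre 𝒞)
      (𝓔.norm_fibreInner_le 𝒞) h4 h5
  · intro h ω e hne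
    have ha' : ξ ω ≠ 0 := fun h0 => hne (by simp [h0])
    have hb' : η (ρ.act ω h e) ≠ 0 := fun h0 => hne (by simp [h0])
    exact ⟨(ω, h), ⟨e, subset_closure ha', subset_closure hb'⟩, rfl⟩

theorem finite_support_fibre (hetale : ρ.IsEtale) {ξ : ∀ ω, Fibre (𝓔.orbit 𝒞) (ρ.σ ω)}
    (hξ : ξ ∈ β.Sections ρ) (x : G.units) : {ω : {ω : Ω // ρ.σ ω = x} | ξ ω.1 ≠ 0}.Finite :=
  (finite_fibre_subtype hetale hξ.2 x).subset fun _ hω => subset_closure hω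

/-- Summation over the fibre at any unit equal to `r h`; needed when `r h` is the range of a product
or an inverse. -/
theorem sectionInner_eq (ξ η : ∀ ω, Fibre (𝓔.orbit 𝒞) (ρ.σ ω)) (h : H) {y : G.units}
    (e : G.r h = y) : β.sectionInner ρ ξ η h = ∑ᶠ ω : {ω : Ω // ρ.σ ω = y},
      𝓔.fibreInner 𝒞 (G.s h)
        (β.act (G.inv h) (((G.s_inv h).trans e).trans ω.2.symm) (G.r_inv h) (ξ ω.1))
        (Fibre.cast (ρ.σ_act ω.1 h (ω.2.trans e.symm)) (η (ρ.act ω.1 h (ω.2.trans e.symm)))) := by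
  subst e; rfl

theorem cast_sectionRsmul (ξ : ∀ ω, Fibre (𝓔.orbit 𝒞) (ρ.σ ω)) (c : ∀ h, Fibre 𝒞.orbit (G.s h))
    (ω : Ω) {x : G.units} (e : ρ.σ ω = x) : Fibre.cast e (β.sectionRsmul ρ ξ c ω) =
      ∑ᶠ h : {h : H // G.r h = x}, 𝓔.fibreRsmul 𝒞 x
        (β.act h.1 (ρ.σ_act ω h.1 (e.trans h.2.symm)).symm h.2
          (ξ (ρ.act ω h.1 (e.trans h.2.symm))))
        (Fibre.cast ((G.s_inv h.1).trans h.2) (c (G.inv h.1))) := by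
  subst e; rfl

/-- `⟨ξ, η⟩^* = ⟨η, ξ⟩`. -/
theorem invol_sectionInner (ξ η : ∀ ω, Fibre (𝓔.orbit 𝒞) (ρ.σ ω)) :
    α.invol (β.sectionInner ρ ξ η) = β.sectionInner ρ η ξ := by
  funext g
  -- The substitution `ω ↦ ω · g`, inverse to acting by `g⁻¹`.
  let φ : {ω : Ω // ρ.σ ω = G.r g} → {ω : Ω // ρ.σ ω = G.s g} := fun ω =>
    ⟨ρ.act ω.1 g ω.2, ρ.σ_act _ _ _⟩
  have hφ : Function.Bijective φ := by
    constructor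
    · intro ω ω' h
      have h' : ρ.act ω.1 g ω.2 = ρ.act ω'.1 g ω'.2 := congrArg Subtype.val h
      apply Subtype.ext
      rw [← ρ.act_act_inv ω.1 g ω.2, ρ.act_congr h' rfl, ρ.act_act_inv]
    · intro ω
      exact ⟨⟨ρ.act ω.1 (G.inv g) (ω.2.trans (G.r_inv g).symm), (ρ.σ_act _ _ _).trans (G.s_inv g)⟩,
        Subtype.ext (ρ.act_inv_act _ _ _)⟩
  let T : Fibre 𝒞.orbit (G.s (G.inv g)) →+ Fibre 𝒞.orbit (G.s g) :=
    { toFun := fun x => α.act (G.inv g) rfl (G.r_inv g) (𝒞.fibreStar _ x)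
      map_zero' := by simp
      map_add' := fun x y => by rw [map_add, map_add] }
  -- An injective additive map passes through the sum without any finiteness of the support.
  have hT : Function.Injective T := (injective_iff_map_eq_zero T).2 fun x hx => by
    rwa [AddMonoidHom.coe_mk, ZeroHom.coe_mk, α.act_eq_zero, ← norm_eq_zero, 𝒞.norm_fibreStar,
      norm_eq_zero] at hx
  change T (β.sectionInner ρ ξ η (G.inv g)) = _
  rw [β.sectionInner_eq ρ ξ η (G.inv g) (G.r_inv g), T.map_finsum_of_injective hT]
  refine (finsum_eq_of_bijective φ hφ fun ω => ?_).symm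
  change _ = α.act (G.inv g) rfl (G.r_inv g) (𝒞.fibreStar _ _)
  rw [𝓔.fibreStar_fibreInner, β.act_fibreInner, β.act_cast]
  congr 1
  · congr 1
    exact β.act_section_congr η (ρ.act_act_inv ω.1 g ω.2).symm _ _
  · have h := β.act_inv_inv rfl (G.r_inv g) ((G.s_inv _).trans (G.r_inv g))
      (G.r_inv _) (Fibre.cast (φ ω).2 (ξ (φ ω).1))
    rw [β.act_cast] at h
    exact h.symm

theorem sectionInner_add_right (hetale : ρ.IsEtale) {ξ : ∀ ω, Fibre (𝓔.orbit 𝒞) (ρ.σ ω)}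
    (hξ : ξ ∈ β.Sections ρ) (η ζ : ∀ ω, Fibre (𝓔.orbit 𝒞) (ρ.σ ω)) :
    β.sectionInner ρ ξ (η + ζ) = β.sectionInner ρ ξ η + β.sectionInner ρ ξ ζ := by
  funext g
  rw [Pi.add_apply]
  unfold sectionInner
  rw [← finsum_add_distrib]
  · refine finsum_congr fun ω => ?_
    rw [← map_add]
    exact congrArg _ ((Fibre.castHom (ρ.σ_act ω.1 g ω.2)).map_add _ _)
  all_goals
    refine (β.finite_support_fibre ρ hetale hξ (G.r g)).subset fun ω hω h0 => hω ?_
    simp [h0]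

theorem sectionInner_smul_right (ξ : ∀ ω, Fibre (𝓔.orbit 𝒞) (ρ.σ ω)) (z : ℂ)
    (η : ∀ ω, Fibre (𝓔.orbit 𝒞) (ρ.σ ω)) :
    β.sectionInner ρ ξ (z • η) = z • β.sectionInner ρ ξ η := by
  funext g
  rw [Pi.smul_apply]
  unfold sectionInner
  rw [smul_finsum]
  refine finsum_congr fun ω => ?_
  rw [← map_smul, ← Fibre.cast_smul]
  rfl

/-- `⟨ξ, η · c⟩ = ⟨ξ, η⟩ * c`. -/
theorem sectionInner_sectionRsmul (hetale : ρ.IsEtale) {ξ : ∀ ω, Fibre (𝓔.orbit 𝒞) (ρ.σ ω)}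
    {c : ∀ h, Fibre 𝒞.orbit (G.s h)} (hξ : ξ ∈ β.Sections ρ) (hc : c ∈ α.Sections)
    (η : ∀ ω, Fibre (𝓔.orbit 𝒞) (ρ.σ ω)) :
    β.sectionInner ρ ξ (β.sectionRsmul ρ η c) = α.conv (β.sectionInner ρ ξ η) c := by
  funext g
  have hfs := α.finite_support_fibre hc (G.s g)
  have hft := β.finite_support_fibre ρ hetale hξ (G.r g)
  -- Both sides expand to the double sum of `T`: the left by inserting `η · c`, the right by
  -- inserting `⟨ξ, η⟩(gh)`. The support of `ξ` bounds `ω` and that of `c` bounds `h`.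
  let T : {ω : Ω // ρ.σ ω = G.r g} → {h : H // G.r h = G.s g} → Fibre 𝒞.orbit (G.s g) :=
    fun ω h => 𝒞.fibreMul (G.s g)
      (𝓔.fibreInner 𝒞 (G.s g)
        (β.act (G.inv g) ((G.s_inv g).trans ω.2.symm) (G.r_inv g) (ξ ω.1))
        (β.act h.1 (ρ.σ_act _ h.1 ((ρ.σ_act ω.1 g ω.2).trans h.2.symm)).symm h.2
          (η (ρ.act (ρ.act ω.1 g ω.2) h.1 ((ρ.σ_act ω.1 g ω.2).trans h.2.symm)))))
      (Fibre.cast ((G.s_inv h.1).trans h.2) (c (G.inv h.1)))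
  have hT1 : ∀ ω h, T ω h ≠ 0 → ω ∈ {ω : {ω : Ω // ρ.σ ω = G.r g} | ξ ω.1 ≠ 0} :=
    fun ω h hne h0 => hne (by simp [T, h0])
  have hT2 : ∀ ω h, T ω h ≠ 0 → h ∈ {h : {h : H // G.r h = G.s g} | c (G.inv h.1) ≠ 0} :=
    fun ω h hne h0 => hne (by simp [T, h0])
  refine Eq.trans (finsum_congr fun ω => ?_)
    ((finsum_comm_of_finite T hft hfs hT1 hT2).trans (finsum_congr fun h => ?_))
  · rw [β.cast_sectionRsmul ρ η c _ (ρ.σ_act ω.1 g ω.2)]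
    refine (AddMonoidHom.map_finsum (𝓔.fibreInner 𝒞 (G.s g) _).toAddMonoidHom ?_).trans
      (finsum_congr fun h => ?_)
    · exact hfs.subset fun h hh h0 => hh (by simp [h0])
    · exact 𝓔.fibreInner_fibreRsmul 𝒞 _ _ _ _
  · rw [β.sectionInner_eq ρ ξ η (G.mul g h.1 h.2.symm) (G.r_mul _ _ _)]
    have h1 := AddMonoidHom.map_finsum (((𝒞.fibreMul (G.s g)).flip
      (Fibre.cast ((G.s_inv h.1).trans h.2) (c (G.inv h.1)))).toAddMonoidHom.comp
      (α.act h.1 (G.s_mul g h.1 h.2.symm).symm h.2 :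
        Fibre 𝒞.orbit (G.s (G.mul g h.1 h.2.symm)) →+ Fibre 𝒞.orbit (G.s g)))
      (f := fun ω : {ω : Ω // ρ.σ ω = G.r g} => 𝓔.fibreInner 𝒞 _
        (β.act (G.inv (G.mul g h.1 h.2.symm)) (((G.s_inv _).trans (G.r_mul _ _ _)).trans ω.2.symm)
          (G.r_inv _) (ξ ω.1))
        (Fibre.cast (ρ.σ_act ω.1 (G.mul g h.1 h.2.symm) (ω.2.trans (G.r_mul _ _ _).symm))
          (η (ρ.act ω.1 (G.mul g h.1 h.2.symm) (ω.2.trans (G.r_mul _ _ _).symm)))))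
      (hft.subset fun ω hω h0 => hω (by simp [h0]))
    refine Eq.trans (finsum_congr fun ω => ?_) h1.symm
    change _ = 𝒞.fibreMul (G.s g) (α.act h.1 _ _ (𝓔.fibreInner 𝒞 _ _ _)) _
    rw [β.act_fibreInner, β.act_cast,
      β.act_act (k := G.inv g) (hk := by
        rw [G.mul_congr rfl (G.inv_mul_rev g h.1 h.2.symm), G.mul_inv_mul_cancel])]
    have h2 := β.act_section_congr η (ρ.act_mul ω.1 g h.1 ω.2 h.2.symm).symm
      (ρ.σ_act _ h.1 ((ρ.σ_act ω.1 g ω.2).trans h.2.symm)).symm h.2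
    exact congrArg (fun x => 𝒞.fibreMul (G.s g) (𝓔.fibreInner 𝒞 (G.s g) _ x) _) h2

end HilbertAction

end

end GroupoidCrossedProduct

namespace GroupoidCrossedProduct

/-! ### Uniform bounds for representations on sections of fixed compact support -/

theorem smul_mem_compactSections {X : Type*} [TopologicalSpace X] [T2Space X]
    [LocallyCompactSpace X] {A ι : Type*} [NormedAddCommGroup A] [NormedSpace ℂ A]
    (m : ι → C₀(X, ℂ) →L[ℂ] A) {Y : Type*} [TopologicalSpace Y] [T2Space Y] {f : C(Y, X)}
    {φ : Y → ℂ} (hφ : Continuous φ) {ξ : ∀ y, Fibre m (f y)} (hξ : ξ ∈ compactSections m f) :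
    (fun y => φ y • ξ y) ∈ compactSections m f := by
  refine mem_compactSections_of_support_subset m (continuous_iff_continuousAt.2 fun y =>
    continuousAt_section_smul m hφ.continuousAt (continuousAt_section_comp hξ continuousAt_id))
    hξ.2 fun y hy => subset_closure fun h0 => hy ?_
  rw [h0, smul_zero]

theorem EtaleGroupoid.exists_bisection_cover {H : Type uH} [TopologicalSpace H]
    (G : EtaleGroupoid H) {K : Set H} (hK : IsCompact K) :
    ∃ (n : ℕ) (U : Fin n → Set H), (∀ i, IsOpen (U i)) ∧ (∀ i, Set.InjOn G.r (U i)) ∧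
      (∀ i, Set.InjOn G.s (U i)) ∧ K ⊆ ⋃ i, U i := by
  obtain ⟨n, U, hU, hUi, hKU⟩ := exists_injOn_cover G.isLocalHomeomorph_r hK
  obtain ⟨m, V, hV, hVi, hKV⟩ := exists_injOn_cover G.isLocalHomeomorph_s hK
  refine ⟨n * m, fun i => U (finProdFinEquiv.symm i).1 ∩ V (finProdFinEquiv.symm i).2,
    fun i => (hU _).inter (hV _), fun i => (hUi _).mono Set.inter_subset_left,
    fun i => (hVi _).mono Set.inter_subset_right, fun g hg => ?_⟩
  obtain ⟨i, hi⟩ := Set.mem_iUnion.1 (hKU hg)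
  obtain ⟨j, hj⟩ := Set.mem_iUnion.1 (hKV hg)
  exact Set.mem_iUnion.2 ⟨finProdFinEquiv (i, j), by simpa using ⟨hi, hj⟩⟩

namespace C0Algebra

variable {X : Type*} [TopologicalSpace X] [T2Space X] [LocallyCompactSpace X] {C : Type*}
  [NonUnitalCStarAlgebra C] (𝒞 : C0Algebra X C)

/-- The C⋆-algebra of continuous sections of the bundle of `C` that vanish off a given set. -/
noncomputable def sectionsVanishingOff (K : Set X) :
    NonUnitalStarSubalgebra ℂ (lp (fun x => 𝒞.FibreAlgebra x) ∞) where
  carrier := {c | (∀ x₀, ContinuousAt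
    (fun x => (⟨x, (𝒞.toFibreAlgebra x).symm (c x)⟩ : TotalSpace 𝒞.orbit)) x₀) ∧
      ∀ x ∉ K, c x = 0}
  add_mem' := fun {c d} hc hd => ⟨fun x₀ => continuousAt_section_add 𝒞.orbit (hc.1 x₀) (hd.1 x₀),
    fun x hx => by rw [lp.coeFn_add, Pi.add_apply, hc.2 x hx, hd.2 x hx, add_zero]⟩
  zero_mem' := ⟨fun x₀ => continuousAt_section_zero 𝒞.orbit continuousAt_id, fun _ _ => rfl⟩
  mul_mem' := fun {c d} hc hd => ⟨fun x₀ => continuousAt_section_map₂ (fun x y => x * y)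
      𝒞.fibreMul 𝒞.fibreMul_toFibre 𝒞.norm_fibreMul_le (hc.1 x₀) (hd.1 x₀),
    fun x hx => by rw [lp.infty_coeFn_mul, Pi.mul_apply, hc.2 x hx, zero_mul]⟩
  smul_mem' := fun z c hc => ⟨fun x₀ => continuousAt_section_smul 𝒞.orbit continuousAt_const
      (hc.1 x₀),
    fun x hx => by rw [lp.coeFn_smul, Pi.smul_apply, hc.2 x hx, smul_zero]⟩
  star_mem' := fun {c} hc => ⟨fun x₀ => continuousAt_section_map star 𝒞.fibreStar
      𝒞.fibreStar_toFibre 𝒞.norm_fibreStar_le (hc.1 x₀),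
    fun x hx => by rw [lp.star_apply, hc.2 x hx, star_zero]⟩

/-- Convergence in the supremum norm is uniform convergence of sections, which preserves both
continuity and vanishing. -/
theorem isClosed_sectionsVanishingOff (K : Set X) :
    IsClosed (𝒞.sectionsVanishingOff K : Set (lp (fun x => 𝒞.FibreAlgebra x) ∞)) := by
  refine isClosed_of_closure_subset fun c hc => ⟨fun x₀ => ?_, fun x hx => ?_⟩
  · refine continuousAt_section_of_approx 𝒞.orbit fun ε hε => ?_
    obtain ⟨d, hd, hcd⟩ := Metric.mem_closure_iff.1 hc ε hε
    refine ⟨_, hd.1 x₀, fun x => ?_⟩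
    rw [dist_eq_norm] at hcd
    exact (lp.norm_apply_le_norm ENNReal.top_ne_zero (c - d) x).trans hcd.le
  · rw [← norm_eq_zero]
    refine le_antisymm (le_of_forall_pos_le_add fun ε hε => ?_) (norm_nonneg _)
    obtain ⟨d, hd, hcd⟩ := Metric.mem_closure_iff.1 hc ε hε
    rw [dist_eq_norm] at hcd
    have h := (lp.norm_apply_le_norm ENNReal.top_ne_zero (c - d) x).trans hcd.le
    rw [lp.coeFn_sub, Pi.sub_apply, hd.2 x hx, sub_zero] at h
    simpa using h

noncomputable instance (K : Set X) : NonUnitalCStarAlgebra (𝒞.sectionsVanishingOff K) :=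
  NonUnitalStarSubalgebra.nonUnitalCStarAlgebra _ (h_closed := 𝒞.isClosed_sectionsVanishingOff K)

end C0Algebra

namespace CStarAction

variable {H : Type uH} [TopologicalSpace H] [T2Space H] {G : EtaleGroupoid H}
  {C : Type uC} [NonUnitalCStarAlgebra C] {𝒞 : C0Algebra G.units C} (α : CStarAction G 𝒞)

open scoped Classical in
/-- Extension by zero of a section over the unit space. -/
noncomputable def extendUnits (c : ∀ x, Fibre 𝒞.orbit x) (g : H) : Fibre 𝒞.orbit (G.s g) :=
  if g ∈ G.units then c (G.s g) else 0

/-- The units are both open and closed in `H`, so extension by zero stays continuous. -/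
theorem extendUnits_mem {c : ∀ x, Fibre 𝒞.orbit x}
    (hc : ∀ x₀, ContinuousAt (fun x => (⟨x, c x⟩ : TotalSpace 𝒞.orbit)) x₀) {K : Set G.units}
    (hK : IsCompact K) (hcK : ∀ x ∉ K, c x = 0) : extendUnits c ∈ α.Sections := by
  refine mem_compactSections_of_support_subset _ (continuous_iff_continuousAt.2 fun g => ?_)
    (hK.image continuous_subtype_val) fun g hg => ?_
  · by_cases hg : g ∈ G.units
    · have h1 : ContinuousAt (fun g => (⟨G.s g, c (G.s g)⟩ : TotalSpace 𝒞.orbit)) g :=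
        ContinuousAt.comp (f := G.s) (g := fun x => (⟨x, c x⟩ : TotalSpace 𝒞.orbit)) (hc _)
          G.s.continuous.continuousAt
      refine h1.congr ?_
      filter_upwards [G.isOpen_units.mem_nhds hg] with h hh
      simp [extendUnits, hh]
    · have h1 := continuousAt_section_zero 𝒞.orbit (G.s.continuous.continuousAt (x := g))
      refine h1.congr ?_
      filter_upwards [G.isClosed_units.isOpen_compl.mem_nhds hg] with h hh
      have : h ∉ G.units := hh
      simp [extendUnits, this]
  · by_cases hu : g ∈ G.units
    · refine ⟨G.s g, by_contra fun h => hg ?_, G.coe_s_of_mem hu⟩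
      simp [extendUnits, hu, hcK _ h]
    · exact absurd (by simp [extendUnits, hu]) hg

/-- A nonzero term needs `h⁻¹` to be a unit, and then `h` can only be `s g`. Hence pointwise
operations over the units agree with those of the convolution algebra. -/
theorem conv_extendUnits (c d : ∀ x, Fibre 𝒞.orbit x) :
    α.conv (extendUnits c) (extendUnits d) =
      extendUnits fun x => 𝒞.fibreMul x (c x) (d x) := by
  funext g
  refine (finsum_eq_single _ ⟨(G.s g : H), G.r_unit _⟩ fun h hne => ?_).trans ?_
  · have hu : G.inv h.1 ∉ G.units := fun hu => hne <| Subtype.ext <| by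
      rw [← G.coe_r_of_mem (G.inv_mem_units_iff.1 hu), h.2]
    simp [extendUnits, hu]
  · have h1 : G.mul g (G.s g) (G.r_unit _).symm = g := G.mul_unit g
    have h2 := α.act_section_congr (extendUnits c) h1
      (G.s_mul g (G.s g) (G.r_unit _).symm).symm (G.r_unit (G.s g))
    rw [h2, α.act_unit' (G.s g).2, Fibre.cast_section (extendUnits d) (G.inv_unit (G.s g)) _
      (G.s_unit _)]
    by_cases hg : g ∈ G.units
    · have h3 : Fibre.cast (G.s_unit (G.s g)) (extendUnits d (G.s g : H)) = d (G.s g) := by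
        rw [Fibre.cast_section (extendUnits d) (G.coe_s_of_mem hg) _ rfl]
        simp [extendUnits, hg]
      rw [h3]
      simp [extendUnits, hg]
    · simp [extendUnits, hg]

theorem invol_extendUnits (c : ∀ x, Fibre 𝒞.orbit x) :
    α.invol (extendUnits c) = extendUnits fun x => 𝒞.fibreStar x (c x) := by
  funext g
  unfold invol
  by_cases hg : g ∈ G.units
  · rw [α.act_section_congr (fun g => 𝒞.fibreStar _ (extendUnits c g)) (G.inv_of_mem hg),
      α.act_congr (G.inv_of_mem hg), α.act_unit' hg]
    simp [extendUnits, hg]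
  · have : G.inv g ∉ G.units := fun h => hg (G.inv_mem_units_iff.1 h)
    simp [extendUnits, hg, this]

/-- The restriction of a representation to the sections over a compact subset of the unit space. -/
noncomputable def Representation.unitsHom (R : α.Representation) {K : Set G.units}
    (hK : IsCompact K) : 𝒞.sectionsVanishingOff K →⋆ₙₐ[ℂ] (R.K →L[ℂ] R.K) where
  toFun c := R.π ⟨_, α.extendUnits_mem c.2.1 hK c.2.2⟩
  map_smul' z c := by
    rw [← map_smul]
    congr 1
    ext g
    by_cases hg : g ∈ G.units <;> simp [extendUnits, hg]
  map_zero' := by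
    rw [← map_zero R.π]
    congr 1
    ext g
    by_cases hg : g ∈ G.units <;> simp [extendUnits, hg]
  map_add' c d := by
    rw [← map_add]
    congr 1
    ext g
    by_cases hg : g ∈ G.units <;> simp [extendUnits, hg]
  map_mul' c d := R.map_conv _ _ _ fun g => (congrFun (α.conv_extendUnits _ _) g).symm
  map_star' c := R.map_invol _ _ fun g => (congrFun (α.invol_extendUnits _) g).symm

/-- A section supported in the unit space has norm at most its supremum norm in every
representation. -/
theorem Representation.norm_le_of_units (R : α.Representation) (b : α.Sections)
    (hb : ∀ g ∉ G.units, b.1 g = 0) {M : ℝ} (hM : 0 ≤ M) (hbM : ∀ g, ‖b.1 g‖ ≤ M) :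
    ‖R.π b‖ ≤ M := by
  let K : Set G.units := G.s '' (closure {g | b.1 g ≠ 0})
  have hK : IsCompact K := b.2.2.image G.s.continuous
  let c : ∀ x, Fibre 𝒞.orbit x := fun x => Fibre.cast (G.s_unit x) (b.1 x)
  have hcb : extendUnits c = b.1 := by
    funext g
    by_cases hg : g ∈ G.units
    · simp only [extendUnits, hg, if_true, c]
      rw [Fibre.cast_section b.1 (G.coe_s_of_mem hg) _ rfl, Fibre.cast_rfl]
    · simp [extendUnits, hg, hb g hg]
  have hcM : ∀ x, ‖c x‖ ≤ M := fun x => (Fibre.norm_cast _ _).trans_le (hbM _)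
  let c' : lp (fun x => 𝒞.FibreAlgebra x) ∞ := ⟨fun x => 𝒞.toFibreAlgebra x (c x),
    memℓp_infty ⟨M, by rintro _ ⟨x, rfl⟩; exact hcM x⟩⟩
  have hc' : c' ∈ 𝒞.sectionsVanishingOff K := by
    refine ⟨fun x₀ => ?_, fun x hx => ?_⟩
    · exact continuousAt_section_cast 𝒞.orbit G.s_unit
        (continuousAt_section_comp b.2 continuous_subtype_val.continuousAt)
    · have : b.1 x = 0 := by
        by_contra h
        exact hx ⟨x, subset_closure h, G.s_unit x⟩
      change Fibre.cast _ _ = 0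
      rw [this, Fibre.cast_zero]
  have h1 : R.π b = R.unitsHom α hK ⟨c', hc'⟩ := congrArg R.π (Subtype.ext hcb.symm)
  rw [h1]
  -- A `*`-homomorphism between C⋆-algebras is contractive, and the norm on the source is the
  -- supremum norm.
  exact (NonUnitalStarAlgHom.norm_apply_le _ _).trans (lp.norm_le_of_forall_le hM hcM)

/-- The terms of `(a^* * a)(g)` involve `a(k)` and `a(kg)`, which have the same range. Injectivity
of `r` gives `kg = k`, so `a^* * a` lives on units, and injectivity of `s` leaves at most one term.
The bound over units and `‖π(a)‖² = ‖π(a^* * a)‖` conclude. -/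
theorem Representation.norm_le_of_bisection (R : α.Representation) (a : α.Sections)
    {U : Set H} (hr : Set.InjOn G.r U) (hs : Set.InjOn G.s U) (ha : ∀ g ∉ U, a.1 g = 0) {M : ℝ}
    (hM : 0 ≤ M) (haM : ∀ g, ‖a.1 g‖ ≤ M) : ‖R.π a‖ ≤ M := by
  let b : α.Sections := ⟨_, α.conv_mem (α.invol_mem a.2) a.2⟩
  have hab : R.π b = star (R.π a) * R.π a := by
    rw [R.map_conv ⟨_, α.invol_mem a.2⟩ a b fun _ => rfl, R.map_invol a _ fun _ => rfl]
  have hb : ∀ g, b.1 g ≠ 0 → g ∈ G.units := by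
    intro g hg
    have hg' := hg
    simp only [b, α.conv_invol_apply] at hg'
    obtain ⟨k, hk⟩ := not_forall.1 (mt finsum_eq_zero_of_forall_eq_zero hg')
    have h1 : k.1 ∈ U := by_contra fun h => hk (by simp [ha _ h])
    have h2 : G.mul k.1 g k.2 ∈ U := by_contra fun h => hk (by simp [ha _ h])
    exact G.mem_units_of_mul_eq_left (hr h2 h1 (G.r_mul _ _ _))
  have hbM : ∀ g, ‖b.1 g‖ ≤ M ^ 2 := by
    intro g
    simp only [b, α.conv_invol_apply]
    have hle : ∀ k : {k : H // G.s k = G.r g}, ‖𝒞.fibreMul (G.s g)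
        (α.act (G.inv g) ((G.s_inv g).trans k.2.symm) (G.r_inv g) (𝒞.fibreStar (G.s k.1) (a.1 k.1)))
        (Fibre.cast (G.s_mul k.1 g k.2) (a.1 (G.mul k.1 g k.2)))‖ ≤ M ^ 2 := by
      intro k
      refine (𝒞.norm_fibreMul_le _ _ _).trans ?_
      rw [α.norm_act, 𝒞.norm_fibreStar, Fibre.norm_cast, sq]
      gcongr <;> exact haM _
    by_cases h : ∃ k : {k : H // G.s k = G.r g}, k.1 ∈ U
    · obtain ⟨k₀, hk₀⟩ := h
      rw [finsum_eq_single _ k₀ fun k hk => ?_]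
      · exact hle k₀
      · have : k.1 ∉ U := fun h => hk (Subtype.ext (hs h hk₀ (k.2.trans k₀.2.symm)))
        simp [ha _ this]
    · push Not at h
      rw [finsum_eq_zero_of_forall_eq_zero fun k => by simp [ha _ (h k)], norm_zero]
      positivity
  have h := R.norm_le_of_units α b (fun g hg => by_contra fun h => hg (hb g h)) (sq_nonneg M) hbM
  rw [hab, CStarRing.norm_star_mul_self, ← sq] at h
  exact abs_le_of_sq_le_sq' h hM |>.2

/-- On the sections supported in a fixed compact set, all representations are bounded by a common
multiple of the supremum norm. -/
theorem exists_norm_π_le {K : Set H} (hK : IsCompact K) :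
    ∃ N : ℝ, 0 ≤ N ∧ ∀ (R : α.Representation) (a : α.Sections) (M : ℝ), 0 ≤ M →
      (∀ g ∉ K, a.1 g = 0) → (∀ g, ‖a.1 g‖ ≤ M) → ‖R.π a‖ ≤ N * M := by
  obtain ⟨n, U, hU, hr, hs, hKU⟩ := G.exists_bisection_cover hK
  have : LocallyCompactSpace H := locallyCompactSpace_of_isLocalHomeomorph G.isLocalHomeomorph_r
  obtain ⟨f, hfU, hf1, hf01, -⟩ := exists_continuous_sum_one_of_isOpen_isCompact hU hK hKU
  refine ⟨n, n.cast_nonneg, fun R a M hM haK haM => ?_⟩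
  -- The constant is the number of bisections: each piece `f_i a` of the partition is supported in
  -- one of them.
  let b : Fin n → α.Sections := fun i => ⟨fun g => (f i g : ℂ) • a.1 g,
    smul_mem_compactSections 𝒞.orbit (by fun_prop) a.2⟩
  have hab : a = ∑ i, b i := by
    ext g
    rw [Submodule.coe_sum, Finset.sum_apply]
    change a.1 g = ∑ i, (f i g : ℂ) • a.1 g
    rw [← Finset.sum_smul]
    by_cases hg : g ∈ K
    · have h := hf1 hg
      simp only [Finset.sum_apply, Pi.one_apply] at h
      rw [← Complex.ofReal_sum, h, Complex.ofReal_one, one_smul]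
    · rw [haK g hg, smul_zero]
  have hbM : ∀ i, ‖R.π (b i)‖ ≤ M := by
    refine fun i => R.norm_le_of_bisection α (b i) (hr i) (hs i) (fun g hg => ?_) hM fun g => ?_
    · have : f i g = 0 := by
        by_contra h
        exact hg (hfU i (subset_tsupport _ h))
      simp [b, this]
    · have h := hf01 i g
      change ‖(f i g : ℂ) • a.1 g‖ ≤ M
      rw [norm_smul, Complex.norm_real, Real.norm_eq_abs, abs_of_nonneg h.1]
      calc f i g * ‖a.1 g‖ ≤ 1 * ‖a.1 g‖ := by gcongr; exact h.2
        _ ≤ M := (one_mul _).trans_le (haM g)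
  calc ‖R.π a‖ = ‖∑ i, R.π (b i)‖ := by rw [← map_sum, ← hab]
    _ ≤ ∑ i : Fin n, M := norm_sum_le_of_le _ fun i _ => hbM i
    _ = n * M := by simp

/-! ## The canonical map to the crossed product -/

theorem exists_norm_π_le_of_section (a : α.Sections) : ∃ M : ℝ, ∀ R : α.Representation,
    ‖R.π a‖ ≤ M := by
  obtain ⟨N, -, h⟩ := α.exists_norm_π_le a.2.2
  obtain ⟨M, hM, haM⟩ := exists_norm_le_of_mem_compactSections 𝒞.orbit a.2
  exact ⟨N * M, fun R => h R a M hM (fun g hg => by_contra fun h => hg (subset_closure h)) haM⟩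

/-- The direct sum of all representations. -/
noncomputable def universal : α.Sections →ₗ[ℂ] α.UniversalOperators where
  toFun a := ⟨fun R => R.π a, memℓp_infty (by
    obtain ⟨M, hM⟩ := α.exists_norm_π_le_of_section a
    exact ⟨M, by rintro _ ⟨R, rfl⟩; exact hM R⟩)⟩
  map_add' a b := by ext1; funext R; exact map_add R.π a b
  map_smul' z a := by ext1; funext R; exact map_smul R.π z a

theorem universal_mem (a : α.Sections) : α.universal a ∈ α.crossedProduct :=
  NonUnitalStarSubalgebra.le_topologicalClosure _ (NonUnitalStarAlgebra.subset_adjoin ℂ _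
    ⟨a, fun _ => rfl⟩)

/-- The canonical map `Γ_c(G, s^*𝒞) → G ⋉ C`. -/
noncomputable def canonicalMap : α.Sections →ₗ[ℂ] α.CrossedProduct :=
  α.universal.codRestrict α.crossedProduct.toSubmodule α.universal_mem

theorem isCanonicalMap_canonicalMap : α.IsCanonicalMap α.canonicalMap := fun _ _ => rfl

theorem canonicalMap_conv (a b : α.Sections) :
    α.canonicalMap ⟨_, α.conv_mem a.2 b.2⟩ = α.canonicalMap a * α.canonicalMap b := by
  apply Subtype.ext
  ext1
  funext R
  exact R.map_conv a b _ fun _ => rfl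

theorem canonicalMap_invol (a : α.Sections) :
    α.canonicalMap ⟨_, α.invol_mem a.2⟩ = star (α.canonicalMap a) := by
  apply Subtype.ext
  ext1
  funext R
  exact R.map_invol a _ fun _ => rfl

/-- The image of the sections is already a `*`-subalgebra, so passing to the generated subalgebra
adds nothing before the closure is taken. -/
theorem denseRange_canonicalMap : DenseRange α.canonicalMap := by
  let S : NonUnitalStarSubalgebra ℂ α.UniversalOperators :=
    { carrier := Set.range α.universal
      add_mem' := by rintro _ _ ⟨a, rfl⟩ ⟨b, rfl⟩; exact ⟨a + b, map_add _ _ _⟩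
      zero_mem' := ⟨0, map_zero _⟩
      mul_mem' := by
        rintro _ _ ⟨a, rfl⟩ ⟨b, rfl⟩
        exact ⟨_, congrArg Subtype.val (α.canonicalMap_conv a b)⟩
      smul_mem' := by rintro z _ ⟨a, rfl⟩; exact ⟨z • a, α.universal.map_smul z a⟩
      star_mem' := by
        rintro _ ⟨a, rfl⟩
        exact ⟨_, congrArg Subtype.val (α.canonicalMap_invol a)⟩ }
  have hS : NonUnitalStarAlgebra.adjoin ℂ
      {T : α.UniversalOperators | ∃ a : α.Sections, ∀ R, T R = R.π a} ≤ S := by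
    refine NonUnitalStarAlgebra.adjoin_le ?_
    rintro T ⟨a, ha⟩
    refine ⟨a, ?_⟩
    ext1
    funext R
    exact (ha R).symm
  intro T
  refine Metric.mem_closure_iff.2 fun ε hε => ?_
  obtain ⟨b, hb, hTb⟩ := Metric.mem_closure_iff.1 T.2 ε hε
  obtain ⟨a, rfl⟩ := hS hb
  exact ⟨α.canonicalMap a, ⟨a, rfl⟩, hTb⟩

end CStarAction

end GroupoidCrossedProduct

namespace GroupoidCrossedProduct

/-! ## Factorization of Gram matrices -/

theorem eq_zero_of_star_mul_self_add_sum {A κ : Type*} [NonUnitalCStarAlgebra A] {s : Finset κ}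
    (b : A) (c : κ → A) (h : star b * b + ∑ i ∈ s, star (c i) * c i = 0) {i : κ} (hi : i ∈ s) :
    c i = 0 := by
  let : PartialOrder A := CStarAlgebra.spectralOrder A
  have : StarOrderedRing A := CStarAlgebra.spectralOrderedRing A
  have h1 : ∀ i ∈ s, 0 ≤ star (c i) * c i := fun i _ => star_mul_self_nonneg _
  have h2 := (add_eq_zero_iff_of_nonneg (star_mul_self_nonneg b) (Finset.sum_nonneg h1)).1 h
  exact CStarRing.star_mul_self_eq_zero_iff _ |>.1 ((Finset.sum_eq_zero_iff_of_nonneg h1).1 h2.2 i hi)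

/-- The negative part `N` of a self-adjoint element, and a square root `R` of it. -/
theorem exists_negPart {S : Type*} [NonUnitalCStarAlgebra S] {M : S} (hM : IsSelfAdjoint M) :
    ∃ N R : S, star N = N ∧ N * M * N = -(star (R * N) * (R * N)) ∧
      (R * N = 0 → ∃ B, M = star B * B) := by
  let : PartialOrder S := CStarAlgebra.spectralOrder S
  have : StarOrderedRing S := CStarAlgebra.spectralOrderedRing S
  obtain ⟨R, hR⟩ := CStarAlgebra.nonneg_iff_eq_star_mul_self.1 (CFC.negPart_nonneg M)
  have hsa : star M⁻ = M⁻ := (CFC.negPart_nonneg M).isSelfAdjoint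
  -- With `M = M⁺ - M⁻`, `M⁺ M⁻ = 0` and `M⁻ = R^* R` one has `M⁻ M M⁻ = -(M⁻)³ = -(R M⁻)^* (R M⁻)`.
  -- If `R M⁻ = 0` then `(M⁻)² = 0`, hence `M⁻ = 0`.
  refine ⟨M⁻, R, hsa, ?_, fun h0 => ?_⟩
  · have h2 : M * M⁻ = -(M⁻ * M⁻) := by
      conv_lhs => enter [1]; rw [← CFC.posPart_sub_negPart M hM]
      rw [sub_mul, CFC.posPart_mul_negPart, zero_sub]
    have h3 : star (R * M⁻) * (R * M⁻) = M⁻ * (star R * R) * M⁻ := by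
      rw [star_mul, hsa]
      simp only [mul_assoc]
    rw [mul_assoc, h2, h3, ← hR, mul_neg, mul_assoc]
  · have h2 : M⁻ * M⁻ = 0 := by
      conv_lhs => enter [1]; rw [hR]
      rw [mul_assoc, h0, mul_zero]
    have hneg : M⁻ = 0 := by
      refine (CStarRing.star_mul_self_eq_zero_iff _).1 ?_
      rw [hsa, h2]
    refine CStarAlgebra.nonneg_iff_eq_star_mul_self.1 ?_
    rw [← CFC.posPart_sub_negPart M hM, hneg, sub_zero]
    exact CFC.posPart_nonneg M

/-- A Hermitian matrix over a C⋆-algebra whose quadratic form is positive (which is tested in a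
separating family of `*`-homomorphisms) is of the form `B^* B`. -/
theorem exists_gram_factorization {A ι n : Type*} [NonUnitalCStarAlgebra A] [Fintype n]
    {D : ι → Type*} [∀ i, NonUnitalCStarAlgebra (D i)] (π : ∀ i, A →⋆ₙₐ[ℂ] D i)
    (hπ : ∀ a, (∀ i, π i a = 0) → a = 0) (T : n → n → A) (hT : ∀ k l, star (T k l) = T l k)
    (hpos : ∀ (y : n → A) (i : ι), ∃ b, π i (∑ k, ∑ l, star (y k) * T k l * y l) = star b * b) :
    ∃ B : n → n → A, ∀ k l, T k l = ∑ p, star (B p k) * B p l := by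
  let : PartialOrder A := CStarAlgebra.spectralOrder A
  have : StarOrderedRing A := CStarAlgebra.spectralOrderedRing A
  let M : CStarMatrix n n A := CStarMatrix.ofMatrix (Matrix.of T)
  have hM : IsSelfAdjoint M := by
    ext k l
    exact hT l k
  obtain ⟨N, R, hsa, h1, hB⟩ := exists_negPart hM
  have h0 : R * N = 0 := by
    ext p k
    refine hπ _ fun i => ?_
    -- The test vector is the `k`-th column of the negative part `N`. The form there is `(N M
    -- N)_{kk} = -∑_q |(R N)_{qk}|²`, positive under `π i` by hypothesis, so every summand is killed
    -- by `π i`.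
    obtain ⟨b, hb⟩ := hpos (fun l => N l k) i
    have h3 : ∑ l, ∑ m, star (N l k) * T l m * N m k = (N * M * N) k k := by
      rw [CStarMatrix.mul_apply]
      simp only [CStarMatrix.mul_apply, Finset.sum_mul]
      rw [Finset.sum_comm]
      refine Finset.sum_congr rfl fun m _ => Finset.sum_congr rfl fun l _ => ?_
      have : star (N l k) = N k l := congrFun (congrFun hsa k) l
      rw [this]
      rfl
    have h4 : (star (R * N) * (R * N)) k k = ∑ q, star ((R * N) q k) * (R * N) q k := by
      rw [CStarMatrix.mul_apply]
      rfl
    rw [h3, h1, CStarMatrix.neg_apply, h4, map_neg, map_sum, neg_eq_iff_add_eq_zero] at hb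
    refine eq_zero_of_star_mul_self_add_sum b (fun q => π i ((R * N) q k)) ?_ (Finset.mem_univ p)
    rw [add_comm, ← hb]
    simp only [map_mul, map_star]
  obtain ⟨B, hB⟩ := hB h0
  refine ⟨fun p k => B p k, fun k l => ?_⟩
  have h : M k l = (star B * B) k l := by rw [← hB]
  rw [CStarMatrix.mul_apply] at h
  exact h

section

variable {X : Type*} [TopologicalSpace X] [T2Space X] [LocallyCompactSpace X] {C : Type*}
  [NonUnitalCStarAlgebra C] (𝒞 : C0Algebra X C)

/-- Evaluation at a point of the base space. -/
noncomputable def C0Algebra.evalSection (K : Set X) (x : X) :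
    𝒞.sectionsVanishingOff K →⋆ₙₐ[ℂ] 𝒞.FibreAlgebra x where
  toFun c := c.1 x
  map_smul' _ _ := rfl
  map_zero' := rfl
  map_add' _ _ := rfl
  map_mul' _ _ := rfl
  map_star' _ := rfl

/-- The Gram matrix of finitely many compactly supported sections of the bundle of a Hilbert module
is of the form `B^* B` for a matrix `B` of continuous sections. -/
theorem HilbertModule.exists_gram_sections {E : Type*} [NormedAddCommGroup E] [NormedSpace ℂ E]
    (𝓔 : HilbertModule C E) {n : Type*} [Fintype n] (x : n → ∀ y, Fibre (𝓔.orbit 𝒞) y)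
    (hx : ∀ l, x l ∈ compactSections (𝓔.orbit 𝒞) (ContinuousMap.id X)) :
    ∃ B : n → n → ∀ y, Fibre 𝒞.orbit y,
      (∀ p l, Continuous fun y => (⟨y, B p l y⟩ : TotalSpace 𝒞.orbit)) ∧
      ∀ y k l, 𝓔.fibreInner 𝒞 y (x k y) (x l y) =
        ∑ p, 𝒞.fibreMul y (𝒞.fibreStar y (B p k y)) (B p l y) := by
  have hb : ∀ k l, Memℓp (fun y => 𝒞.toFibreAlgebra y (𝓔.fibreInner 𝒞 y (x k y) (x l y))) ∞ := by
    intro k l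
    obtain ⟨M, hM, hkM⟩ := exists_norm_le_of_mem_compactSections _ (hx k)
    obtain ⟨N, -, hlN⟩ := exists_norm_le_of_mem_compactSections _ (hx l)
    refine memℓp_infty ⟨M * N, ?_⟩
    rintro _ ⟨y, rfl⟩
    refine (𝓔.norm_fibreInner_le 𝒞 y _ _).trans ?_
    gcongr
    · exact hkM y
    · exact hlN y
  let T : n → n → 𝒞.sectionsVanishingOff Set.univ := fun k l => ⟨⟨_, hb k l⟩,
    fun y₀ => continuousAt_section_map₂ 𝓔.inner (𝓔.fibreInner 𝒞) (𝓔.fibreInner_toFibre 𝒞)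
      (𝓔.norm_fibreInner_le 𝒞) (continuousAt_section_comp (hx k) continuousAt_id)
      (continuousAt_section_comp (hx l) continuousAt_id), fun y hy => absurd trivial hy⟩
  obtain ⟨B, hB⟩ := exists_gram_factorization (𝒞.evalSection Set.univ)
    (fun a ha => Subtype.ext (lp.ext (funext ha))) T
    (fun k l => Subtype.ext (lp.ext (funext fun y => 𝓔.fibreStar_fibreInner 𝒞 y _ _)))
    fun z y => by
      -- At the point `y` the quadratic form of the Gram matrix is `⟨e, e⟩` with `e = ∑_l x_l(y)
      -- z_l(y)`.
      let e := ∑ l, 𝓔.fibreRsmul 𝒞 y (x l y) ((𝒞.toFibreAlgebra y).symm ((z l).1 y))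
      obtain ⟨b, hb⟩ := 𝓔.exists_fibreInner_self_eq 𝒞 y e
      refine ⟨𝒞.toFibreAlgebra y b, Eq.trans ?_ (congrArg (𝒞.toFibreAlgebra y) hb)⟩
      simp only [map_sum, map_mul, e, LinearMap.sum_apply, 𝓔.fibreInner_fibreRsmul]
      refine Eq.trans ?_ Finset.sum_comm
      refine Finset.sum_congr rfl fun k _ => Finset.sum_congr rfl fun l _ => ?_
      rw [← 𝓔.fibreStar_fibreInner 𝒞 y (x l y), 𝓔.fibreInner_fibreRsmul, 𝒞.fibreStar_fibreMul,
        𝓔.fibreStar_fibreInner]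
      rfl
  refine ⟨fun p l y => (𝒞.toFibreAlgebra y).symm ((B p l).1 y), fun p l =>
    continuous_iff_continuousAt.2 (B p l).2.1, fun y k l => ?_⟩
  have h := congrArg (𝒞.evalSection Set.univ y) (hB k l)
  rw [map_sum] at h
  simp only [map_mul, map_star] at h
  exact h

end

end GroupoidCrossedProduct

namespace GroupoidCrossedProduct

/-! ## Positivity of the inner product of sections over the groupoid -/

namespace HilbertAction

variable {H : Type uH} [TopologicalSpace H] [T2Space H] {G : EtaleGroupoid H}
  {C : Type uC} [NonUnitalCStarAlgebra C] {𝒞 : C0Algebra G.units C} {α : CStarAction G 𝒞}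
  {E : Type uE} [NormedAddCommGroup E] [NormedSpace ℂ E] {𝓔 : HilbertModule C E}
  (β : HilbertAction α 𝓔)

/-- A compactly supported section over `G` is, up to the action, a finite sum of sections pulled
back along the range map, with scalar coefficients. -/
theorem exists_act_eq_sum {a : ∀ g, Fibre (𝓔.orbit 𝒞) (G.s g)}
    (ha : a ∈ compactSections (𝓔.orbit 𝒞) G.s) :
    ∃ (n : ℕ) (θ : Fin n → C(H, ℝ)) (x : Fin n → ∀ y, Fibre (𝓔.orbit 𝒞) y),
      (∀ l, HasCompactSupport (θ l)) ∧
      (∀ l, x l ∈ compactSections (𝓔.orbit 𝒞) (ContinuousMap.id G.units)) ∧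
      ∀ h, β.act h rfl rfl (a h) = ∑ l, (θ l h : ℂ) • x l (G.r h) := by
  have : LocallyCompactSpace H := locallyCompactSpace_of_isLocalHomeomorph G.isLocalHomeomorph_r
  obtain ⟨n, U, hU, hUi, hKU⟩ := exists_injOn_cover G.isLocalHomeomorph_r ha.2
  obtain ⟨f, hfU, hf1, hf01, hfc⟩ := exists_continuous_sum_one_of_isOpen_isCompact hU ha.2 hKU
  let θ : Fin n → C(H, ℝ) := fun l => ⟨fun h => √(f l h), by fun_prop⟩
  have hθ0 : ∀ l h, h ∉ U l → θ l h = 0 := by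
    intro l h hh
    have : f l h = 0 := by
      by_contra h0
      exact hh (hfU l (subset_tsupport _ h0))
    simp [θ, this]
  let F : ∀ (l : Fin n) (y : G.units) (h : H), G.r h = y → Fibre (𝓔.orbit 𝒞) y :=
    fun l y h e => (θ l h : ℂ) • β.act h rfl e (a h)
  refine ⟨n, θ, fun l y => ∑ᶠ h : {h // G.r h = y}, F l y h.1 h.2, fun l => ?_, fun l => ?_,
    fun h => ?_⟩
  · exact (hfc l).comp_left (g := Real.sqrt) Real.sqrt_zero
  · refine finsum_fibre_mem_compactSections (𝓔.orbit 𝒞) (ContinuousMap.id G.units)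
      G.isLocalHomeomorph_r continuous_id (F l) ?_ ((fun h => (G.r h, h)) '' closure {g | a g ≠ 0})
      (ha.2.image (G.r.continuous.prodMk continuous_id)) ?_
    · refine continuous_iff_continuousAt.2 fun p₀ => ?_
      have h1 : Continuous fun p : {p : G.units × H // G.r p.2 = id p.1} => p.1.2 :=
        continuous_snd.comp continuous_subtype_val
      have h2 := continuousAt_section_comp (z₀ := p₀) ha h1.continuousAt
      have h3 := β.continuousAt_section (y₀ := p₀)
        (fun p : {p : G.units × H // G.r p.2 = id p.1} => (rfl : G.s p.1.2 = G.s p.1.2))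
        (fun p => p.2) h1.continuousAt h2
      refine continuousAt_section_smul _ (φ := fun p : {p : G.units × H // G.r p.2 = id p.1} =>
        (θ l p.1.2 : ℂ)) ?_ h3
      exact (Complex.continuous_ofReal.comp ((θ l).continuous.comp h1)).continuousAt
    · intro y h e hne
      have : a h ≠ 0 := fun h0 => hne (by
        change (θ l h : ℂ) • β.act h rfl e (a h) = 0
        rw [h0, map_zero, smul_zero])
      exact ⟨h, subset_closure this, Prod.ext e rfl⟩
  · have h1 : ∀ l, (θ l h : ℂ) • ∑ᶠ k : {k // G.r k = G.r h}, F l (G.r h) k.1 k.2 =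
        (f l h : ℂ) • β.act h rfl rfl (a h) := by
      intro l
      by_cases hl : h ∈ U l
      · rw [finsum_eq_single _ ⟨h, rfl⟩ fun k hk => ?_]
        · simp only [F, smul_smul]
          rw [← Complex.ofReal_mul]
          congr 2
          exact Real.mul_self_sqrt (hf01 l h).1
        · have : k.1 ∉ U l := fun hk' => hk (Subtype.ext (hUi l hk' hl k.2))
          simp [F, hθ0 l _ this]
      · have h0 := hθ0 l h hl
        have : f l h = 0 := by
          have := Real.mul_self_sqrt (hf01 l h).1
          simp only [θ, ContinuousMap.coe_mk] at h0
          rw [← this, h0, mul_zero]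
        rw [h0, this]
        simp
    rw [Finset.sum_congr rfl fun l _ => h1 l, ← Finset.sum_smul]
    by_cases hg : a h = 0
    · simp [hg]
    · have h := hf1 (subset_closure hg)
      simp only [Finset.sum_apply, Pi.one_apply] at h
      rw [← Complex.ofReal_sum, h, Complex.ofReal_one, one_smul]

/-- The inner product of a section over `G` with itself is a finite sum of elements
`b^* * b`. -/
theorem exists_sectionInner_self_eq {a : ∀ g, Fibre (𝓔.orbit 𝒞) (G.s g)}
    (ha : a ∈ compactSections (𝓔.orbit 𝒞) G.s) :
    ∃ (n : ℕ) (b : Fin n → α.Sections),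
      β.sectionInner (RightSpaceAction.self G) a a =
        ∑ p, α.conv (α.invol (b p).1) (b p).1 := by
  obtain ⟨n, θ, x, hθ, hx, hax⟩ := β.exists_act_eq_sum ha
  obtain ⟨B, hB, hxB⟩ := 𝓔.exists_gram_sections 𝒞 x hx
  -- The formula for `h · a(h)` with `x_l` replaced by `B_{pl}`.
  let c : Fin n → ∀ h, Fibre 𝒞.orbit (G.r h) := fun p h => ∑ l, (θ l h : ℂ) • B p l (G.r h)
  let b : Fin n → ∀ h, Fibre 𝒞.orbit (G.s h) := fun p h =>
    α.act (G.inv h) (G.s_inv h) (G.r_inv h) (c p h)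
  have hcK : ∀ p h, h ∉ ⋃ l, tsupport (θ l) → c p h = 0 := by
    intro p h hh
    refine Finset.sum_eq_zero fun l _ => ?_
    have : θ l h = 0 := by
      by_contra h0
      exact hh (Set.mem_iUnion.2 ⟨l, subset_tsupport _ h0⟩)
    simp [this]
  have hb : ∀ p, b p ∈ α.Sections := by
    intro p
    refine mem_compactSections_of_support_subset _ (continuous_iff_continuousAt.2 fun h₀ => ?_)
      (isCompact_iUnion fun l => hθ l) fun h hh => ?_
    · refine α.continuousAt_section (fun h => G.s_inv h) (fun h => G.r_inv h)
        G.continuous_inv.continuousAt ?_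
      refine continuousAt_section_sum _ _ G.r.continuous.continuousAt fun l _ => ?_
      refine continuousAt_section_smul _ (φ := fun h => (θ l h : ℂ)) ?_ ?_
      · exact (Complex.continuous_ofReal.comp (θ l).continuous).continuousAt
      · exact ((hB p l).comp G.r.continuous).continuousAt
    · by_contra h0
      exact hh (by simp [b, hcK p h h0])
  have hinner : ∀ (y : G.units) (u v : Fin n → ℂ), 𝓔.fibreInner 𝒞 y
      (∑ l, u l • x l y) (∑ l, v l • x l y) = ∑ p, 𝒞.fibreMul y
        (𝒞.fibreStar y (∑ l, u l • B p l y)) (∑ l, v l • B p l y) := by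
    intro y u v
    simp only [map_sum, LinearMap.sum_apply, map_smulₛₗ, LinearMap.smul_apply, map_smul,
      hxB, Finset.smul_sum]
    conv_rhs => rw [Finset.sum_comm]; enter [2, l]; rw [Finset.sum_comm]
    rfl
  refine ⟨n, fun p => ⟨b p, hb p⟩, ?_⟩
  funext g
  rw [Finset.sum_apply]
  have hact : ∀ k, a k = β.act (G.inv k) (G.s_inv k) (G.r_inv k)
      (∑ l, (θ l k : ℂ) • x l (G.r k)) := by
    intro k
    rw [← hax, β.act_inv_act]
  -- Since `r(kg) = r(k)`, both arguments are translates by `(kg)⁻¹` of vectors in the single fibre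
  -- at `r k`. There the Gram factorization applies, and equivariance carries it back to the fibre
  -- at `s g`.
  have hterm : ∀ k : {k : H // G.s k = G.r g},
      𝓔.fibreInner 𝒞 (G.s g) (β.act (G.inv g) ((G.s_inv g).trans k.2.symm) (G.r_inv g) (a k.1))
        (Fibre.cast (G.s_mul k.1 g k.2) (a (G.mul k.1 g k.2))) =
      ∑ p, 𝒞.fibreMul (G.s g)
        (α.act (G.inv g) ((G.s_inv g).trans k.2.symm) (G.r_inv g) (𝒞.fibreStar (G.s k.1) (b p k.1)))
        (Fibre.cast (G.s_mul k.1 g k.2) (b p (G.mul k.1 g k.2))) := by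
    intro k
    have hkg : G.mul (G.inv g) (G.inv k.1) ((G.s_inv g).trans (k.2.symm.trans (G.r_inv k.1).symm))
        = G.inv (G.mul k.1 g k.2) := (G.inv_mul_rev k.1 g k.2).symm
    have h1 : β.act (G.inv g) ((G.s_inv g).trans k.2.symm) (G.r_inv g) (a k.1) =
        β.act (G.inv (G.mul k.1 g k.2)) ((G.s_inv _).trans (G.r_mul _ _ _))
          ((G.r_inv _).trans (G.s_mul _ _ _)) (∑ l, (θ l k.1 : ℂ) • x l (G.r k.1)) := by
      rw [hact, β.act_act (hk := hkg)]
    have h2 : Fibre.cast (G.s_mul k.1 g k.2) (a (G.mul k.1 g k.2)) =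
        β.act (G.inv (G.mul k.1 g k.2)) ((G.s_inv _).trans (G.r_mul _ _ _))
          ((G.r_inv _).trans (G.s_mul _ _ _))
          (∑ l, (θ l (G.mul k.1 g k.2) : ℂ) • x l (G.r k.1)) := by
      rw [hact, β.cast_act]
      exact β.act_section_congr (f := fun y => y)
        (fun y => ∑ l, (θ l (G.mul k.1 g k.2) : ℂ) • x l y) (G.r_mul k.1 g k.2) _ _
    have h3 : ∀ p, α.act (G.inv g) ((G.s_inv g).trans k.2.symm) (G.r_inv g)
        (𝒞.fibreStar (G.s k.1) (b p k.1)) =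
        α.act (G.inv (G.mul k.1 g k.2)) ((G.s_inv _).trans (G.r_mul _ _ _))
          ((G.r_inv _).trans (G.s_mul _ _ _)) (𝒞.fibreStar (G.r k.1) (c p k.1)) := by
      intro p
      rw [← α.act_fibreStar, α.act_act (hk := hkg)]
    have h4 : ∀ p, Fibre.cast (G.s_mul k.1 g k.2) (b p (G.mul k.1 g k.2)) =
        α.act (G.inv (G.mul k.1 g k.2)) ((G.s_inv _).trans (G.r_mul _ _ _))
          ((G.r_inv _).trans (G.s_mul _ _ _))
          (∑ l, (θ l (G.mul k.1 g k.2) : ℂ) • B p l (G.r k.1)) := by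
      intro p
      simp only [b]
      rw [α.cast_act]
      exact α.act_section_congr (f := fun y => y)
        (fun y => ∑ l, (θ l (G.mul k.1 g k.2) : ℂ) • B p l y) (G.r_mul k.1 g k.2) _ _
    rw [h1, h2, ← β.act_fibreInner, hinner, map_sum]
    refine Finset.sum_congr rfl fun p _ => ?_
    rw [h3, h4, ← α.act_fibreMul]
  refine (finsum_congr hterm).trans ((finsum_sum_comm _ _ fun p _ => ?_).trans
    (Finset.sum_congr rfl fun p _ => (α.conv_invol_apply _ _ g).symm))
  refine (finite_fibre_subtype G.isLocalHomeomorph_s (isCompact_iUnion fun l => hθ l)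
    (G.r g)).subset fun k hk => ?_
  by_contra h0
  exact hk (by simp [b, hcK p k.1 h0])

end HilbertAction

end GroupoidCrossedProduct

namespace GroupoidCrossedProduct

/-! ## Sums over orbits -/

namespace RightSpaceAction

variable {H : Type uH} [TopologicalSpace H] [T2Space H] {G : EtaleGroupoid H}
  {Ω : Type uΩ} [TopologicalSpace Ω] (ρ : RightSpaceAction G Ω)

/-- The sum of a scalar function over the orbit of a point. -/
noncomputable def orbitSum (φ : Ω → ℝ) (ω : Ω) : ℝ :=
  ∑ᶠ k : {k : H // G.r k = ρ.σ ω}, φ (ρ.act ω k.1 k.2.symm)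

theorem orbitSum_eq (φ : Ω → ℝ) (ω : Ω) {y : G.units} (e : ρ.σ ω = y) :
    ρ.orbitSum φ ω = ∑ᶠ k : {k : H // G.r k = y}, φ (ρ.act ω k.1 (e.trans k.2.symm)) := by
  subst e; rfl

/-- The substitution `k ↦ hk`: acting by `h` does not change the orbit. -/
theorem orbitSum_act (φ : Ω → ℝ) (ω : Ω) (h : H) (e : ρ.σ ω = G.r h) :
    ρ.orbitSum φ (ρ.act ω h e) = ρ.orbitSum φ ω := by
  rw [ρ.orbitSum_eq φ _ (ρ.σ_act ω h e), ρ.orbitSum_eq φ ω e]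
  let f : {k : H // G.r k = G.s h} → {k : H // G.r k = G.r h} := fun k =>
    ⟨G.mul h k.1 k.2.symm, G.r_mul _ _ _⟩
  refine finsum_eq_of_bijective f ⟨fun k k' hk => ?_, fun k => ?_⟩ fun k => ?_
  · have hk' : G.mul h k.1 k.2.symm = G.mul h k'.1 k'.2.symm := congrArg Subtype.val hk
    apply Subtype.ext
    rw [← G.inv_mul_mul h k.1 k.2.symm, G.mul_congr rfl hk', G.inv_mul_mul]
  · refine ⟨⟨G.mul (G.inv h) k.1 ((G.s_inv h).trans k.2.symm), (G.r_mul _ _ _).trans (G.r_inv h)⟩,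
      Subtype.ext (G.mul_inv_mul_cancel _ _ _)⟩
  · exact congrArg φ (ρ.act_mul ω h k.1 e k.2.symm).symm

variable {ρ}

theorem IsProper.finite_orbit (hproper : ρ.IsProper) {K L : Set Ω} (hK : IsCompact K)
    (hL : IsCompact L) (y : G.units) :
    {k : {k : H // G.r k = y} | ∃ (ω : Ω) (e : ρ.σ ω = G.r k.1), ω ∈ K ∧
      ρ.act ω k.1 e ∈ L}.Finite :=
  (finite_fibre_subtype G.isLocalHomeomorph_r ((hproper.isCompact hK hL).image continuous_snd)
    y).subset fun k ⟨ω, e, h1, h2⟩ => ⟨(ω, k.1), ⟨e, h1, h2⟩, rfl⟩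

theorem IsProper.finite_support_orbitSum (hproper : ρ.IsProper) {φ : Ω → ℝ}
    (hφ : HasCompactSupport φ) (ω : Ω) {y : G.units} (e : ρ.σ ω = y) :
    (Function.support fun k : {k : H // G.r k = y} =>
      φ (ρ.act ω k.1 (e.trans k.2.symm))).Finite :=
  (hproper.finite_orbit isCompact_singleton hφ y).subset fun k hk =>
    ⟨ω, e.trans k.2.symm, rfl, subset_tsupport _ hk⟩

theorem IsProper.le_orbitSum (hproper : ρ.IsProper) {φ : Ω → ℝ} (hφ : HasCompactSupport φ)
    (hφ0 : ∀ ω, 0 ≤ φ ω) (ω : Ω) : φ ω ≤ ρ.orbitSum φ ω := by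
  have h := single_le_finsum (⟨(ρ.σ ω : H), G.r_unit _⟩ : {k : H // G.r k = ρ.σ ω})
    (hproper.finite_support_orbitSum hφ ω rfl) fun k => hφ0 _
  rwa [ρ.act_unit'] at h

/-- For `ω` in a compact neighbourhood of `ω₀`, properness confines the pairs `(ω, k)` with `ω · k`
in the support of `φ` to a compact set. -/
theorem IsProper.continuous_orbitSum [T2Space Ω] [LocallyCompactSpace Ω] (hproper : ρ.IsProper)
    {φ : Ω → ℝ} (hφc : Continuous φ) (hφ : HasCompactSupport φ) : Continuous (ρ.orbitSum φ) := by
  classical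
  refine continuous_iff_continuousAt.2 fun ω₀ => ?_
  let F : Ω → H → ℝ := fun ω k => if e : ρ.σ ω = G.r k then φ (ρ.act ω k e) else 0
  have hF : ρ.orbitSum φ = fun ω => ∑ᶠ k : {k : H // G.r k = ρ.σ ω}, F ω k.1 := by
    funext ω
    refine finsum_congr fun k => ?_
    simp only [F, dif_pos k.2.symm]
  obtain ⟨N, hN, hN₀⟩ := exists_compact_mem_nhds ω₀
  rw [hF]
  refine continuousAt_finsum_fibre G.isLocalHomeomorph_r ρ.σ.continuous F ω₀ ?_ _
    (hproper.isCompact hN hφ) ?_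
  · rw [continuousOn_iff_continuous_restrict]
    have h1 : Continuous fun p : {p : Ω × H // G.r p.2 = ρ.σ p.1} =>
        φ (ρ.act p.1.1 p.1.2 p.2.symm) :=
      hφc.comp (ρ.continuous_act.comp (Continuous.subtype_mk continuous_subtype_val fun p =>
        p.2.symm))
    refine h1.congr fun p => ?_
    have hp : ρ.σ p.1.1 = G.r p.1.2 := p.2.symm
    simp only [Set.restrict_apply, F, dif_pos hp]
  · filter_upwards [hN₀] with ω hω k hk hne
    simp only [F, dif_pos hk.symm] at hne
    exact ⟨hk.symm, hω, subset_tsupport _ hne⟩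

end RightSpaceAction

/-! ## Reduction of positivity to sections over the groupoid -/

namespace HilbertAction

variable {H : Type uH} [TopologicalSpace H] [T2Space H] {G : EtaleGroupoid H}
  {C : Type uC} [NonUnitalCStarAlgebra C] {𝒞 : C0Algebra G.units C} {α : CStarAction G 𝒞}
  {E : Type uE} [NormedAddCommGroup E] [NormedSpace ℂ E] {𝓔 : HilbertModule C E}
  {Ω : Type uΩ} [TopologicalSpace Ω] (β : HilbertAction α 𝓔) (ρ : RightSpaceAction G Ω)

/-- The section `h ↦ ∑_w θ(w) ξ(w · h)` over `G`, where `w` runs over the fibre at `r h`. -/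
noncomputable def orbitSection (_ : HilbertAction α 𝓔) (ρ : RightSpaceAction G Ω) (θ : Ω → ℝ)
    (ξ : ∀ ω, Fibre (𝓔.orbit 𝒞) (ρ.σ ω)) (h : H) : Fibre (𝓔.orbit 𝒞) (G.s h) :=
  ∑ᶠ w : {w : Ω // ρ.σ w = G.r h},
    (θ w.1 : ℂ) • Fibre.cast (ρ.σ_act w.1 h w.2) (ξ (ρ.act w.1 h w.2))

theorem orbitSection_mem [T2Space Ω] (hproper : ρ.IsProper) (hetale : ρ.IsEtale) {θ : Ω → ℝ}
    (hθc : Continuous θ) (hθ : HasCompactSupport θ) {ξ : ∀ ω, Fibre (𝓔.orbit 𝒞) (ρ.σ ω)}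
    (hξ : ξ ∈ β.Sections ρ) :
    β.orbitSection ρ θ ξ ∈ compactSections (𝓔.orbit 𝒞) G.s := by
  refine finsum_fibre_mem_compactSections (𝓔.orbit 𝒞) G.s hetale G.r.continuous
    (fun h w e => (θ w : ℂ) • Fibre.cast (ρ.σ_act w h e) (ξ (ρ.act w h e))) ?_ _
    ((hproper.isCompact hθ hξ.2).image continuous_swap) ?_
  · refine continuous_iff_continuousAt.2 fun p₀ => ?_
    have h2 : Continuous fun p : {p : H × Ω // ρ.σ p.2 = G.r p.1} => p.1.2 :=
      continuous_snd.comp continuous_subtype_val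
    have h3 : Continuous fun p : {p : H × Ω // ρ.σ p.2 = G.r p.1} =>
        ρ.act p.1.2 p.1.1 p.2 :=
      ρ.continuous_act.comp (Continuous.subtype_mk
        (continuous_swap.comp continuous_subtype_val) fun p => p.2)
    have h4 := continuousAt_section_cast (𝓔.orbit 𝒞) (y₀ := p₀)
      (fun p : {p : H × Ω // ρ.σ p.2 = G.r p.1} => ρ.σ_act p.1.2 p.1.1 p.2)
      (continuousAt_section_comp hξ h3.continuousAt)
    refine continuousAt_section_smul _ (φ := fun p : {p : H × Ω // ρ.σ p.2 = G.r p.1} =>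
      (θ p.1.2 : ℂ)) ?_ h4
    exact (Complex.continuous_ofReal.comp (hθc.comp h2)).continuousAt
  · intro h w e hne
    have hw : θ w ≠ 0 := fun h0 => hne (by simp [h0])
    have hξ' : ξ (ρ.act w h e) ≠ 0 := fun h0 => hne (by simp [h0])
    exact ⟨(w, h), ⟨e, subset_tsupport _ hw, subset_closure hξ'⟩, rfl⟩

theorem orbitSection_eq_of_injOn {U : Set Ω} (hU : Set.InjOn ρ.σ U) {θ : Ω → ℝ}
    (hθ : ∀ w ∉ U, θ w = 0) (ξ : ∀ ω, Fibre (𝓔.orbit 𝒞) (ρ.σ ω)) {w : Ω} (hw : w ∈ U) (h : H)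
    (e : ρ.σ w = G.r h) :
    β.orbitSection ρ θ ξ h = (θ w : ℂ) • Fibre.cast (ρ.σ_act w h e) (ξ (ρ.act w h e)) := by
  refine finsum_eq_single _ (⟨w, e⟩ : {w : Ω // ρ.σ w = G.r h}) fun w' hw' => ?_
  have : w'.1 ∉ U := fun h => hw' (Subtype.ext (hU h hw (w'.2.trans e.symm)))
  simp [hθ _ this]

theorem orbitSection_eq_zero {θ : Ω → ℝ} (ξ : ∀ ω, Fibre (𝓔.orbit 𝒞) (ρ.σ ω)) (h : H)
    (hθ : ∀ w, ρ.σ w = G.r h → θ w = 0) : β.orbitSection ρ θ ξ h = 0 :=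
  finsum_eq_zero_of_forall_eq_zero fun w => by simp [hθ _ w.2]

/-- The summand `⟨h⁻¹ · ξ(ω), ξ(ω · h)⟩` of `⟨ξ, ξ⟩(h)`. -/
noncomputable def innerTerm (ξ : ∀ ω, Fibre (𝓔.orbit 𝒞) (ρ.σ ω)) (h : H)
    (ω : {ω : Ω // ρ.σ ω = G.r h}) : Fibre 𝒞.orbit (G.s h) :=
  𝓔.fibreInner 𝒞 (G.s h)
    (β.act (G.inv h) ((G.s_inv h).trans ω.2.symm) (G.r_inv h) (ξ ω.1))
    (Fibre.cast (ρ.σ_act ω.1 h ω.2) (ξ (ρ.act ω.1 h ω.2)))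

theorem innerTerm_smul (c : Ω → ℝ) (ξ : ∀ ω, Fibre (𝓔.orbit 𝒞) (ρ.σ ω)) (h : H)
    (ω : {ω : Ω // ρ.σ ω = G.r h}) :
    β.innerTerm ρ (fun ω => (c ω : ℂ) • ξ ω) h ω =
      ((c ω.1 * c (ρ.act ω.1 h ω.2) : ℝ) : ℂ) • β.innerTerm ρ ξ h ω := by
  simp only [innerTerm, Fibre.cast_smul, map_smul, map_smulₛₗ, LinearMap.smul_apply, smul_smul,
    Complex.conj_ofReal, Complex.ofReal_mul]
  rw [mul_comm]

/-- For each `g` at most one `w` in `U` lies over `r g`, so the product of the two orbit sections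
has the single term `φ(w) ⟨h⁻¹ · ξ(w · g), ξ(w · gh)⟩`. Put `ω = w · g` and `k = g⁻¹`; for fixed `ω`
the sum over `k` of `φ(ω · k)` is the orbit sum. -/
theorem sectionInner_orbitSection [T2Space Ω] (hproper : ρ.IsProper) (hetale : ρ.IsEtale)
    {U : Set Ω} (hU : Set.InjOn ρ.σ U) {φ : Ω → ℝ} (hφ0 : ∀ w, 0 ≤ φ w) (hφU : ∀ w ∉ U, φ w = 0)
    (hφ : HasCompactSupport φ) {ξ : ∀ ω, Fibre (𝓔.orbit 𝒞) (ρ.σ ω)} (hξ : ξ ∈ β.Sections ρ)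
    (h : H) :
    β.sectionInner (RightSpaceAction.self G) (β.orbitSection ρ (fun w => √(φ w)) ξ)
        (β.orbitSection ρ (fun w => √(φ w)) ξ) h =
      ∑ᶠ ω : {ω : Ω // ρ.σ ω = G.r h}, (ρ.orbitSum φ ω.1 : ℂ) • β.innerTerm ρ ξ h ω := by
  have hθU : ∀ w ∉ U, √(φ w) = 0 := fun w hw => by rw [hφU w hw, Real.sqrt_zero]
  have hterm : ∀ g : {g : H // G.s g = G.r h},
      𝓔.fibreInner 𝒞 (G.s h)
        (β.act (G.inv h) ((G.s_inv h).trans g.2.symm) (G.r_inv h)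
          (β.orbitSection ρ (fun w => √(φ w)) ξ g.1))
        (Fibre.cast (G.s_mul g.1 h g.2)
          (β.orbitSection ρ (fun w => √(φ w)) ξ (G.mul g.1 h g.2))) =
      ∑ᶠ w : {w : Ω // ρ.σ w = G.r g.1}, (φ w.1 : ℂ) •
        β.innerTerm ρ ξ h ⟨ρ.act w.1 g.1 w.2, (ρ.σ_act _ _ _).trans g.2⟩ := by
    intro g
    by_cases hw : ∃ w ∈ U, ρ.σ w = G.r g.1
    · obtain ⟨w, hwU, hwg⟩ := hw
      rw [finsum_eq_single _ ⟨w, hwg⟩ fun w' hw' => ?_]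
      · rw [β.orbitSection_eq_of_injOn ρ hU hθU ξ hwU g.1 hwg,
          β.orbitSection_eq_of_injOn ρ hU hθU ξ hwU (G.mul g.1 h g.2)
            (hwg.trans (G.r_mul _ _ _).symm)]
        simp only [Fibre.cast_smul, map_smul, map_smulₛₗ, LinearMap.smul_apply, smul_smul,
          Complex.conj_ofReal]
        rw [← Complex.ofReal_mul, Real.mul_self_sqrt (hφ0 w), β.act_cast, Fibre.cast_cast,
          Fibre.cast_section ξ (ρ.act_mul w g.1 h hwg g.2) _ (by
            rw [ρ.σ_act])]
        rfl
      · have : w'.1 ∉ U := fun h => hw' (Subtype.ext (hU h hwU (w'.2.trans hwg.symm)))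
        simp [hφU _ this]
    · have h0 : ∀ w, ρ.σ w = G.r g.1 → w ∉ U := fun w hwg hwU => hw ⟨w, hwU, hwg⟩
      rw [β.orbitSection_eq_zero ρ ξ g.1 fun w hwg => hθU w (h0 w hwg),
        finsum_eq_zero_of_forall_eq_zero fun w => by simp [hφU _ (h0 _ w.2)]]
      simp
  -- The common double sum, in the variables `k = g⁻¹` and `ω = w · g`. Properness bounds `k`, and
  -- the support of `ξ` bounds `ω`.
  let T : {k : H // G.r k = G.r h} → {ω : Ω // ρ.σ ω = G.r h} → Fibre 𝒞.orbit (G.s h) :=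
    fun k ω => (φ (ρ.act ω.1 k.1 (ω.2.trans k.2.symm)) : ℂ) • β.innerTerm ρ ξ h ω
  have hS : ∀ ω, β.innerTerm ρ ξ h ω ≠ 0 → ξ ω.1 ≠ 0 := fun ω hne h0 =>
    hne (by simp [innerTerm, h0])
  have hT1 : ∀ k ω, T k ω ≠ 0 → k ∈ {k : {k : H // G.r k = G.r h} | ∃ (ω : Ω)
      (e : ρ.σ ω = G.r k.1), ω ∈ closure {ω | ξ ω ≠ 0} ∧ ρ.act ω k.1 e ∈ tsupport φ} :=
    fun k ω hne => ⟨ω.1, ω.2.trans k.2.symm,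
      subset_closure (hS ω fun h0 => hne (by simp [T, h0])),
      subset_tsupport _ fun h0 => hne (by simp [T, h0])⟩
  have hT2 : ∀ k ω, T k ω ≠ 0 → ω ∈ {ω : {ω : Ω // ρ.σ ω = G.r h} | ξ ω.1 ≠ 0} :=
    fun k ω hne => hS ω fun h0 => hne (by simp [T, h0])
  let e₁ : {k : H // G.r k = G.r h} → {g : H // G.s g = G.r h} := fun k =>
    ⟨G.inv k.1, (G.s_inv _).trans k.2⟩
  have he₁ : Function.Bijective e₁ := ⟨fun k k' hk =>
    Subtype.ext (G.inv_injective (congrArg Subtype.val hk)), fun g =>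
      ⟨⟨G.inv g.1, (G.r_inv _).trans g.2⟩, Subtype.ext (G.inv_inv _)⟩⟩
  refine (finsum_congr hterm).trans ((finsum_eq_of_bijective e₁ he₁ fun k => ?_).symm.trans
    ((finsum_comm_of_finite T (hproper.finite_orbit hξ.2 hφ _)
      (β.finite_support_fibre ρ hetale hξ _) hT1 hT2).trans (finsum_congr fun ω => ?_)))
  · let e₂ : {ω : Ω // ρ.σ ω = G.r h} → {w : Ω // ρ.σ w = G.r (e₁ k).1} := fun ω =>
      ⟨ρ.act ω.1 k.1 (ω.2.trans k.2.symm), (ρ.σ_act _ _ _).trans (G.r_inv _).symm⟩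
    have hinv : ∀ ω, ρ.act (e₂ ω).1 (e₁ k).1 (e₂ ω).2 = ω.1 := fun ω => ρ.act_act_inv _ _ _
    refine finsum_eq_of_bijective e₂ ⟨fun ω ω' hω => ?_, fun w => ?_⟩ fun ω => ?_
    · apply Subtype.ext
      rw [← hinv ω, ← hinv ω', ρ.act_congr (congrArg Subtype.val hω) rfl]
    · exact ⟨⟨ρ.act w.1 (e₁ k).1 w.2, (ρ.σ_act _ _ _).trans (e₁ k).2⟩,
        Subtype.ext (ρ.act_inv_act w.1 k.1 w.2)⟩
    · exact congrArg (fun ω' => (φ (e₂ ω).1 : ℂ) • β.innerTerm ρ ξ h ω') (Subtype.ext (hinv ω)).symm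
  · rw [← finsum_smul, ρ.orbitSum_eq φ ω.1 ω.2]
    congr 1
    exact (AddMonoidHom.map_finsum (Complex.ofRealHom : ℝ →+ ℂ)
      (hproper.finite_support_orbitSum hφ ω.1 ω.2)).symm

/-- The inner product of a section over `Ω` with itself is a finite sum of inner products of
sections over `G` with themselves. -/
theorem exists_sectionInner_eq_sum_self [T2Space Ω] (hproper : ρ.IsProper) (hetale : ρ.IsEtale)
    {ξ : ∀ ω, Fibre (𝓔.orbit 𝒞) (ρ.σ ω)} (hξ : ξ ∈ β.Sections ρ) :
    ∃ (n : ℕ) (a : Fin n → ∀ g, Fibre (𝓔.orbit 𝒞) (G.s g)),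
      (∀ i, a i ∈ compactSections (𝓔.orbit 𝒞) G.s) ∧
      β.sectionInner ρ ξ ξ = ∑ i, β.sectionInner (RightSpaceAction.self G) (a i) (a i) := by
  have : LocallyCompactSpace Ω := locallyCompactSpace_of_isLocalHomeomorph hetale
  obtain ⟨n, U, hU, hUi, hKU⟩ := exists_injOn_cover hetale hξ.2
  obtain ⟨φ, hφU, hφ1, hφ01, hφc⟩ := exists_continuous_sum_one_of_isOpen_isCompact hU hξ.2 hKU
  have hφ0 : ∀ i w, w ∉ U i → φ i w = 0 := by
    intro i w hw
    by_contra h0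
    exact hw (hφU i (subset_tsupport _ h0))
  -- The `φ i` sum to `1` where `ξ ≠ 0`, and each is bounded by its orbit sum, so `Ψ ≥ 1` there.
  let Ψ : Ω → ℝ := fun ω => ∑ i, ρ.orbitSum (φ i) ω
  have hΨc : Continuous Ψ := continuous_finsetSum _ fun i _ =>
    hproper.continuous_orbitSum (φ i).continuous (hφc i)
  have hΨ1 : ∀ ω, ξ ω ≠ 0 → 1 ≤ Ψ ω := by
    intro ω hω
    have h := hφ1 (subset_closure hω)
    simp only [Finset.sum_apply, Pi.one_apply] at h
    rw [← h]
    exact Finset.sum_le_sum fun i _ => hproper.le_orbitSum (hφc i) (fun w => (hφ01 i w).1) ω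
  have hΨinv : ∀ ω h e, Ψ (ρ.act ω h e) = Ψ ω := fun ω h e =>
    Finset.sum_congr rfl fun i _ => ρ.orbitSum_act _ _ _ _
  -- The maximum with `1` makes `c` continuous on all of `Ω` without changing it where `ξ ≠ 0`.
  let c : Ω → ℝ := fun ω => (√(max (Ψ ω) 1))⁻¹
  have hc : Continuous c := by
    refine Continuous.inv₀ (by fun_prop) fun ω => ?_
    have : 0 < max (Ψ ω) 1 := lt_max_of_lt_right one_pos
    positivity
  have hcΨ : ∀ ω, 1 ≤ Ψ ω → Ψ ω * (c ω * c ω) = 1 := by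
    intro ω hω
    have h1 : √(Ψ ω) * √(Ψ ω) = Ψ ω := Real.mul_self_sqrt (by linarith)
    simp only [c, max_eq_left hω]
    rw [← mul_inv, h1, mul_inv_cancel₀ (by linarith)]
  let ζ : ∀ ω, Fibre (𝓔.orbit 𝒞) (ρ.σ ω) := fun ω => (c ω : ℂ) • ξ ω
  have hζ : ζ ∈ β.Sections ρ :=
    smul_mem_compactSections _ (Complex.continuous_ofReal.comp hc) hξ
  refine ⟨n, fun i => β.orbitSection ρ (fun w => √(φ i w)) ζ, fun i => ?_, ?_⟩
  · exact β.orbitSection_mem ρ hproper hetale (by fun_prop)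
      ((hφc i).comp_left (g := Real.sqrt) Real.sqrt_zero) hζ
  · funext h
    rw [Finset.sum_apply, Finset.sum_congr rfl fun i _ => β.sectionInner_orbitSection ρ hproper
      hetale (hUi i) (fun w => (hφ01 i w).1) (hφ0 i) (hφc i) hζ h]
    refine Eq.trans (finsum_congr fun ω => ?_) (finsum_sum_comm _ _ fun i _ => ?_)
    · change β.innerTerm ρ ξ h ω = _
      rw [← Finset.sum_smul, ← Complex.ofReal_sum, β.innerTerm_smul, smul_smul,
        ← Complex.ofReal_mul]
      by_cases h0 : ξ ω.1 = 0
      · simp [innerTerm, h0]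
      -- Invariance of `Ψ` turns the factor `c(ω) c(ω · h)` into `c(ω)²`, which cancels `Ψ(ω)`.
      · have hcc : c (ρ.act ω.1 h ω.2) = c ω.1 := by simp only [c, hΨinv]
        rw [hcc, hcΨ _ (hΨ1 _ h0), Complex.ofReal_one, one_smul]
    · refine (β.finite_support_fibre ρ hetale hζ (G.r h)).subset fun ω hω h0 => hω ?_
      simp [innerTerm, h0]

/-- `⟨ξ, ξ⟩` is a finite sum of elements `b^* * b`. -/
theorem exists_sectionInner_self_eq_sum [T2Space Ω] (hproper : ρ.IsProper) (hetale : ρ.IsEtale)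
    {ξ : ∀ ω, Fibre (𝓔.orbit 𝒞) (ρ.σ ω)} (hξ : ξ ∈ β.Sections ρ) :
    ∃ (n : ℕ) (m : Fin n → ℕ) (b : ∀ i, Fin (m i) → α.Sections), β.sectionInner ρ ξ ξ =
      ∑ i, ∑ p, α.conv (α.invol (b i p).1) (b i p).1 := by
  obtain ⟨n, a, ha, h⟩ := β.exists_sectionInner_eq_sum_self ρ hproper hetale hξ
  choose m b hb using fun i => β.exists_sectionInner_self_eq (ha i)
  exact ⟨n, m, b, h.trans (Finset.sum_congr rfl fun i _ => hb i)⟩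

end HilbertAction

end GroupoidCrossedProduct

namespace GroupoidCrossedProduct

/-! ## Completion of pre-Hilbert modules -/

/-- A definite inner product on a complex normed space with values in a C⋆-algebra that induces the
norm and satisfies the Cauchy–Schwarz inequality. -/
structure CStarInner (A : Type*) [NonUnitalCStarAlgebra A] (V : Type*) [NormedAddCommGroup V]
    [NormedSpace ℂ V] where
  inner : V → V → A
  inner_add_right : ∀ x y z, inner x (y + z) = inner x y + inner x z
  inner_smul_right : ∀ (x y) (z : ℂ), inner x (z • y) = z • inner x y
  star_inner : ∀ x y, star (inner x y) = inner y x
  inner_self_nonneg : ∀ x, ∃ b : A, inner x x = star b * b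
  norm_sq_eq : ∀ x, ‖x‖ ^ 2 = ‖inner x x‖
  norm_inner_le : ∀ x y, ‖inner x y‖ ≤ ‖x‖ * ‖y‖

theorem isClosed_star_mul_self (A : Type*) [NonUnitalCStarAlgebra A] :
    IsClosed {a : A | ∃ b, a = star b * b} := by
  let : PartialOrder A := CStarAlgebra.spectralOrder A
  have : StarOrderedRing A := CStarAlgebra.spectralOrderedRing A
  simpa only [CStarAlgebra.nonneg_iff_eq_star_mul_self] using
    CStarAlgebra.isClosed_nonneg (A := A)

theorem exists_sum_star_mul_self {A κ : Type*} [NonUnitalCStarAlgebra A] (s : Finset κ)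
    {a : κ → A} (h : ∀ i ∈ s, ∃ b, a i = star b * b) : ∃ b, ∑ i ∈ s, a i = star b * b := by
  let : PartialOrder A := CStarAlgebra.spectralOrder A
  have : StarOrderedRing A := CStarAlgebra.spectralOrderedRing A
  rw [← CStarAlgebra.nonneg_iff_eq_star_mul_self]
  exact Finset.sum_nonneg fun i hi => CStarAlgebra.nonneg_iff_eq_star_mul_self.2 (h i hi)

namespace CStarInner

variable {A : Type*} [NonUnitalCStarAlgebra A] {V : Type*} [NormedAddCommGroup V]
  [NormedSpace ℂ V] (I : CStarInner A V)

theorem inner_add_left (x y z : V) : I.inner (x + y) z = I.inner x z + I.inner y z := by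
  rw [← I.star_inner, I.inner_add_right, star_add, I.star_inner, I.star_inner]

theorem inner_smul_left (x y : V) (z : ℂ) : I.inner (z • x) y = star z • I.inner x y := by
  rw [← I.star_inner, I.inner_smul_right, star_smul, I.star_inner]

/-- The inner product as a continuous sesquilinear map. -/
noncomputable def innerSL : V →L⋆[ℂ] V →L[ℂ] A :=
  LinearMap.mkContinuous₂ (LinearMap.mk₂'ₛₗ (starRingEnd ℂ) (RingHom.id ℂ) I.inner
    I.inner_add_left (fun z x y => I.inner_smul_left x y z) I.inner_add_right
    (fun z x y => I.inner_smul_right x y z)) 1 fun x y => by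
      rw [one_mul]; exact I.norm_inner_le x y

theorem innerSL_apply (x y : V) : I.innerSL x y = I.inner x y := rfl

theorem continuous_inner : Continuous fun p : V × V => I.inner p.1 p.2 :=
  (I.innerSL.continuous.comp continuous_fst).clm_apply continuous_snd

open UniformSpace in
-- The inner product is extended merely as a continuous biadditive map, so conjugate linearity in
-- the first variable plays no role here.
theorem exists_completion : ∃ J : Completion V → Completion V → A,
    (Continuous fun p : Completion V × Completion V => J p.1 p.2) ∧
      ∀ x y : V, J x y = I.inner x y := by
  let φ : V →+ V →+ A :=
    { toFun := fun x => (I.innerSL x : V →ₗ[ℂ] A).toAddMonoidHom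
      map_zero' := by ext y; simp
      map_add' := fun x y => by ext z; simp }
  have hφ : Continuous fun p : V × V => φ p.1 p.2 := I.continuous_inner
  have hd := Completion.isDenseInducing_toCompl V
  exact ⟨fun x y => ((hd.prodMap hd).extend fun p : V × V => φ p.1 p.2) (x, y),
    hd.extend_Z_bilin hd hφ, fun x y => (hd.prodMap hd).extend_eq hφ (x, y)⟩

open UniformSpace in
/-- The inner product extends to the completion. -/
theorem exists_cstarInner_completion : ∃ I' : CStarInner A (Completion V),
    ∀ x y : V, I'.inner x y = I.inner x y := by
  obtain ⟨J, hJ, hJc⟩ := I.exists_completion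
  have hJ' {Z : Type _} [TopologicalSpace Z] {f g : Z → Completion V} (hf : Continuous f)
      (hg : Continuous g) : Continuous fun z => J (f z) (g z) := hJ.comp (hf.prodMk hg)
  refine ⟨
  { inner := J
    inner_add_right := fun x y z => ?_
    inner_smul_right := fun x y z => ?_
    star_inner := fun x y => ?_
    inner_self_nonneg := fun x => ?_
    norm_sq_eq := fun x => ?_
    norm_inner_le := fun x y => ?_ }, hJc⟩
  · refine Completion.induction_on₃ x y z ?_ fun x y z => ?_
    · exact isClosed_eq
        (hJ' (f := fun p : _ × _ × _ => p.1) (g := fun p => p.2.1 + p.2.2)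
          (by fun_prop) (by fun_prop))
        ((hJ.comp (f := fun p : _ × _ × _ => (p.1, p.2.1)) (by fun_prop)).add
          (hJ.comp (f := fun p : _ × _ × _ => (p.1, p.2.2)) (by fun_prop)))
    · rw [← Completion.coe_add, hJc, hJc, hJc, I.inner_add_right]
  · refine Completion.induction_on₂ x y ?_ fun x y => ?_
    · have hs : Continuous fun w : Completion V => z • w := continuous_const_smul z
      exact isClosed_eq (hJ' continuous_fst (hs.comp continuous_snd)) (hJ.const_smul z)
    · rw [← Completion.coe_smul, hJc, hJc, I.inner_smul_right]
  · refine Completion.induction_on₂ x y ?_ fun x y => ?_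
    · exact isClosed_eq hJ.star (hJ.comp continuous_swap)
    · rw [hJc, hJc, I.star_inner]
  · refine Completion.induction_on x ?_ fun x => ?_
    · exact (isClosed_star_mul_self A).preimage (f := fun x => J x x)
        (hJ' continuous_id continuous_id)
    · rw [hJc]
      exact I.inner_self_nonneg x
  · refine Completion.induction_on x ?_ fun x => ?_
    · exact isClosed_eq (by fun_prop) (hJ' continuous_id continuous_id).norm
    · rw [hJc, Completion.norm_coe, I.norm_sq_eq]
  · refine Completion.induction_on₂ x y ?_ fun x y => ?_
    · exact isClosed_le hJ.norm (by fun_prop)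
    · rw [hJc, Completion.norm_coe, Completion.norm_coe]
      exact I.norm_inner_le x y

/-- The map `y ↦ ⟨·, y⟩`, as an isometry. -/
noncomputable def toDual : V →ₗᵢ[ℂ] V →L⋆[ℂ] A where
  toLinearMap := I.innerSL.flip
  norm_map' y := by
    refine le_antisymm (ContinuousLinearMap.opNorm_le_bound _ (norm_nonneg _) fun x => ?_) ?_
    · rw [mul_comm]
      exact I.norm_inner_le x y
    · rcases (norm_nonneg y).eq_or_lt with h | h
      · rw [← h]
        exact norm_nonneg _
      -- Testing the functional at `y` itself gives `‖y‖²`, hence the lower bound for its norm.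
      · have h1 := (I.innerSL.flip y).le_opNorm y
        rw [ContinuousLinearMap.flip_apply, innerSL_apply, ← I.norm_sq_eq, sq] at h1
        exact le_of_mul_le_mul_right h1 h

theorem ext_inner_left {y z : V} (h : ∀ x, I.inner x y = I.inner x z) : y = z :=
  I.toDual.injective (ContinuousLinearMap.ext h)

/-- A complete space with an inner product is a Hilbert module as soon as a dense set of products
`y · a` exists. -/
theorem exists_hilbertModule [CompleteSpace V] {D : Set V} (hD : Dense D) {R : Set A}
    (hR : Dense R) (h : ∀ y ∈ D, ∀ a ∈ R, ∃ z, ∀ x, I.inner x z = I.inner x y * a) :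
    ∃ 𝓕 : HilbertModule A V, 𝓕.inner = I.inner := by
  -- `P (y, a)` is the functional `x ↦ ⟨x, y⟩ a`. It depends continuously on `(y, a)`, and the range
  -- of the isometry `toDual` is closed because `V` is complete. So representability on the dense
  -- set `D ×ˢ R` extends to all pairs.
  let P : V × A → V →L⋆[ℂ] A := fun p =>
    ((ContinuousLinearMap.mul ℂ A).flip p.2).comp (I.toDual p.1)
  have h1 : Continuous fun p : V × A => (ContinuousLinearMap.mul ℂ A).flip p.2 :=
    (ContinuousLinearMap.mul ℂ A).flip.continuous.comp continuous_snd
  have h2 : Continuous fun p : V × A => I.toDual p.1 := I.toDual.continuous.comp continuous_fst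
  have hP : Continuous P :=
    ((ContinuousLinearMap.compSL V A A (starRingEnd ℂ) (RingHom.id ℂ)).continuous.comp
      h1).clm_apply h2
  have hcl : IsClosed (P ⁻¹' Set.range I.toDual) :=
    I.toDual.isometry.isClosedEmbedding.isClosed_range.preimage hP
  have hall : ∀ p, p ∈ P ⁻¹' Set.range I.toDual := by
    intro p
    refine hcl.closure_subset_iff.2 ?_ (hD.prod hR p)
    rintro ⟨y, a⟩ ⟨hy, ha⟩
    obtain ⟨z, hz⟩ := h y hy a ha
    exact ⟨z, ContinuousLinearMap.ext hz⟩
  have hex : ∀ (y : V) (a : A), ∃ z, ∀ x, I.inner x z = I.inner x y * a := by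
    intro y a
    obtain ⟨z, hz⟩ := hall (y, a)
    exact ⟨z, fun x => congrArg (fun T : V →L⋆[ℂ] A => T x) hz⟩
  choose m hm using hex
  -- A vector is determined by its inner products, so each module axiom reduces to an identity in
  -- `A`.
  refine ⟨{ I with
    rsmul := m
    inner_rsmul_right := fun x y a => hm y a x
    add_rsmul := fun x y a => I.ext_inner_left fun w => ?_
    rsmul_add := fun x a b => I.ext_inner_left fun w => ?_
    rsmul_mul := fun x a b => I.ext_inner_left fun w => ?_
    smul_rsmul := fun z x a => I.ext_inner_left fun w => ?_
    rsmul_smul := fun z x a => I.ext_inner_left fun w => ?_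
    complete := inferInstance }, rfl⟩
  · rw [hm, I.inner_add_right, I.inner_add_right, hm, hm, add_mul]
  · rw [hm, I.inner_add_right, hm, hm, mul_add]
  · rw [hm, hm, hm, mul_assoc]
  · rw [hm, I.inner_smul_right, I.inner_smul_right, hm, smul_mul_assoc]
  · rw [hm, I.inner_smul_right, hm, mul_smul_comm]

end CStarInner

/-- The Cauchy–Schwarz inequality for a pre-inner product for which multiplication by the values
of the inner product makes sense. -/
theorem norm_inner_sq_le_of_rsmul {A V : Type*} [NonUnitalCStarAlgebra A] [AddCommGroup V]
    [Module ℂ V] (ip : V → V → A) (hadd : ∀ x y z, ip x (y + z) = ip x y + ip x z)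
    (hsmul : ∀ (x y) (z : ℂ), ip x (z • y) = z • ip x y) (hstar : ∀ x y, star (ip x y) = ip y x)
    (hpos : ∀ x, ∃ b, ip x x = star b * b) (hdef : ∀ x, ip x x = 0 → x = 0)
    (hrs : ∀ x y, ∃ z, ∀ w, ip w z = ip w y * ip y x) (x y : V) :
    ‖ip x y‖ ^ 2 ≤ ‖ip x x‖ * ‖ip y y‖ := by
  let : PartialOrder A := CStarAlgebra.spectralOrder A
  have : StarOrderedRing A := CStarAlgebra.spectralOrderedRing A
  have hadd' : ∀ x y z, ip (x + y) z = ip x z + ip y z := fun x y z => by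
    rw [← hstar, hadd, star_add, hstar, hstar]
  have hsmul' : ∀ (x y) (z : ℂ), ip (z • x) y = star z • ip x y := fun x y z => by
    rw [← hstar, hsmul, star_smul, hstar]
  have hxy : ‖ip x y‖ = ‖ip y x‖ := by rw [← hstar, norm_star]
  by_cases hN : ip y y = 0
  · have h0 : ip x (0 : V) = 0 := by simpa using hsmul x 0 0
    rw [hdef y hN, h0]
    simp only [norm_zero, ne_eq, OfNat.ofNat_ne_zero, not_false_eq_true, zero_pow]
    positivity
  have hN' : 0 < ‖ip y y‖ := norm_pos_iff.2 hN
  -- `z` plays the role of `y · ⟨y, x⟩`. The inequality comes from positivity of `⟨x - t z, x - t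
  -- z⟩` with `t = ‖⟨y, y⟩‖⁻¹`.
  obtain ⟨z, hz⟩ := hrs x y
  set a := ip y x with ha
  have hxa : ip x y = star a := by rw [ha, hstar]
  have hzx : ip z x = star a * a := by rw [← hstar, hz, hxa, star_mul, star_star]
  have hxz : ip x z = star a * a := by rw [hz, hxa]
  have hzz : ip z z = star a * ip y y * a := by
    have h1 : ip z y = star a * ip y y := by rw [← hstar, hz, star_mul, hstar y y]
    rw [hz, h1]
  set t : ℝ := ‖ip y y‖⁻¹ with ht
  have hp : 0 ≤ ip (x + (-(t : ℂ)) • z) (x + (-(t : ℂ)) • z) :=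
    CStarAlgebra.nonneg_iff_eq_star_mul_self.2 (hpos _)
  have hexp : ip (x + (-(t : ℂ)) • z) (x + (-(t : ℂ)) • z) =
      ip x x - (2 * t) • (star a * a) + (t ^ 2) • (star a * ip y y * a) := by
    rw [hadd, hadd', hadd', hsmul, hsmul, hsmul', hsmul', hxz, hzx, hzz]
    simp only [star_neg, Complex.star_def, Complex.conj_ofReal, neg_smul, smul_neg, neg_neg,
      Complex.coe_smul, smul_smul, two_mul, add_smul, sq]
    abel
  -- Bounding `⟨y, y⟩` by its norm turns the quadratic term into at most `t a^* a`, so that `t a^* a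
  -- ≤ ⟨x, x⟩` remains.
  have hle : star a * ip y y * a ≤ ‖ip y y‖ • (star a * a) :=
    CStarAlgebra.star_left_conjugate_le_norm_smul (hb := by
      rw [IsSelfAdjoint, hstar])
  have hle2 : (t ^ 2) • (star a * ip y y * a) ≤ t • (star a * a) := by
    have h1 := smul_le_smul_of_nonneg_left hle (sq_nonneg t)
    have h2 : t ^ 2 * ‖ip y y‖ = t := by
      rw [ht]
      field_simp
    rwa [smul_smul, h2] at h1
  have hle3 : t • (star a * a) ≤ ip x x := by
    rw [hexp] at hp
    have h2 := hp.trans (add_le_add_right hle2 _)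
    rw [← sub_nonneg]
    convert h2 using 1
    rw [two_mul, add_smul]
    abel
  have h4 := CStarAlgebra.norm_le_norm_of_nonneg_of_le
    (smul_nonneg (inv_nonneg.2 hN'.le) (star_mul_self_nonneg a)) hle3
  rw [norm_smul, CStarRing.norm_star_mul_self, Real.norm_of_nonneg (inv_nonneg.2 hN'.le),
    inv_mul_le_iff₀ hN'] at h4
  rw [hxy, sq]
  linarith

universe uV in
/-- A pre-Hilbert module over a dense subalgebra has a completion. -/
theorem exists_hilbertModule_completion {A S : Type*} {V : Type uV} [NonUnitalCStarAlgebra A]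
    [AddCommGroup V] [Module ℂ V] (j : S → A) (hj : DenseRange j)
    (ip : V → V → A) (act : V → S → V) (hadd : ∀ x y z, ip x (y + z) = ip x y + ip x z)
    (hsmul : ∀ (x y) (z : ℂ), ip x (z • y) = z • ip x y) (hstar : ∀ x y, star (ip x y) = ip y x)
    (hpos : ∀ x, ∃ b, ip x x = star b * b) (hdef : ∀ x, ip x x = 0 → x = 0)
    (hact : ∀ x y c, ip x (act y c) = ip x y * j c) (hrange : ∀ x y, ip x y ∈ Set.range j) :
    ∃ (F : Type uV) (_ : NormedAddCommGroup F) (_ : NormedSpace ℂ F) (𝓕 : HilbertModule A F)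
      (ι : V →ₗ[ℂ] F), Function.Injective ι ∧ DenseRange ι ∧
        (∀ x y, 𝓕.inner (ι x) (ι y) = ip x y) ∧ ∀ x c, 𝓕.rsmul (ι x) (j c) = ι (act x c) := by
  -- Values of the inner product lie in the range of `j`, so the vectors `y · ⟨y, x⟩` exist before
  -- completion.
  have hcs := norm_inner_sq_le_of_rsmul ip hadd hsmul hstar hpos hdef fun x y => by
    obtain ⟨c, hc⟩ := hrange y x
    exact ⟨act y c, fun w => by rw [hact, hc]⟩
  have hcs' : ∀ x y, ‖ip x y‖ ≤ √‖ip x x‖ * √‖ip y y‖ := fun x y => by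
    rw [← Real.sqrt_mul (norm_nonneg _)]
    exact Real.le_sqrt_of_sq_le (hcs x y)
  have hadd' : ∀ x y z, ip (x + y) z = ip x z + ip y z := fun x y z => by
    rw [← hstar, hadd, star_add, hstar, hstar]
  have hsmul' : ∀ (x y) (z : ℂ), ip (z • x) y = star z • ip x y := fun x y z => by
    rw [← hstar, hsmul, star_smul, hstar]
  let : Norm V := ⟨fun x => √‖ip x x‖⟩
  have hnorm : ∀ x : V, ‖x‖ ^ 2 = ‖ip x x‖ := fun x => Real.sq_sqrt (norm_nonneg _)
  have core : NormedSpace.Core ℂ V :=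
    { norm_nonneg := fun x => Real.sqrt_nonneg _
      norm_smul := fun z x => by
        change √‖ip (z • x) (z • x)‖ = ‖z‖ * √‖ip x x‖
        rw [hsmul, hsmul', smul_smul, norm_smul, norm_mul, norm_star, Real.sqrt_mul (by positivity),
          Real.sqrt_mul_self (norm_nonneg _)]
      norm_triangle := fun x y => by
        refine abs_le_of_sq_le_sq' ?_ (add_nonneg (Real.sqrt_nonneg _) (Real.sqrt_nonneg _)) |>.2
        have h0 : ‖x + y‖ ^ 2 = ‖ip x x + ip y x + (ip x y + ip y y)‖ := by
          rw [hnorm, hadd, hadd', hadd']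
        refine h0.trans_le ?_
        rw [add_sq, Real.sq_sqrt (norm_nonneg _), Real.sq_sqrt (norm_nonneg _)]
        have h1 := hcs' x y
        have h2 := hcs' y x
        have h3 := norm_add_le (ip x x + ip y x) (ip x y + ip y y)
        have h4 := norm_add_le (ip x x) (ip y x)
        have h5 := norm_add_le (ip x y) (ip y y)
        linarith [mul_comm √‖ip x x‖ √‖ip y y‖]
      norm_eq_zero_iff := fun x => by
        change √‖ip x x‖ = 0 ↔ x = 0
        rw [Real.sqrt_eq_zero (norm_nonneg _), norm_eq_zero]
        refine ⟨hdef x, ?_⟩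
        rintro rfl
        simpa using hsmul 0 0 0 }
  let : NormedAddCommGroup V := NormedAddCommGroup.ofCore core
  let : NormedSpace ℂ V := NormedSpace.ofCore core
  let I : CStarInner A V := ⟨ip, hadd, hsmul, hstar, hpos, hnorm, hcs'⟩
  obtain ⟨I', hI'⟩ := I.exists_cstarInner_completion
  let ι : V →ₗᵢ[ℂ] UniformSpace.Completion V := UniformSpace.Completion.toComplₗᵢ
  have hι : DenseRange ι := UniformSpace.Completion.denseRange_coe
  have hιip : ∀ x y, I'.inner (ι x) (ι y) = ip x y := hI'
  have hext : ∀ x c w, I'.inner w (ι (act x c)) = I'.inner w (ι x) * j c := by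
    intro x c w
    refine UniformSpace.Completion.induction_on w (isClosed_eq ?_ ?_) fun w => ?_
    · exact I'.continuous_inner.comp (continuous_id.prodMk continuous_const)
    · exact (I'.continuous_inner.comp
        (continuous_id.prodMk continuous_const)).mul continuous_const
    · exact (hιip w _).trans ((hact w x c).trans (congrArg (· * j c) (hιip w x).symm))
  obtain ⟨𝓕, h𝓕⟩ := I'.exists_hilbertModule hι hj (by
    rintro _ ⟨x, rfl⟩ _ ⟨c, rfl⟩
    exact ⟨ι (act x c), hext x c⟩)
  refine ⟨UniformSpace.Completion V, inferInstance, inferInstance, 𝓕, ι.toLinearMap,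
    ι.injective, hι, fun x y => ?_, fun x c => ?_⟩
  · rw [h𝓕]
    exact hιip x y
  · refine I'.ext_inner_left fun w => ?_
    rw [← h𝓕, 𝓕.inner_rsmul_right, h𝓕]
    exact (hext x c w).symm

end GroupoidCrossedProduct

namespace GroupoidCrossedProduct

/-! ## Representations of C⋆-algebras -/

universe uA in
open scoped ComplexOrder in
/-- Nonzero elements of a C⋆-algebra are detected by representations on Hilbert spaces. -/
theorem exists_representation_ne_zero {A : Type uA} [NonUnitalCStarAlgebra A] {a : A}
    (ha : a ≠ 0) : ∃ (K : Type uA) (_ : NormedAddCommGroup K) (_ : InnerProductSpace ℂ K)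
      (_ : CompleteSpace K) (τ : A →⋆ₙₐ[ℂ] (K →L[ℂ] K)), τ a ≠ 0 := by
  let : PartialOrder A := CStarAlgebra.spectralOrder A
  have : StarOrderedRing A := CStarAlgebra.spectralOrderedRing A
  -- Without a unit there is no canonical cyclic vector; the class of `a^*` is used instead. Then
  -- `τ(a)` sends it to the class of `b = a a^*`, of squared norm `F(b^* b) = F(e)`.
  set b := a * star a with hb
  have hb0 : b ≠ 0 := fun h => ha ((CStarRing.mul_star_self_eq_zero_iff a).1 h)
  set e := star b * b with he
  have he0 : e ≠ 0 := fun h => hb0 ((CStarRing.star_mul_self_eq_zero_iff b).1 h)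
  have hee : 0 ≤ e := star_mul_self_nonneg b
  have hconv : Convex ℝ {x : A | 0 ≤ x} := fun x hx z hz s t hs ht _ =>
    show 0 ≤ s • x + t • z from add_nonneg (smul_nonneg hs (show 0 ≤ x from hx))
      (smul_nonneg ht (show 0 ≤ z from hz))
  have hnot : -e ∉ {x : A | 0 ≤ x} := fun h =>
    he0 (le_antisymm (by simpa using h) hee)
  -- Hahn–Banach separates `-e` from the closed cone of positive elements.
  obtain ⟨f, u, hf, hu⟩ := RCLike.geometric_hahn_banach_closed_point (𝕜 := ℂ) hconv
    CStarAlgebra.isClosed_nonneg hnot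
  have hu0 : 0 < u := by simpa using hf 0 (le_refl (0 : A))
  have hfneg : ∀ x : A, 0 ≤ x → (f x).re ≤ 0 := by
    intro x hx
    by_contra! hlt
    -- On this rescaling of `x` the real part of `f` equals `u`, contradicting the strict bound by
    -- `u` on the cone.
    have h1 := hf ((u / (f x).re) • x) (smul_nonneg (div_pos hu0 hlt).le hx)
    rw [← Complex.coe_smul, map_smul, smul_eq_mul] at h1
    simp [hlt.ne'] at h1
  have hfe : (f e).re < 0 := by
    have h1 := hu0.trans hu
    rw [map_neg] at h1
    simpa using h1
  -- Minus the symmetrization of `f`: on self-adjoint elements it is `-2 Re f`, hence positive on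
  -- the cone, and strictly positive at `e`.
  let F₀ : A →ₗ[ℂ] ℂ :=
    { toFun := fun x => -(f x + star (f (star x)))
      map_add' := fun x z => by
        simp only [star_add, map_add]
        ring
      map_smul' := fun c x => by
        simp only [star_smul, map_smul, smul_eq_mul, RingHom.id_apply, star_mul', star_star]
        ring }
  have hF₀ : ∀ x : A, IsSelfAdjoint x → F₀ x = ((-2 * (f x).re : ℝ) : ℂ) := by
    intro x hx
    change -(f x + star (f (star x))) = _
    rw [hx.star_eq, Complex.star_def, Complex.add_conj]
    push_cast
    ring
  let F : A →ₚ[ℂ] ℂ := PositiveLinearMap.mk₀ F₀ fun x hx => by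
    rw [hF₀ x hx.isSelfAdjoint, Complex.zero_le_real]
    linarith [hfneg x hx]
  refine ⟨F.GNS, inferInstance, inferInstance, inferInstance, F.gnsNonUnitalStarAlgHom, ?_⟩
  intro h0
  have h1 : F.leftMulMapPreGNS a (F.toPreGNS (star a)) = F.toPreGNS b := rfl
  have h2 : ((F.toPreGNS b : F.PreGNS) : F.GNS) = 0 := by
    rw [← h1, ← F.gnsNonUnitalStarAlgHom_apply_coe, h0]
    rfl
  have h3 : ‖F.toPreGNS b‖ = 0 := by
    rw [← UniformSpace.Completion.norm_coe, h2, norm_zero]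
  have h4 := F.preGNS_norm_sq (F.toPreGNS b)
  rw [h3] at h4
  have h5 : F₀ e = 0 := by
    refine Eq.trans ?_ h4.symm |>.trans (by simp)
    rfl
  rw [hF₀ e hee.isSelfAdjoint] at h5
  have h6 : -2 * (f e).re = 0 := by exact_mod_cast h5
  linarith

/-! ## Operators given by matrices with finite rows and columns -/

section Matrix

variable {I K : Type*} [NormedAddCommGroup K] [InnerProductSpace ℂ K]

/-- Cauchy–Schwarz in each row costs a factor `N`, and each index `j` occurs in at most `N` rows,
which costs another. -/
theorem sum_norm_sq_le_of_rows_cols (T : I → I → K →L[ℂ] K) {M : ℝ}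
    (hM : ∀ i j, ‖T i j‖ ≤ M) {N : ℕ} (R : I → Finset I) (hR : ∀ i, (R i).card ≤ N)
    (hC : ∀ j, ∃ t : Finset I, t.card ≤ N ∧ ∀ i, j ∈ R i → i ∈ t)
    (x : lp (fun _ : I => K) 2) (s : Finset I) :
    ∑ i ∈ s, ‖∑ j ∈ R i, T i j (x j)‖ ^ 2 ≤ (M * N * ‖x‖) ^ 2 := by
  classical
  have h1 : ∀ i, ‖∑ j ∈ R i, T i j (x j)‖ ^ 2 ≤ N * M ^ 2 * ∑ j ∈ R i, ‖x j‖ ^ 2 := by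
    intro i
    have h2 : ‖∑ j ∈ R i, T i j (x j)‖ ≤ ∑ j ∈ R i, M * ‖x j‖ :=
      norm_sum_le_of_le _ fun j _ => (T i j).le_of_opNorm_le (hM i j) _
    calc ‖∑ j ∈ R i, T i j (x j)‖ ^ 2 ≤ (∑ j ∈ R i, M * ‖x j‖) ^ 2 := by gcongr
      _ ≤ (R i).card * ∑ j ∈ R i, (M * ‖x j‖) ^ 2 := sq_sum_le_card_mul_sum_sq
      _ ≤ N * ∑ j ∈ R i, (M * ‖x j‖) ^ 2 := by gcongr; exact_mod_cast hR i
      _ = N * M ^ 2 * ∑ j ∈ R i, ‖x j‖ ^ 2 := by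
        simp only [mul_pow]
        rw [← Finset.mul_sum, mul_assoc]
  have h3 : ∑ i ∈ s, ∑ j ∈ R i, ‖x j‖ ^ 2 ≤ N * ‖x‖ ^ 2 := by
    rw [Finset.sum_comm' (s' := fun j => s.filter fun i => j ∈ R i) (t' := s.biUnion R)
      (by intro i j; simp only [Finset.mem_filter, Finset.mem_biUnion]; tauto)]
    have h4 : ∀ j ∈ s.biUnion R, ∑ _i ∈ s.filter (fun i => j ∈ R i), ‖x j‖ ^ 2 ≤
        N * ‖x j‖ ^ 2 := by
      intro j _
      obtain ⟨t, ht, htj⟩ := hC j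
      rw [Finset.sum_const, nsmul_eq_mul]
      gcongr
      exact_mod_cast (Finset.card_le_card fun i hi =>
        htj i (Finset.mem_filter.1 hi).2).trans ht
    refine (Finset.sum_le_sum h4).trans ?_
    rw [← Finset.mul_sum]
    gcongr
    have h5 := lp.sum_rpow_le_norm_rpow (p := 2) (by simp) x (s.biUnion R)
    simpa using h5
  calc ∑ i ∈ s, ‖∑ j ∈ R i, T i j (x j)‖ ^ 2
      ≤ ∑ i ∈ s, N * M ^ 2 * ∑ j ∈ R i, ‖x j‖ ^ 2 := Finset.sum_le_sum fun i _ => h1 i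
    _ = N * M ^ 2 * ∑ i ∈ s, ∑ j ∈ R i, ‖x j‖ ^ 2 := by rw [Finset.mul_sum]
    _ ≤ N * M ^ 2 * (N * ‖x‖ ^ 2) := by gcongr
    _ = (M * N * ‖x‖) ^ 2 := by ring

/-- A matrix of operators with uniformly bounded entries, rows and columns defines a bounded
operator on the Hilbert sum. -/
theorem exists_matrixOperator (T : I → I → K →L[ℂ] K) {M : ℝ} (hM0 : 0 ≤ M)
    (hM : ∀ i j, ‖T i j‖ ≤ M) {N : ℕ}
    (hR : ∀ i, ∃ t : Finset I, t.card ≤ N ∧ ∀ j, T i j ≠ 0 → j ∈ t)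
    (hC : ∀ j, ∃ t : Finset I, t.card ≤ N ∧ ∀ i, T i j ≠ 0 → i ∈ t) :
    ∃ A : lp (fun _ : I => K) 2 →L[ℂ] lp (fun _ : I => K) 2,
      ∀ x i, A x i = ∑ᶠ j, T i j (x j) := by
  classical
  choose R' hR' hRm' using hR
  -- The row sets are cut down to the exact supports; otherwise membership `j ∈ R i` would not be
  -- controlled by the column bound.
  let R : I → Finset I := fun i => (R' i).filter fun j => T i j ≠ 0
  have hR : ∀ i, (R i).card ≤ N := fun i => (Finset.card_filter_le _ _).trans (hR' i)
  have hRm : ∀ i j, T i j ≠ 0 → j ∈ R i := fun i j h => Finset.mem_filter.2 ⟨hRm' i j h, h⟩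
  have hC' : ∀ j, ∃ t : Finset I, t.card ≤ N ∧ ∀ i, j ∈ R i → i ∈ t := fun j => by
    obtain ⟨t, ht, htj⟩ := hC j
    exact ⟨t, ht, fun i hi => htj i (Finset.mem_filter.1 hi).2⟩
  have key := sum_norm_sq_le_of_rows_cols T hM R hR hC'
  have hmem : ∀ x : lp (fun _ : I => K) 2, Memℓp (fun i => ∑ j ∈ R i, T i j (x j)) 2 := fun x =>
    memℓp_gen' (C := (M * N * ‖x‖) ^ 2) fun s => by simpa using key x s
  let A : lp (fun _ : I => K) 2 →ₗ[ℂ] lp (fun _ : I => K) 2 :=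
    { toFun := fun x => ⟨_, hmem x⟩
      map_add' := fun x z => by
        ext i
        change ∑ j ∈ R i, T i j (x j + z j) = ∑ j ∈ R i, T i j (x j) + ∑ j ∈ R i, T i j (z j)
        simp only [map_add, Finset.sum_add_distrib]
      map_smul' := fun c x => by
        ext i
        change ∑ j ∈ R i, T i j (c • x j) = c • ∑ j ∈ R i, T i j (x j)
        simp only [map_smul, Finset.smul_sum] }
  refine ⟨A.mkContinuous (M * N) fun x => ?_, fun x i => ?_⟩
  · refine lp.norm_le_of_forall_sum_le (by simp) (by positivity) fun s => ?_
    change ∑ i ∈ s, ‖∑ j ∈ R i, T i j (x j)‖ ^ (2 : ℝ≥0∞).toReal ≤ _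
    simpa using key x s
  · change ∑ j ∈ R i, T i j (x j) = _
    refine (finsum_eq_sum_of_support_subset _ fun j hj => hRm i j fun h => hj ?_).symm
    change T i j (x j) = 0
    rw [h]
    rfl

open Classical in
theorem matrixOperator_single {T : I → I → K →L[ℂ] K}
    {A : lp (fun _ : I => K) 2 →L[ℂ] lp (fun _ : I => K) 2}
    (hA : ∀ x i, A x i = ∑ᶠ j, T i j (x j)) (j : I) (w : K) (i : I) :
    A (lp.single 2 j w) i = T i j w := by
  rw [hA, finsum_eq_single _ j, lp.single_apply_self]
  intro k hk
  rw [lp.single_apply_ne _ _ _ hk, map_zero]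

open Classical in
theorem lp_clm_ext {A B : lp (fun _ : I => K) 2 →L[ℂ] lp (fun _ : I => K) 2}
    (h : ∀ j w i, A (lp.single 2 j w) i = B (lp.single 2 j w) i) : A = B := by
  ext1 x
  have hx := lp.hasSum_single (p := 2) (by simp) x
  refine (hx.mapL A).unique ?_
  have h1 : (fun i => A (lp.single 2 i (x i))) = fun i => B (lp.single 2 i (x i)) :=
    funext fun i => lp.ext (funext fun k => h i _ k)
  rw [h1]
  exact hx.mapL B

/-- The adjoint of a matrix operator is given by the adjoint matrix. -/
theorem matrixOperator_eq_star [CompleteSpace K] {T S : I → I → K →L[ℂ] K}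
    {A B : lp (fun _ : I => K) 2 →L[ℂ] lp (fun _ : I => K) 2}
    (hA : ∀ x i, A x i = ∑ᶠ j, T i j (x j)) (hB : ∀ x i, B x i = ∑ᶠ j, S i j (x j))
    (h : ∀ i j, S i j = star (T j i)) : B = star A := by
  classical
  refine lp_clm_ext fun j w i => ext_inner_left ℂ fun v => ?_
  have h1 : inner ℂ v (star A (lp.single 2 j w) i) =
      inner ℂ (A (lp.single 2 i v)) (lp.single 2 j w) := by
    rw [ContinuousLinearMap.star_eq_adjoint, ← ContinuousLinearMap.adjoint_inner_right]
    exact (lp.inner_single_left (G := fun _ : I => K) i v _).symm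
  rw [matrixOperator_single hB, h]
  refine Eq.trans ?_ h1.symm
  refine Eq.trans ?_ (lp.inner_single_right (G := fun _ : I => K) j w _).symm
  rw [matrixOperator_single hA, ContinuousLinearMap.star_eq_adjoint,
    ContinuousLinearMap.adjoint_inner_right]

end Matrix

/-! ## Regular representations -/

namespace CStarAction

variable {H : Type uH} [TopologicalSpace H] [T2Space H] {G : EtaleGroupoid H}
  {C : Type uC} [NonUnitalCStarAlgebra C] {𝒞 : C0Algebra G.units C} (α : CStarAction G 𝒞)
  {y : G.units}

theorem s_eq_r_inv (g k : {h : H // G.s h = y}) : G.s g.1 = G.r (G.inv k.1) :=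
  g.2.trans ((G.r_inv k.1).trans k.2).symm

/-- The matrix entries `k⁻¹ · a(g k⁻¹)` of the regular representation at the unit `y`. -/
noncomputable def regularEntry (a : ∀ g, Fibre 𝒞.orbit (G.s g)) (g k : {h : H // G.s h = y}) :
    Fibre 𝒞.orbit y :=
  α.act (G.inv k.1) (G.s_mul g.1 (G.inv k.1) (s_eq_r_inv g k)).symm ((G.r_inv k.1).trans k.2)
    (a (G.mul g.1 (G.inv k.1) (s_eq_r_inv g k)))

theorem regularEntry_add (a b : ∀ g, Fibre 𝒞.orbit (G.s g)) (g k : {h : H // G.s h = y}) :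
    α.regularEntry (a + b) g k = α.regularEntry a g k + α.regularEntry b g k :=
  map_add _ _ _

theorem regularEntry_smul (z : ℂ) (a : ∀ g, Fibre 𝒞.orbit (G.s g)) (g k : {h : H // G.s h = y}) :
    α.regularEntry (z • a) g k = z • α.regularEntry a g k :=
  (α.act _ _ _).map_smul _ _

theorem norm_regularEntry (a : ∀ g, Fibre 𝒞.orbit (G.s g)) (g k : {h : H // G.s h = y}) :
    ‖α.regularEntry a g k‖ = ‖a (G.mul g.1 (G.inv k.1) (s_eq_r_inv g k))‖ :=
  α.norm_act _ _ _ _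

theorem regularEntry_invol (a : ∀ g, Fibre 𝒞.orbit (G.s g)) (g k : {h : H // G.s h = y}) :
    α.regularEntry (α.invol a) g k = 𝒞.fibreStar y (α.regularEntry a k g) := by
  have h1 : G.inv (G.mul g.1 (G.inv k.1) (s_eq_r_inv g k)) =
      G.mul k.1 (G.inv g.1) (s_eq_r_inv k g) := by
    rw [G.inv_mul_rev]
    exact G.mul_congr (G.inv_inv _) rfl _
  have h2 : G.mul (G.inv k.1) (G.inv (G.mul g.1 (G.inv k.1) (s_eq_r_inv g k)))
      ((G.s_inv _).trans (((G.r_inv _).trans (G.s_mul _ _ _)).trans (G.s_inv _)).symm) =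
      G.inv g.1 := by
    rw [G.mul_congr rfl h1]
    exact G.inv_mul_mul _ _ _
  unfold regularEntry invol
  rw [α.act_act _ _ _ _ h2, α.act_fibreStar]
  congr 1
  exact α.act_section_congr a h1 _ _

/-- Convolution becomes matrix multiplication under `h = k l⁻¹`: then `g k⁻¹ h = g l⁻¹`, `h⁻¹ = l
k⁻¹`, and the actions of `k⁻¹` and `h` compose to that of `l⁻¹`. -/
theorem regularEntry_conv {a b : ∀ g, Fibre 𝒞.orbit (G.s g)} (g k : {h : H // G.s h = y}) :
    α.regularEntry (α.conv a b) g k =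
      ∑ᶠ l, 𝒞.fibreMul y (α.regularEntry a g l) (α.regularEntry b l k) := by
  let φ : {h : H // G.s h = y} →
      {h : H // G.r h = G.s (G.mul g.1 (G.inv k.1) (s_eq_r_inv g k))} := fun l =>
    ⟨G.mul k.1 (G.inv l.1) (s_eq_r_inv k l),
      (G.r_mul _ _ _).trans ((G.s_mul _ _ _).trans (G.s_inv _)).symm⟩
  have hφ : Function.Bijective φ := by
    constructor
    · intro l l' h
      have h' : G.mul k.1 (G.inv l.1) _ = G.mul k.1 (G.inv l'.1) _ := congrArg Subtype.val h
      apply Subtype.ext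
      apply G.inv_injective
      rw [← G.inv_mul_mul k.1 (G.inv l.1) (s_eq_r_inv k l), G.mul_congr rfl h', G.inv_mul_mul]
    · rintro ⟨h, hh⟩
      have e : G.r h = G.r k.1 := hh.trans ((G.s_mul _ _ _).trans (G.s_inv _))
      refine ⟨⟨G.mul (G.inv h) k.1 ((G.s_inv h).trans e), (G.s_mul _ _ _).trans k.2⟩, ?_⟩
      apply Subtype.ext
      change G.mul k.1 (G.inv (G.mul (G.inv h) k.1 _)) _ = h
      rw [G.mul_congr rfl (G.inv_mul_rev _ _ _), G.mul_inv_mul_cancel]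
      exact G.inv_inv h
  let T : Fibre 𝒞.orbit (G.s (G.mul g.1 (G.inv k.1) (s_eq_r_inv g k))) →+ Fibre 𝒞.orbit y :=
    { toFun := α.act (G.inv k.1) (G.s_mul g.1 (G.inv k.1) (s_eq_r_inv g k)).symm
        ((G.r_inv k.1).trans k.2)
      map_zero' := map_zero _
      map_add' := map_add _ }
  have hT : Function.Injective T := LinearIsometryEquiv.injective _
  change T (α.conv a b _) = _
  unfold conv
  rw [T.map_finsum_of_injective hT]
  refine (finsum_eq_of_bijective φ hφ fun l => ?_).symm
  change _ = α.act (G.inv k.1) _ _ (𝒞.fibreMul _ _ _)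
  rw [α.act_fibreMul]
  refine Eq.symm (congrArg₂ (fun x z => 𝒞.fibreMul y x z) ?_ ?_)
  · rw [α.act_act _ _ _ _ (G.inv_mul_mul _ _ _)]
    refine α.act_section_congr a ?_ _ _
    rw [G.mul_assoc _ _ _ (s_eq_r_inv g k) ((G.s_inv _).trans (G.r_mul _ _ _).symm)]
    exact G.mul_congr rfl (G.inv_mul_mul _ _ _) _
  · rw [α.act_cast]
    refine α.act_section_congr b ?_ _ _
    change G.inv (G.mul k.1 (G.inv l.1) _) = _
    rw [G.inv_mul_rev]
    exact G.mul_congr (G.inv_inv _) rfl _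

/-- The column indexed by the unit `y` lists the values of the section, so the matrix determines `a`
on `s⁻¹(y)`. -/
theorem regularEntry_unit (a : ∀ g, Fibre 𝒞.orbit (G.s g)) (g : {h : H // G.s h = y}) :
    α.regularEntry a g ⟨y, G.s_unit y⟩ = Fibre.cast g.2 (a g.1) := by
  unfold regularEntry
  rw [α.act_unit' (G.inv_mem_units_iff.2 y.2)]
  exact Fibre.cast_section a ((G.mul_congr rfl (G.inv_unit y) _).trans (G.mul_unit' _ _ _)) _ _

/-- The entry at `(g, k)` is nonzero only if `g k⁻¹` lies in the support of `a`. Along row `g` these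
points share the range `r g`, along column `k` the source `r k`; fibres of `r` and `s` meet a
compact set in boundedly many points. -/
theorem exists_card_regularEntry_le {a : ∀ g, Fibre 𝒞.orbit (G.s g)} (ha : a ∈ α.Sections)
    (y : G.units) : ∃ N : ℕ,
      (∀ g : {h : H // G.s h = y}, ∃ t : Finset {h : H // G.s h = y}, t.card ≤ N ∧
        ∀ k, α.regularEntry a g k ≠ 0 → k ∈ t) ∧
      ∀ k : {h : H // G.s h = y}, ∃ t : Finset {h : H // G.s h = y}, t.card ≤ N ∧
        ∀ g, α.regularEntry a g k ≠ 0 → g ∈ t := by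
  classical
  obtain ⟨N₁, hN₁⟩ := exists_forall_card_le G.isLocalHomeomorph_r ha.2
  obtain ⟨N₂, hN₂⟩ := exists_forall_card_le G.isLocalHomeomorph_s ha.2
  have hmem : ∀ g k : {h : H // G.s h = y}, α.regularEntry a g k ≠ 0 →
      G.mul g.1 (G.inv k.1) (s_eq_r_inv g k) ∈ closure {g | a g ≠ 0} := fun g k h =>
    subset_closure fun h0 => h ((α.act_eq_zero _ _ _ _).2 h0)
  have hfin : ∀ {P : {h : H // G.s h = y} → Prop} {N : ℕ} (f : {h : H // G.s h = y} → H),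
      Function.Injective f → (∀ s : Finset H, (∀ w ∈ s, ∃ k, P k ∧ f k = w) → s.card ≤ N) →
      ∃ t : Finset {h : H // G.s h = y}, t.card ≤ N ∧ ∀ k, P k → k ∈ t := by
    intro P N f hf hs
    have hcard : ∀ t : Finset {h : H // G.s h = y}, (∀ k ∈ t, P k) → t.card ≤ N := fun t ht => by
      rw [← Finset.card_image_of_injective t hf]
      refine hs _ fun w hw => ?_
      obtain ⟨k, hk, rfl⟩ := Finset.mem_image.1 hw
      exact ⟨k, ht k hk, rfl⟩
    have hPf : {k | P k}.Finite := by
      by_contra h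
      obtain ⟨t, ht, hc⟩ := Set.Infinite.exists_subset_card_eq h (N + 1)
      have := hcard t fun k hk => ht hk
      omega
    exact ⟨hPf.toFinset, hcard _ fun k hk => hPf.mem_toFinset.1 hk,
      fun k hk => hPf.mem_toFinset.2 hk⟩
  refine ⟨max N₁ N₂, fun g => ?_, fun k => ?_⟩
  · refine hfin (fun k => G.mul g.1 (G.inv k.1) (s_eq_r_inv g k)) (fun k k' h => ?_) fun s hs => ?_
    · apply Subtype.ext
      apply G.inv_injective
      rw [← G.inv_mul_mul g.1 (G.inv k.1) (s_eq_r_inv g k), G.mul_congr rfl h, G.inv_mul_mul]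
    · refine (hN₁ (G.r g.1) s fun w hw => ?_).trans (le_max_left _ _)
      obtain ⟨k, hk, rfl⟩ := hs w hw
      exact ⟨hmem g k hk, G.r_mul _ _ _⟩
  · refine hfin (fun g => G.mul g.1 (G.inv k.1) (s_eq_r_inv g k)) (fun g g' h => ?_) fun s hs => ?_
    · exact Subtype.ext (G.mul_left_injective h)
    · refine (hN₂ (G.r k.1) s fun w hw => ?_).trans (le_max_right _ _)
      obtain ⟨g, hg, rfl⟩ := hs w hw
      exact ⟨hmem g k hg, (G.s_mul _ _ _).trans (G.s_inv _)⟩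

/-- The regular representation at the unit `y` induced by a representation of the fibre `C_y`. -/
theorem exists_regularRepresentation {K : Type uC} [NormedAddCommGroup K]
    [InnerProductSpace ℂ K] [CompleteSpace K] (τ : 𝒞.FibreAlgebra y →⋆ₙₐ[ℂ] (K →L[ℂ] K)) :
    ∃ R : α.Representation, ∀ a : α.Sections, R.π a = 0 → ∀ g k : {h : H // G.s h = y},
      τ (𝒞.toFibreAlgebra y (α.regularEntry a.1 g k)) = 0 := by
  classical
  let T : α.Sections → {h : H // G.s h = y} → {h : H // G.s h = y} → K →L[ℂ] K :=
    fun a g k => τ (𝒞.toFibreAlgebra y (α.regularEntry a.1 g k))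
  have hT0 : ∀ a g k, T a g k ≠ 0 → α.regularEntry a.1 g k ≠ 0 := fun a g k h h0 => h (by
    simp only [T, h0, map_zero])
  have hex : ∀ a : α.Sections, ∃ A : lp (fun _ : {h : H // G.s h = y} => K) 2 →L[ℂ]
      lp (fun _ : {h : H // G.s h = y} => K) 2, ∀ x i, A x i = ∑ᶠ j, T a i j (x j) := by
    intro a
    obtain ⟨M, hM0, hM⟩ := exists_norm_le_of_mem_compactSections 𝒞.orbit a.2
    obtain ⟨N, hR, hC⟩ := α.exists_card_regularEntry_le a.2 y
    refine exists_matrixOperator (T a) hM0 (fun g k => ?_) (N := N) (fun g => ?_) fun k => ?_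
    · refine (NonUnitalStarAlgHom.norm_apply_le τ _).trans ?_
      rw [𝒞.norm_toFibreAlgebra, α.norm_regularEntry]
      exact hM _
    · obtain ⟨t, ht, h⟩ := hR g
      exact ⟨t, ht, fun k hk => h k (hT0 a g k hk)⟩
    · obtain ⟨t, ht, h⟩ := hC k
      exact ⟨t, ht, fun g hg => h g (hT0 a g k hg)⟩
  choose A hA using hex
  have hsingle := fun a => matrixOperator_single (hA a)
  refine ⟨
    { K := lp (fun _ : {h : H // G.s h = y} => K) 2
      π :=
        { toFun := A
          map_add' := fun a b => lp_clm_ext fun j w i => ?_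
          map_smul' := fun z a => lp_clm_ext fun j w i => ?_ }
      map_conv := fun a b c hc => lp_clm_ext fun j w i => ?_
      map_invol := fun a b hb => matrixOperator_eq_star (hA a) (hA b) fun i j => ?_ }, ?_⟩
  · rw [_root_.add_apply, lp.coeFn_add, Pi.add_apply, hsingle, hsingle, hsingle, ← _root_.add_apply]
    simp only [T, Submodule.coe_add, regularEntry_add, map_add]
  · rw [RingHom.id_apply, _root_.smul_apply, lp.coeFn_smul, Pi.smul_apply, hsingle, hsingle, ← _root_.smul_apply]
    simp only [T, Submodule.coe_smul, regularEntry_smul, map_smul]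
  · change A c _ i = A a (A b _) i
    rw [hsingle, hA]
    simp only [hsingle]
    obtain ⟨N, -, hC⟩ := α.exists_card_regularEntry_le b.2 y
    -- Column `j` of `b` has finitely many nonzero entries, so the matrix product and the
    -- composition of operators are both sums over `t`.
    obtain ⟨t, -, ht⟩ := hC j
    have h1 : α.regularEntry c.1 i j =
        ∑ l ∈ t, 𝒞.fibreMul y (α.regularEntry a.1 i l) (α.regularEntry b.1 l j) := by
      rw [show c.1 = α.conv a.1 b.1 from funext hc, regularEntry_conv]
      refine finsum_eq_sum_of_support_subset _ fun l hl => ht l fun h0 => hl ?_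
      simp [h0]
    rw [finsum_eq_sum_of_support_subset (s := t)]
    · simp only [T, h1, map_sum, 𝒞.toFibreAlgebra_fibreMul, map_mul]
      rw [_root_.sum_apply]
      rfl
    · refine fun l hl => ht l (hT0 b l j fun h0 => hl ?_)
      simp [h0]
  · simp only [T]
    rw [show b.1 = α.invol a.1 from funext hb, regularEntry_invol, 𝒞.toFibreAlgebra_fibreStar,
      map_star]
  · intro a ha g k
    change T a g k = 0
    ext w
    rw [← hsingle]
    change A a = 0 at ha
    rw [ha]
    rfl

/-- If `a(g) ≠ 0`, some representation `τ` of `C_{s g}` does not kill `a(g)`, and `τ(a(g))` is the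
matrix entry at `(g, s g)` of the regular representation that `τ` induces. -/
theorem canonicalMap_injective : Function.Injective α.canonicalMap := by
  refine (injective_iff_map_eq_zero _).2 fun a ha => ?_
  ext g
  by_contra hg
  have h1 : 𝒞.toFibreAlgebra (G.s g) (a.1 g) ≠ 0 := (map_ne_zero_iff _ (LinearEquiv.injective _)).2 hg
  obtain ⟨K, _, _, _, τ, hτ⟩ := exists_representation_ne_zero h1
  obtain ⟨R, hR⟩ := α.exists_regularRepresentation τ
  refine hτ ?_
  have h2 := hR a (by
    rw [← α.isCanonicalMap_canonicalMap a R, ha]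
    rfl) ⟨g, rfl⟩ ⟨G.s g, G.s_unit _⟩
  rwa [regularEntry_unit] at h2

theorem exists_canonicalMap_eq_star_mul_self {n : ℕ} {m : Fin n → ℕ} (a : α.Sections)
    (b : ∀ i, Fin (m i) → α.Sections)
    (h : a.1 = ∑ i, ∑ p, α.conv (α.invol (b i p).1) (b i p).1) :
    ∃ T : α.CrossedProduct, α.canonicalMap a = star T * T := by
  have h1 : a = ∑ i, ∑ p,
      ⟨α.conv (α.invol (b i p).1) (b i p).1, α.conv_mem (α.invol_mem (b i p).2) (b i p).2⟩ := by
    refine Subtype.ext (h.trans ?_)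
    simp only [Submodule.coe_sum]
  rw [h1, map_sum]
  refine exists_sum_star_mul_self (A := α.CrossedProduct) _ fun i _ => ?_
  rw [map_sum]
  refine exists_sum_star_mul_self (A := α.CrossedProduct) _ fun p _ => ⟨α.canonicalMap (b i p), ?_⟩
  exact (α.canonicalMap_conv ⟨_, α.invol_mem (b i p).2⟩ (b i p)).trans
    (congrArg (· * α.canonicalMap (b i p)) (α.canonicalMap_invol (b i p)))

end CStarAction

/-! ### Definiteness of the inner product on sections -/

namespace HilbertAction

variable {H : Type uH} [TopologicalSpace H] [T2Space H] {G : EtaleGroupoid H}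
  {C : Type uC} [NonUnitalCStarAlgebra C] {𝒞 : C0Algebra G.units C} {α : CStarAction G 𝒞}
  {E : Type uE} [NormedAddCommGroup E] [NormedSpace ℂ E] {𝓔 : HilbertModule C E}
  {Ω : Type uΩ} [TopologicalSpace Ω] (β : HilbertAction α 𝓔) (ρ : RightSpaceAction G Ω)

/-- A unit acts trivially on `Ω` and on the fibres, so the diagonal terms `⟨ξ(ω), ξ(ω)⟩` are what
remains. -/
theorem sectionInner_self_unit (ξ : ∀ ω, Fibre (𝓔.orbit 𝒞) (ρ.σ ω)) (y : G.units) :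
    β.sectionInner ρ ξ ξ y = ∑ᶠ ω : {ω : Ω // ρ.σ ω = y},
      𝓔.fibreInner 𝒞 (G.s y) (Fibre.cast (ω.2.trans (G.s_unit y).symm) (ξ ω.1))
        (Fibre.cast (ω.2.trans (G.s_unit y).symm) (ξ ω.1)) := by
  rw [β.sectionInner_eq ρ ξ ξ y (G.r_unit y)]
  refine finsum_congr fun ω => ?_
  congr 1
  · rw [β.act_unit' (G.inv_mem_units_iff.2 y.2)]
  · exact Fibre.cast_section ξ (ρ.act_unit' ω.1 y _) _ _

/-- The inner product is definite. -/
theorem eq_zero_of_sectionInner_self (hetale : ρ.IsEtale) {ξ : ∀ ω, Fibre (𝓔.orbit 𝒞) (ρ.σ ω)}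
    (hξ : ξ ∈ β.Sections ρ) (h : β.sectionInner ρ ξ ξ = 0) : ξ = 0 := by
  funext ω
  by_contra hω
  have h1 := congrFun h (ρ.σ ω : H)
  rw [β.sectionInner_self_unit ρ ξ] at h1
  have hfin := β.finite_support_fibre ρ hetale hξ (ρ.σ ω)
  rw [finsum_eq_sum_of_support_subset (s := hfin.toFinset)] at h1
  · choose b hb using fun ω' : {ω' : Ω // ρ.σ ω' = ρ.σ ω} =>
      𝓔.exists_fibreInner_self_eq 𝒞 _ (Fibre.cast (ω'.2.trans (G.s_unit _).symm) (ξ ω'.1))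
    have h2 := fun ω' => congrArg (𝒞.toFibreAlgebra _) (hb ω')
    simp only [𝒞.toFibreAlgebra_fibreMul, 𝒞.toFibreAlgebra_fibreStar] at h2
    have h3 := congrArg (𝒞.toFibreAlgebra _) h1
    rw [map_sum, Finset.sum_congr rfl fun ω' _ => h2 ω', Pi.zero_apply, map_zero] at h3
    -- A vanishing finite sum of elements `b^* b` in the C⋆-algebra of the fibre has only zero
    -- terms; the extra summand of the lemma is taken to be `0`.
    have h4 := eq_zero_of_star_mul_self_add_sum (s := hfin.toFinset)
      (0 : 𝒞.FibreAlgebra (G.s (ρ.σ ω : H))) (fun ω' => 𝒞.toFibreAlgebra _ (b ω'))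
      (by rw [mul_zero, zero_add]; exact h3) (i := ⟨ω, rfl⟩) (hfin.mem_toFinset.2 hω)
    have h5 := h2 ⟨ω, rfl⟩
    rw [h4, mul_zero, ← map_zero (𝒞.toFibreAlgebra (G.s (ρ.σ ω : H)))] at h5
    have h6 := 𝓔.eq_zero_of_fibreInner_self 𝒞 _ _ ((𝒞.toFibreAlgebra _).injective h5)
    exact hω ((Fibre.cast_eq_zero _ _).1 h6)
  · intro ω' hω'
    rw [Set.Finite.coe_toFinset]
    exact fun h0 => hω' (by simp [h0])

end HilbertAction

end GroupoidCrossedProduct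

/-! ### The crossed product Hilbert module -/

theorem mainTheorem4
    {H : Type uH} [TopologicalSpace H] [T2Space H] (G : EtaleGroupoid H)
    {C : Type uC} [NonUnitalCStarAlgebra C] (𝒞 : C0Algebra G.units C) (α : CStarAction G 𝒞)
    {E : Type uE} [NormedAddCommGroup E] [NormedSpace ℂ E] (𝓔 : HilbertModule C E)
    (β : HilbertAction α 𝓔)
    {Ω : Type uΩ} [TopologicalSpace Ω] [T2Space Ω] (ρ : RightSpaceAction G Ω)
    (hfree : ρ.IsFree) (hproper : ρ.IsProper) (hetale : ρ.IsEtale) :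
    (∀ a b : α.Sections, α.conv a.1 b.1 ∈ α.Sections) ∧
    (∀ a : α.Sections, α.invol a.1 ∈ α.Sections) ∧
    ∃ j : α.Sections →ₗ[ℂ] α.CrossedProduct, α.IsCanonicalMap j ∧
    ∃ (hinner : ∀ ξ η : β.Sections ρ, β.sectionInner ρ ξ.1 η.1 ∈ α.Sections)
      (hrsmul : ∀ (ξ : β.Sections ρ) (c : α.Sections),
        β.sectionRsmul ρ ξ.1 c.1 ∈ β.Sections ρ)
      (F : Type (max uE uΩ)) (_ : NormedAddCommGroup F) (_ : NormedSpace ℂ F)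
      (𝓕 : HilbertModule α.CrossedProduct F) (ι : β.Sections ρ →ₗ[ℂ] F),
      Function.Injective ι ∧ DenseRange ι ∧
      (∀ ξ η : β.Sections ρ, 𝓕.inner (ι ξ) (ι η) = j ⟨β.sectionInner ρ ξ.1 η.1, hinner ξ η⟩) ∧
      (∀ (ξ : β.Sections ρ) (c : α.Sections),
        𝓕.rsmul (ι ξ) (j c) = ι ⟨β.sectionRsmul ρ ξ.1 c.1, hrsmul ξ c⟩) := by
  have hinner : ∀ ξ η : β.Sections ρ, β.sectionInner ρ ξ.1 η.1 ∈ α.Sections := fun ξ η =>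
    β.sectionInner_mem ρ hproper hetale ξ.2 η.2
  have hrsmul : ∀ (ξ : β.Sections ρ) (c : α.Sections),
      β.sectionRsmul ρ ξ.1 c.1 ∈ β.Sections ρ := fun ξ c => β.sectionRsmul_mem ρ ξ.2 c.2
  refine ⟨fun a b => α.conv_mem a.2 b.2, fun a => α.invol_mem a.2, α.canonicalMap,
    α.isCanonicalMap_canonicalMap, hinner, hrsmul, ?_⟩
  -- Only the identity `⟨ξ, η · c⟩ = ⟨ξ, η⟩ * c` is needed about the action; the module axioms
  -- follow in the completion.
  refine exists_hilbertModule_completion (S := α.Sections) (V := β.Sections ρ) α.canonicalMap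
    α.denseRange_canonicalMap (fun ξ η => α.canonicalMap ⟨β.sectionInner ρ ξ.1 η.1, hinner ξ η⟩)
    (fun ξ c => ⟨β.sectionRsmul ρ ξ.1 c.1, hrsmul ξ c⟩) (fun ξ η ζ => ?_) (fun ξ η z => ?_)
    (fun ξ η => ?_) (fun ξ => ?_) (fun ξ h => ?_) (fun ξ η c => ?_) (fun ξ η => ⟨_, rfl⟩)
  · exact (congrArg α.canonicalMap
      (Subtype.ext (β.sectionInner_add_right ρ hetale ξ.2 η.1 ζ.1))).trans
        (α.canonicalMap.map_add ⟨_, hinner ξ η⟩ ⟨_, hinner ξ ζ⟩)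
  · exact (congrArg α.canonicalMap (Subtype.ext (β.sectionInner_smul_right ρ ξ.1 z η.1))).trans
      (α.canonicalMap.map_smul z ⟨_, hinner ξ η⟩)
  · exact (α.canonicalMap_invol ⟨_, hinner ξ η⟩).symm.trans
      (congrArg α.canonicalMap (Subtype.ext (β.invol_sectionInner ρ ξ.1 η.1)))
  · obtain ⟨n, m, b, hb⟩ := β.exists_sectionInner_self_eq_sum ρ hproper hetale ξ.2
    exact α.exists_canonicalMap_eq_star_mul_self ⟨_, hinner ξ ξ⟩ b hb
  -- Injectivity of `j` transfers definiteness from sections to the crossed product, so no quotient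
  -- is formed.
  · have h1 := α.canonicalMap_injective (h.trans α.canonicalMap.map_zero.symm)
    exact Subtype.ext (β.eq_zero_of_sectionInner_self ρ hetale ξ.2 (congrArg Subtype.val h1))
  · exact (congrArg α.canonicalMap
      (Subtype.ext (β.sectionInner_sectionRsmul ρ hetale ξ.2 c.2 η.1))).trans
        (α.canonicalMap_conv ⟨_, hinner ξ η⟩ c)
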